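/- Let $\tau$ be the tautological line bundle over $S^2\cong\mathbb{CP}^1$, where $S^2\subset\mathbb R^3$ is oriented by its outward normal and the point with polar angle $\theta$ and azimuth $\phi$ corresponds to the line $[\sin\frac\theta2e^{i\phi}:\cos\frac\theta2]$. Its unit circle bundle is the Hopf fibration $S^3\to S^2$, and parallel transport is taken for the Chern connection of $\tau$. Let $L=\tau^\vee$, and let $V_k=H^0(S^2,L^k)$ be the space of homogeneous polynomials of degree $k$ in two variables, with the inner product $\langle s,s'\rangle=\int_{S^2}(s(x),s'(x))_x\,\tfrac12\sin\theta\,d\theta\,d\phi$, antilinear in the first slot. For $p\in S^3$, the coherent state $\psi^{(k)}_p\in V_k$ is defined by $\langle\psi^{(k)}_p,s\rangle=s[p^{\otimes k}]$ for all $s\in V_k$. Let $\gamma,\sigma$ be smooth simple closed oriented curves on $S^2$, of lengths $T_\gamma,T_\sigma$ and parameterized by arclength, for the Kähler metric (one half of the standard metric of the unit sphere). Let $\tilde\gamma,\tilde\sigma$ be parallel-transported lifts of them to $S^3$, and $\Psi^{(k)}_{\tilde\gamma}=\int_0^{T_\gamma}\psi^{(k)}_{\tilde\gamma(t)}\,dt$,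 $\Psi^{(k)}_{\tilde\sigma}=\int_0^{T_\sigma}\psi^{(k)}_{\tilde\sigma(t)}\,dt$. Suppose that $\gamma$ and $\sigma$ are Bohr–Sommerfeld loops, that is, the holonomy of each is a $k$th root of unity for some $k\ge1$ (such a $k$ is called a Bohr–Sommerfeld value of the loop). Suppose that $\gamma$ and $\sigma$ meet in exactly two points $p$ and $n$, transversely, with the same angle $\nu\in(0,\pi)$ between $\gamma'$ and $\sigma'$ at both points, where $p$ is the positive point: rotating $\gamma'$ to $\sigma'$ at $p$ agrees with the orientation of $S^2$. Let $A$ be the spherical area (total area of $S^2$ being $4\pi$) of the region to the right of $\gamma$ and to the left of $\sigma$, and suppose that the relative phase of the lifts is such that $\tilde\gamma_p=e^{iA/4}\tilde\sigma_p$. Then, as $k\to\infty$ through the joint Bohr–Sommerfeld values of $\gamma$ and $\sigma$, $$\left\langle\Psi^{(k)}_{\tilde\gamma},\Psi^{(k)}_{\tilde\sigma}\right\rangle=\sqrt{\frac{8}{\sin\nu}}\,\cos\left(\frac{kA}{4}+\frac\nu2-\frac\pi4\right)+o(1).$$ -/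

import Mathlib

open MeasureTheory Filter Topology Set Real
open scoped ContDiff

noncomputable section

namespace CoherentLoop

/-- Euclidean three-space; `S²` is its unit sphere, oriented by the outward normal. -/
abbrev E3 : Type := EuclideanSpace ℝ (Fin 3)

/-- `ℂ²`; the unit circle bundle of the tautological line bundle over `S² = ℂℙ¹` is its unit
sphere `S³`. -/
abbrev C2 : Type := EuclideanSpace ℂ (Fin 2)

/-! ### The sphere, the Hopf fibration and the area -/

/-- The point of `S²` with polar angle `θ = y.1` and azimuth `φ = y.2`. -/
def spherePoint (y : ℝ × ℝ) : E3 :=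
  !₂[sin y.1 * cos y.2, sin y.1 * sin y.2, cos y.1]

/-- The unit vector `u(θ, φ) = (sin (θ/2) e^{iφ}, cos (θ/2))` in the Hopf fibre over
`spherePoint (θ, φ)`. -/
def fibrePoint (y : ℝ × ℝ) : C2 :=
  !₂[(sin (y.1 / 2) : ℂ) * Complex.exp (Complex.I * (y.2 : ℂ)), (cos (y.1 / 2) : ℂ)]

/-- The Hopf map `S³ → S²`, sending a unit vector `q` to the line `[q₁ : q₂]`, where `ℂℙ¹` is
identified with `S²` by stereographic projection from the south pole, `z = q₁ / q₂`. -/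
def hopf (q : C2) : E3 :=
  !₂[2 * (q 0 * star (q 1)).re, 2 * (q 0 * star (q 1)).im, ‖q 1‖ ^ 2 - ‖q 0‖ ^ 2]

/-- The measure `sin θ dθ dφ` on the coordinate rectangle `0 < θ < π`, `0 < φ < 2π`. -/
def coordMeasure : Measure (ℝ × ℝ) :=
  (volume.restrict (Ioo 0 π ×ˢ Ioo 0 (2 * π))).withDensity fun y => ENNReal.ofReal (sin y.1)

/-- The standard area measure of the unit sphere `S²` (total mass `4π`), in spherical
coordinates. The Kähler area form is one half of it. -/
def sphereArea : Measure E3 := coordMeasure.map spherePoint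

/-! ### The holomorphic sections of `L^k` -/

/-- The space `V_k = H⁰(ℂℙ¹, L^k)`, where `L` is the dual of the tautological line bundle: the
homogeneous polynomials of degree `k` in two variables. -/
def V (k : ℕ) : Type := MvPolynomial.homogeneousSubmodule (Fin 2) ℂ k

instance (k : ℕ) : AddCommGroup (V k) :=
  inferInstanceAs (AddCommGroup (MvPolynomial.homogeneousSubmodule (Fin 2) ℂ k))

instance (k : ℕ) : Module ℂ (V k) :=
  inferInstanceAs (Module ℂ (MvPolynomial.homogeneousSubmodule (Fin 2) ℂ k))

/-- The polynomial underlying a section. -/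
def poly (k : ℕ) : V k →ₗ[ℂ] MvPolynomial (Fin 2) ℂ :=
  (MvPolynomial.homogeneousSubmodule (Fin 2) ℂ k).subtype

/-- The evaluation `s ↦ s[p^{⊗k}]` of sections of `L^k` at a vector `p` of a fibre of the
tautological bundle. -/
def evalAt (k : ℕ) (p : C2) : V k →ₗ[ℂ] ℂ :=
  (MvPolynomial.aeval (R := ℂ) (fun i => p i)).toLinearMap ∘ₗ poly k

/-- The global inner product `∫_{S²} (s(x), s'(x))_x vol_x`, antilinear in the first slot. In the
fibre over `x`, `(s(x), s'(x))_x = conj (s[q]) * s'[q]` for any unit vector `q` over `x`; the volume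
form is `(1/2) sin θ dθ dφ`. -/
def globalInner (k : ℕ) (s s' : V k) : ℂ :=
  (1 / 2 : ℂ) * ∫ y, star (evalAt k (fibrePoint y) s) * evalAt k (fibrePoint y) s' ∂coordMeasure

theorem continuous_fibrePoint : Continuous fibrePoint := by
  unfold fibrePoint
  refine (PiLp.continuous_toLp 2 _).comp (continuous_pi fun i => ?_)
  fin_cases i <;> simp <;> fun_prop

theorem continuous_evalAt (k : ℕ) (s : V k) : Continuous fun y => evalAt k (fibrePoint y) s := by
  have h : Continuous fun q : C2 => evalAt k q s := by
    have h1 : ∀ q : C2, evalAt k q s = MvPolynomial.eval (fun i => q i) (poly k s) := fun q => by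
      simp [evalAt, MvPolynomial.aeval_eq_eval]
    simp only [h1]
    exact (MvPolynomial.continuous_eval _).comp (by fun_prop)
  exact h.comp continuous_fibrePoint

theorem evalAt_smul (k : ℕ) (c : ℂ) (q : C2) (s : V k) :
    evalAt k (c • q) s = c ^ k * evalAt k q s := by
  have h := (show (poly k s).IsHomogeneous k from s.2)
  simp only [evalAt, LinearMap.comp_apply, AlgHom.toLinearMap_apply, MvPolynomial.aeval_def]
  rw [MvPolynomial.eval₂_eq', MvPolynomial.eval₂_eq', Finset.mul_sum]
  refine Finset.sum_congr rfl fun d hd => ?_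
  have hdeg := h (MvPolynomial.mem_support_iff.mp hd)
  have : ∑ i, d i = k := by
    rw [← hdeg, Finsupp.weight_apply, Finsupp.sum_fintype _ _ (by simp)]
    simp
  simp only [PiLp.smul_apply, smul_eq_mul, mul_pow, Finset.prod_mul_distrib,
    Finset.prod_pow_eq_pow_sum, this]
  ring

theorem integrable_coord {f : ℝ × ℝ → ℂ} (hf : Continuous f) : Integrable f coordMeasure := by
  have h1 : Integrable f (volume.restrict (Icc 0 π ×ˢ Icc 0 (2 * π))) :=
    hf.continuousOn.integrableOn_compact (isCompact_Icc.prod isCompact_Icc)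
  refine h1.mono_measure ?_
  refine le_trans (withDensity_mono (g := 1) (Eventually.of_forall fun y => ?_)) ?_
  · simpa using sin_le_one y.1
  · rw [withDensity_one]
    exact Measure.restrict_mono (Set.prod_mono Ioo_subset_Icc_self Ioo_subset_Icc_self) le_rfl

theorem integrable_fibre (k : ℕ) (s s' : V k) : Integrable
    (fun y => star (evalAt k (fibrePoint y) s) * evalAt k (fibrePoint y) s') coordMeasure :=
  integrable_coord ((continuous_evalAt k s).star.mul (continuous_evalAt k s'))

theorem globalInner_self (k : ℕ) (s : V k) : globalInner k s s =
    (((1 / 2 : ℝ) * ∫ y, ‖evalAt k (fibrePoint y) s‖ ^ 2 ∂coordMeasure : ℝ) : ℂ) := by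
  unfold globalInner
  have : ∀ y, star (evalAt k (fibrePoint y) s) * evalAt k (fibrePoint y) s =
      ((‖evalAt k (fibrePoint y) s‖ ^ 2 : ℝ) : ℂ) := fun y => by
    simpa using Complex.conj_mul' (evalAt k (fibrePoint y) s)
  simp only [this, integral_complex_ofReal]
  push_cast
  ring

theorem eq_zero_of_globalInner_self (k : ℕ) (s : V k) (h : globalInner k s s = 0) : s = 0 := by
  rw [globalInner_self] at h
  have h0 : ∫ y, ‖evalAt k (fibrePoint y) s‖ ^ 2 ∂coordMeasure = 0 := by
    have := Complex.ofReal_eq_zero.mp h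
    linarith
  have hc := continuous_evalAt k s
  have hint : Integrable (fun y => ‖evalAt k (fibrePoint y) s‖ ^ 2) coordMeasure := by
    have := (integrable_coord (f := fun y => evalAt k (fibrePoint y) s * evalAt k (fibrePoint y) s)
      (hc.mul hc)).norm
    simpa [sq] using this
  rw [integral_eq_zero_iff_of_nonneg (fun y => sq_nonneg _) hint] at h0
  have hm : Measurable fun y : ℝ × ℝ => ENNReal.ofReal (sin y.1) := by fun_prop
  have h1 := (ae_withDensity_iff hm).mp h0
  have hU : IsOpen (Ioo 0 π ×ˢ Ioo 0 (2 * π)) := isOpen_Ioo.prod isOpen_Ioo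
  have h2 : (fun y => evalAt k (fibrePoint y) s)
      =ᵐ[volume.restrict (Ioo 0 π ×ˢ Ioo 0 (2 * π))] fun _ => (0 : ℂ) := by
    filter_upwards [h1, ae_restrict_mem hU.measurableSet] with y hy hyU
    have hs : 0 < sin y.1 := sin_pos_of_mem_Ioo hyU.1
    simpa using hy (by simpa using hs)
  have h3 := Measure.eqOn_open_of_ae_eq h2 hU hc.continuousOn continuousOn_const
  set e : ℂ := Complex.exp (Complex.I * ((1 : ℝ) : ℂ)) with he
  have key : ∀ r t : ℝ, 0 < r → 0 < t →
      MvPolynomial.aeval (R := ℂ) ![(r : ℂ) * e, (t : ℂ)] (poly k s) = 0 := by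
    intro r t hr ht
    have hy : (2 * arctan (r / t), (1 : ℝ)) ∈ Ioo 0 π ×ˢ Ioo 0 (2 * π) := by
      refine ⟨⟨?_, ?_⟩, ⟨one_pos, ?_⟩⟩
      · have := arctan_pos.mpr (div_pos hr ht)
        show 0 < 2 * arctan (r / t)
        linarith
      · have := arctan_lt_pi_div_two (r / t)
        show 2 * arctan (r / t) < π
        linarith
      · have := pi_gt_three
        show (1 : ℝ) < 2 * π
        linarith
    have h4 := h3 hy
    simp only at h4
    have hcos : 0 < cos (arctan (r / t)) := cos_arctan_pos _
    have h5 := evalAt_smul k ((t / cos (arctan (r / t)) : ℝ) : ℂ)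
      (fibrePoint (2 * arctan (r / t), (1 : ℝ))) s
    rw [h4, mul_zero] at h5
    have hsin : t / cos (arctan (r / t)) * sin (arctan (r / t)) = r := by
      have h6 := tan_arctan (r / t)
      rw [tan_eq_sin_div_cos] at h6
      field_simp at h6 ⊢
      linarith
    have hcos' : t / cos (arctan (r / t)) * cos (arctan (r / t)) = t := by
      field_simp
    have hvec : (fun i => (((t / cos (arctan (r / t)) : ℝ) : ℂ) •
        fibrePoint (2 * arctan (r / t), (1 : ℝ))) i) = ![(r : ℂ) * e, (t : ℂ)] := by
      have ha : 2 * arctan (r / t) / 2 = arctan (r / t) := by ring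
      ext i
      fin_cases i
      · simp only [fibrePoint, ha, PiLp.smul_apply, smul_eq_mul]
        show (((t / cos (arctan (r / t)) : ℝ) : ℂ)) * ((sin (arctan (r / t)) : ℂ) * e) = (r : ℂ) * e
        rw [← mul_assoc, ← Complex.ofReal_mul, hsin]
      · simp only [fibrePoint, ha, PiLp.smul_apply, smul_eq_mul]
        show (((t / cos (arctan (r / t)) : ℝ) : ℂ)) * (cos (arctan (r / t)) : ℂ) = (t : ℂ)
        rw [← Complex.ofReal_mul, hcos']
    simp only [evalAt, LinearMap.comp_apply, AlgHom.toLinearMap_apply] at h5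
    rwa [hvec] at h5
  have hpoly : poly k s = 0 := by
    have hinf : (Ioi (0 : ℝ)).Infinite := Ioi_infinite 0
    refine MvPolynomial.funext_set
      ![(fun r : ℝ => (r : ℂ) * e) '' Ioi 0, (fun t : ℝ => (t : ℂ)) '' Ioi 0] ?_ ?_
    · intro i
      fin_cases i
      · refine hinf.image fun a _ b _ hab => ?_
        exact Complex.ofReal_injective (mul_right_cancel₀ (Complex.exp_ne_zero _) hab)
      · exact hinf.image fun a _ b _ hab => Complex.ofReal_injective hab
    · intro x hx
      obtain ⟨r, hr, hr'⟩ := hx 0 (mem_univ _)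
      obtain ⟨t, ht, ht'⟩ := hx 1 (mem_univ _)
      have hx' : x = ![(r : ℂ) * e, (t : ℂ)] := by
        ext i
        fin_cases i
        · exact hr'.symm
        · exact ht'.symm
      rw [map_zero, hx', ← MvPolynomial.coe_aeval_eq_eval]
      exact key r t hr ht
  exact Subtype.ext hpoly

/-- `V_k` with its global inner product. -/
@[reducible]
def innerCore (k : ℕ) : InnerProductSpace.Core ℂ (V k) where
  inner := globalInner k
  conj_inner_symm s s' := by
    unfold globalInner
    rw [map_mul, ← integral_conj]
    congr 1
    · rw [map_div₀, map_one, map_ofNat]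
    · refine integral_congr_ae (Eventually.of_forall fun y => ?_)
      simp [mul_comm]
  re_inner_nonneg s := by
    show 0 ≤ RCLike.re (globalInner k s s)
    rw [globalInner_self]
    show 0 ≤ (((1 / 2 : ℝ) * ∫ y, ‖evalAt k (fibrePoint y) s‖ ^ 2 ∂coordMeasure : ℝ) : ℂ).re
    rw [Complex.ofReal_re]
    have : 0 ≤ ∫ y, ‖evalAt k (fibrePoint y) s‖ ^ 2 ∂coordMeasure :=
      integral_nonneg fun y => sq_nonneg _
    positivity
  add_left s s' s'' := by
    show globalInner k (s + s') s'' = globalInner k s s'' + globalInner k s' s''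
    unfold globalInner
    rw [← mul_add, ← integral_add (integrable_fibre k s s'') (integrable_fibre k s' s'')]
    simp only [map_add, star_add, add_mul]
  smul_left s s' c := by
    show globalInner k (c • s) s' = (starRingEnd ℂ) c * globalInner k s s'
    unfold globalInner
    rw [mul_left_comm, ← integral_const_mul ((starRingEnd ℂ) c)]
    congr 1
    refine integral_congr_ae (Eventually.of_forall fun y => ?_)
    simp [mul_assoc]
  definite s h := eq_zero_of_globalInner_self k s h

instance (k : ℕ) : NormedAddCommGroup (V k) :=
  @InnerProductSpace.Core.toNormedAddCommGroup ℂ (V k) _ _ _ (innerCore k)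

instance (k : ℕ) : InnerProductSpace ℂ (V k) :=
  InnerProductSpace.ofCore (innerCore k).toCore

instance (k : ℕ) : FiniteDimensional ℂ (V k) :=
  Module.Finite.iff_fg.mpr (MvPolynomial.homogeneousSubmodule_fg (σ := Fin 2) (R := ℂ) k)

instance (k : ℕ) : CompleteSpace (V k) := FiniteDimensional.complete ℂ (V k)

theorem inner_eq_globalInner (k : ℕ) (s s' : V k) : inner ℂ s s' = globalInner k s s' := rfl

/-! ### Coherent states and coherent loop states -/

/-- The coherent state `ψ_p^{(k)} ∈ V_k`: the vector which represents the evaluation at `p^{⊗k}`,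
that is, `⟨ψ_p, s⟩ = s[p^{⊗k}]` for all `s`. -/
def coherentState (k : ℕ) (p : C2) : V k :=
  (InnerProductSpace.toDual ℂ (V k)).symm (LinearMap.toContinuousLinearMap (evalAt k p))

theorem inner_coherentState (k : ℕ) (p : C2) (s : V k) :
    inner ℂ (coherentState k p) s = evalAt k p s := by
  rw [coherentState, InnerProductSpace.toDual_symm_apply]
  rfl

/-- The coherent loop state `∫₀ᵀ ψ^{(k)}_{c(t)} dt ∈ V_k` of a curve `c` in `S³`. -/
def loopState (k : ℕ) (c : ℝ → C2) (T : ℝ) : V k := ∫ t in (0 : ℝ)..T, coherentState k (c t)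

/-! ### Loops on the sphere -/

/-- `γ` is a smooth simple closed curve on `S²`, as a `T`-periodic map that is injective on a
period and parameterized by arclength for the Kähler metric. That metric is one half of the
standard metric of the unit sphere, so unit speed means Euclidean speed `√2`. -/
structure IsLoop (γ : ℝ → E3) (T : ℝ) : Prop where
  pos : 0 < T
  smooth : ContDiff ℝ ∞ γ
  mem_sphere : ∀ t, ‖γ t‖ = 1
  periodic : ∀ t, γ (t + T) = γ t
  injOn : InjOn γ (Ico 0 T)
  speed : ∀ t, ‖deriv γ t‖ = √2

/-- `c` is a parallel-transported lift of `γ` to `S³`: it lies over `γ`, and its velocity has no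
component along the fibre, so that it is parallel for the Chern connection of the tautological
bundle, which is the orthogonal projection of the trivial connection of `ℂ²`. -/
structure IsParallelLift (c : ℝ → C2) (γ : ℝ → E3) : Prop where
  differentiable : Differentiable ℝ c
  norm_eq : ∀ t, ‖c t‖ = 1
  lies_over : ∀ t, hopf (c t) = γ t
  parallel : ∀ t, inner ℂ (c t) (deriv c t) = 0

/-- The holonomy around a loop of period `T` with parallel lift `c`: the number `h` with
`c T = h • c 0`. It does not depend on the lift. -/
def holonomy (c : ℝ → C2) (T : ℝ) : ℂ := inner ℂ (c 0) (c T)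

/-- The loop of period `T` with parallel lift `c` is Bohr-Sommerfeld of order `k`. -/
def IsBohrSommerfeld (c : ℝ → C2) (T : ℝ) (k : ℕ) : Prop := 0 < k ∧ holonomy c T ^ k = 1

/-- The cross product of `ℝ³`. -/
def cross (a b : E3) : E3 := WithLp.toLp 2 (crossProduct a.ofLp b.ofLp)

/-- Tangent vectors `v, w` at `x ∈ S²` form a positive basis iff `orient x v w > 0`, a negative one
iff `orient x v w < 0`, and are linearly dependent iff it vanishes. -/
def orient (x v w : E3) : ℝ := inner ℝ x (cross v w)

/-- The point of `S²` obtained from `γ t` by a displacement `ε` in the direction of `γ t × γ' t`,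
which is the normal direction pointing to the left of `γ`, seen from outside the sphere. -/
def displaced (γ : ℝ → E3) (t ε : ℝ) : E3 :=
  ‖γ t + ε • cross (γ t) (deriv γ t)‖⁻¹ • (γ t + ε • cross (γ t) (deriv γ t))

/-- The connected component of `x` in the complement of the curve `γ` in `S²`. -/
def component (γ : ℝ → E3) (x : E3) : Set E3 :=
  connectedComponentIn (Metric.sphere (0 : E3) 1 \ range γ) x

/-- The region to the left of `γ`: the component of the complement of `γ` which the points slightly
to the left of `γ` belong to. -/
def leftRegion (γ : ℝ → E3) : Set E3 :=
  {x | ∃ t, ∀ᶠ ε in 𝓝[>] (0 : ℝ), x ∈ component γ (displaced γ t ε)}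

/-- The region to the right of `γ`. -/
def rightRegion (γ : ℝ → E3) : Set E3 :=
  {x | ∃ t, ∀ᶠ ε in 𝓝[<] (0 : ℝ), x ∈ component γ (displaced γ t ε)}

/-- The limit `k → ∞` through the joint Bohr-Sommerfeld values of two loops, of periods `T` and
`S`, with parallel lifts `c` and `d`. -/
def jointBohrSommerfeld (c : ℝ → C2) (T : ℝ) (d : ℝ → C2) (S : ℝ) : Filter ℕ :=
  atTop ⊓ 𝓟 {k | IsBohrSommerfeld c T k ∧ IsBohrSommerfeld d S k}

end CoherentLoop

end

open CoherentLoop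

/-!
The pairing of two loop states is a double integral over the loops: by the reproducing property of
the coherent states it equals `(k + 1) / (2 π) ∬ ⟨d s, c t⟩ ^ k` (`inner_loopState`). The overlap
satisfies `|⟨d s, c t⟩|² = 1 - |γ t - σ s|² / 4` (`norm_overlap_sq`), so that for large `k` only the
two meeting points contribute, and Laplace's method applies there (`laplace_origin`,
`laplace_crossing`, `laplace_period`). At a crossing where `c = u • d`, the quadratic form is given
by the scalar product and the orientation of the two velocities (`inner_deriv_deriv`), and the
Gaussian integral (`integral_crossForm`) gives the contribution
`u ^ k √(2 / sin ν) e^{± i (ν / 2 - π / 4)}` with the sign of the crossing. For joint Bohr-Sommerfeld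
values the integrand is periodic, so that the periods of integration may be chosen with the two
crossings in their interiors (`integral_pairing_shift`).

It remains to show that the crossing at `n` is negative, and that the relative phase of the lifts,
which is `e^{iA/4}` at `p`, is `e^{-iA/4}` at `n`; the two contributions are then conjugate to each
other and add up to the cosine. Stokes' theorem for the region between the curves, which need not
have an accessible shape, is avoided as follows. A vector `q` over a point `x` of the sphere defines
a holomorphic section `wedge q` of `L`, which vanishes at `x` only. Along a parallel lift, its
argument changes by a quantity `angleChange` that depends only on the base curve and on `x`
(`exp_angleChange`). As a function of `x`, this quantity

* is continuous away from the curve, and jumps by `2 π` across it (`tendsto_jump`);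
* has mean value zero over the sphere, because the rate of change is odd under the reflection in the
  plane spanned by the position and the velocity (`IsLoop.integral_angleChange`).

For one closed loop the change of argument is constant modulo `2 π` off the loop, hence locally
constant. It takes values on the left and on the right of the loop which differ by `2 π`, so that the
left and the right region are disjoint (`IsLoop.disjoint_regions`). Hence the arcs of each loop
between the meeting points alternate between the two sides of the other one
(`IsCrossingPair.arcs`), and the crossing at `n` is negative (`IsCrossingPair.orient_nonpos`).

For the digon formed by the arcs of `σ` and `γ` which end at `p`, the change of argument is modulo
`2 π` the change of the relative phase of the lifts, for every `x`. Comparing the jumps, it is a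
constant `w` plus `2 π` times the indicator function of the region to the right of `γ` and to the
left of `σ` (`IsCrossingPair.exists_digonPhase_eq`). As the mean value is zero, `w = -A / 2`, which
is the change of the relative phase (`IsCrossingPair.phase_eq`).
-/

noncomputable section

namespace CoherentLoop

/-! ### The Hopf map and parallel lifts -/

/-- The determinant of two vectors of `ℂ²`. As a function of `c` it is, up to a scalar, the section
of `L` vanishing at the point of the sphere under `q`. -/
def wedge (q c : C2) : ℂ := q 0 * c 1 - q 1 * c 0

/-- The vector `(-conj c₁, conj c₀)`, which spans the orthogonal complement of `c`. -/
def perp (c : C2) : C2 := !₂[-star (c 1), star (c 0)]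

/-- The image of the vector `l • perp c` under the differential of the Hopf map at `c`. -/
def tangent (c : C2) (l : ℂ) : E3 :=
  !₂[2 * (star l * c 0 ^ 2 - l * star (c 1) ^ 2).re, 2 * (star l * c 0 ^ 2 - l * star (c 1) ^ 2).im,
    4 * (l * star (c 0) * star (c 1)).re]

theorem inner_C2 (p q : C2) : inner ℂ p q = star (p 0) * q 0 + star (p 1) * q 1 := by
  simp [PiLp.inner_apply, Fin.sum_univ_two, mul_comm]

theorem inner_E3 (x y : E3) : inner ℝ x y = x 0 * y 0 + x 1 * y 1 + x 2 * y 2 := by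
  simp [PiLp.inner_apply, Fin.sum_univ_three, mul_comm]

theorem normSq_C2 (c : C2) : ‖c‖ ^ 2 = Complex.normSq (c 0) + Complex.normSq (c 1) := by
  rw [EuclideanSpace.norm_sq_eq, Fin.sum_univ_two, Complex.normSq_eq_norm_sq,
    Complex.normSq_eq_norm_sq]

theorem norm_eq_one_iff (c : C2) :
    ‖c‖ = 1 ↔ (c 0).re ^ 2 + (c 0).im ^ 2 + (c 1).re ^ 2 + (c 1).im ^ 2 = 1 := by
  have h := normSq_C2 c
  rw [Complex.normSq_apply, Complex.normSq_apply] at h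
  constructor
  · intro h1
    rw [h1] at h
    linarith
  · intro h1
    have h2 : ‖c‖ ^ 2 = 1 := by rw [h]; linarith
    exact (pow_eq_one_iff_of_nonneg (norm_nonneg c) two_ne_zero).1 h2

theorem hopf_zero (c : C2) :
    hopf c 0 = 2 * ((c 0).re * (c 1).re + (c 0).im * (c 1).im) := by
  simp [hopf]

theorem hopf_one (c : C2) :
    hopf c 1 = 2 * ((c 0).im * (c 1).re - (c 0).re * (c 1).im) := by
  simp [hopf]
  ring

theorem hopf_two (c : C2) :
    hopf c 2 = (c 1).re ^ 2 + (c 1).im ^ 2 - (c 0).re ^ 2 - (c 0).im ^ 2 := by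
  simp only [hopf, ← Complex.normSq_eq_norm_sq, Complex.normSq_apply]
  simp
  ring

@[simp] theorem cross_zero (a b : E3) : cross a b 0 = a 1 * b 2 - a 2 * b 1 := by
  simp [cross, crossProduct]

@[simp] theorem cross_one (a b : E3) : cross a b 1 = a 2 * b 0 - a 0 * b 2 := by
  simp [cross, crossProduct]

@[simp] theorem cross_two (a b : E3) : cross a b 2 = a 0 * b 1 - a 1 * b 0 := by
  simp [cross, crossProduct]

theorem tangent_zero (c : C2) (l : ℂ) : tangent c l 0 =
    2 * (l.re * ((c 0).re ^ 2 - (c 0).im ^ 2 - (c 1).re ^ 2 + (c 1).im ^ 2) +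
      2 * l.im * ((c 0).re * (c 0).im - (c 1).re * (c 1).im)) := by
  simp [tangent, pow_two]
  ring

theorem tangent_one (c : C2) (l : ℂ) : tangent c l 1 =
    2 * (2 * l.re * ((c 0).re * (c 0).im + (c 1).re * (c 1).im) -
      l.im * ((c 0).re ^ 2 - (c 0).im ^ 2 + (c 1).re ^ 2 - (c 1).im ^ 2)) := by
  simp [tangent, pow_two]
  ring

theorem tangent_two (c : C2) (l : ℂ) : tangent c l 2 =
    4 * (l.re * ((c 0).re * (c 1).re - (c 0).im * (c 1).im) +
      l.im * ((c 0).re * (c 1).im + (c 0).im * (c 1).re)) := by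
  simp [tangent]
  ring

theorem inner_tangent (c : C2) (hc : ‖c‖ = 1) (l m : ℂ) :
    inner ℝ (tangent c l) (tangent c m) = 4 * (star l * m).re := by
  rw [norm_eq_one_iff] at hc
  have h2 : ((c 0).re ^ 2 + (c 0).im ^ 2 + (c 1).re ^ 2 + (c 1).im ^ 2) ^ 2 = 1 := by
    rw [hc, one_pow]
  simp [inner_E3, tangent, pow_two]
  linear_combination 4 * (l.re * m.re + l.im * m.im) * h2

/-- The complex structure of the tangent plane at `hopf c`, the rotation by a right angle, is the
multiplication of `l` by `i`. -/
theorem cross_tangent (c : C2) (hc : ‖c‖ = 1) (l : ℂ) :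
    cross (hopf c) (tangent c l) = tangent c (Complex.I * l) := by
  rw [norm_eq_one_iff] at hc
  ext i
  fin_cases i
  all_goals
    simp only [Fin.zero_eta, Fin.mk_one, Fin.reduceFinMk, cross_zero, cross_one, cross_two,
      hopf_zero, hopf_one, hopf_two, tangent_zero, tangent_one, tangent_two, Complex.I_mul_re,
      Complex.I_mul_im]
  · linear_combination 2 * (-l.im * ((c 0).re ^ 2 - (c 0).im ^ 2 - (c 1).re ^ 2 + (c 1).im ^ 2) +
      2 * l.re * ((c 0).re * (c 0).im - (c 1).re * (c 1).im)) * hc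
  · linear_combination 2 * (-2 * l.im * ((c 0).re * (c 0).im + (c 1).re * (c 1).im) -
      l.re * ((c 0).re ^ 2 - (c 0).im ^ 2 + (c 1).re ^ 2 - (c 1).im ^ 2)) * hc
  · linear_combination 4 * (-l.im * ((c 0).re * (c 1).re - (c 0).im * (c 1).im) +
      l.re * ((c 0).re * (c 1).im + (c 0).im * (c 1).re)) * hc

theorem orient_eq_inner_cross (x v w : E3) : orient x v w = inner ℝ w (cross x v) := by
  simp only [orient, inner_E3, cross_zero, cross_one, cross_two]
  ring

theorem orient_tangent (c : C2) (hc : ‖c‖ = 1) (l m : ℂ) :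
    orient (hopf c) (tangent c l) (tangent c m) = 4 * (star l * m).im := by
  rw [orient_eq_inner_cross, cross_tangent c hc, inner_tangent c hc]
  simp
  ring

/-- The transition probability of two unit vectors in terms of the points of the sphere under them.
-/
theorem inner_hopf (c d : C2) (hc : ‖c‖ = 1) (hd : ‖d‖ = 1) :
    ‖inner ℂ d c‖ ^ 2 = (1 + inner ℝ (hopf c) (hopf d)) / 2 := by
  rw [norm_eq_one_iff] at hc hd
  rw [inner_C2, ← Complex.normSq_eq_norm_sq, inner_E3]
  simp only [hopf_zero, hopf_one, hopf_two, Complex.normSq_apply]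
  simp
  have h := congr($hc * $hd)
  linear_combination h / 2

theorem norm_wedge_sq (q c : C2) (hq : ‖q‖ = 1) (hc : ‖c‖ = 1) :
    ‖wedge q c‖ ^ 2 = (1 - inner ℝ (hopf q) (hopf c)) / 2 := by
  rw [norm_eq_one_iff] at hc hq
  rw [wedge, ← Complex.normSq_eq_norm_sq, inner_E3]
  simp only [hopf_zero, hopf_one, hopf_two, Complex.normSq_apply]
  simp
  have h := congr($hq * $hc)
  linear_combination h / 2

theorem norm_hopf (c : C2) (hc : ‖c‖ = 1) : ‖hopf c‖ = 1 := by
  rw [norm_eq_one_iff] at hc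
  rw [← pow_eq_one_iff_of_nonneg (norm_nonneg _) two_ne_zero, ← real_inner_self_eq_norm_sq,
    inner_E3, hopf_zero, hopf_one, hopf_two]
  have h := congr($hc * $hc)
  linear_combination h

/-- The logarithmic derivative of `wedge q` along a horizontal direction, up to the positive factor
`‖wedge q c‖ ^ 2`, in terms of the points of the sphere. -/
theorem wedge_perp (q c : C2) (l : ℂ) : star (wedge q c) * wedge q (l • perp c) =
    (-(inner ℝ (hopf q) (tangent c l)) + Complex.I * (inner ℝ (hopf q) (tangent c (Complex.I * l))))
      / 4 := by
  simp only [inner_E3, hopf_zero, hopf_one, hopf_two]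
  apply Complex.ext
  all_goals
    simp [wedge, perp, tangent, pow_two]
    ring

theorem star_mul_self_C2 (c : C2) (hc : ‖c‖ = 1) :
    star (c 0) * c 0 + star (c 1) * c 1 = 1 := by
  rw [← inner_C2, inner_self_eq_norm_sq_to_K, hc]
  simp

theorem norm_perp (c : C2) : ‖perp c‖ = ‖c‖ := by
  simp [EuclideanSpace.norm_eq, perp, add_comm]

/-- Two unit vectors with the same image under the Hopf map lie on a common complex line. -/
theorem eq_smul_of_hopf_eq {c d : C2} (hc : ‖c‖ = 1) (hd : ‖d‖ = 1) (h : hopf c = hopf d) :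
    c = (inner ℂ d c : ℂ) • d := by
  have h1 : wedge d c = 0 := by
    have := norm_wedge_sq d c hd hc
    rw [h, real_inner_self_eq_norm_sq, norm_hopf d hd] at this
    simpa using this
  have h2 := star_mul_self_C2 d hd
  unfold wedge at h1
  rw [inner_C2]
  ext i
  fin_cases i <;> simp only [Fin.zero_eta, Fin.mk_one, PiLp.smul_apply, smul_eq_mul]
  · linear_combination (-c 0) * h2 - star (d 1) * h1
  · linear_combination (-c 1) * h2 + star (d 0) * h1

/-- A vector orthogonal to the unit vector `c` is a multiple of `perp c`. -/
theorem eq_smul_perp {c u : C2} (hc : ‖c‖ = 1) (h : inner ℂ c u = 0) :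
    u = wedge c u • perp c := by
  have h2 := star_mul_self_C2 c hc
  rw [inner_C2] at h
  unfold wedge perp
  ext i
  fin_cases i <;> simp
  · simp at h h2
    linear_combination (-u 0) * h2 + c 0 * h
  · simp at h h2
    linear_combination (-u 1) * h2 + c 1 * h

theorem hopf_smul (w : ℂ) (hw : ‖w‖ = 1) (c : C2) : hopf (w • c) = hopf c := by
  have h : w.re ^ 2 + w.im ^ 2 = 1 := by
    have := Complex.normSq_eq_norm_sq w
    rw [hw, Complex.normSq_apply] at this
    linarith
  ext i
  fin_cases i
  all_goals
    simp only [Fin.zero_eta, Fin.mk_one, Fin.reduceFinMk, hopf_zero, hopf_one, hopf_two,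
      PiLp.smul_apply, smul_eq_mul, Complex.mul_re, Complex.mul_im]
  · linear_combination 2 * ((c 0).re * (c 1).re + (c 0).im * (c 1).im) * h
  · linear_combination 2 * ((c 0).im * (c 1).re - (c 0).re * (c 1).im) * h
  · linear_combination ((c 1).re ^ 2 + (c 1).im ^ 2 - (c 0).re ^ 2 - (c 0).im ^ 2) * h

theorem exists_hopf_eq {x : E3} (hx : ‖x‖ = 1) : ∃ q : C2, ‖q‖ = 1 ∧ hopf q = x := by
  have hx2 : x 0 ^ 2 + x 1 ^ 2 + x 2 ^ 2 = 1 := by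
    have := real_inner_self_eq_norm_sq x
    rw [hx, inner_E3] at this
    linarith
  rcases eq_or_ne (x 2) (-1) with h | h
  · refine ⟨!₂[1, 0], by simp [norm_eq_one_iff], ?_⟩
    have h0 : x 0 = 0 := by nlinarith [sq_nonneg (x 0), sq_nonneg (x 1)]
    have h1 : x 1 = 0 := by nlinarith [sq_nonneg (x 0), sq_nonneg (x 1)]
    ext i
    fin_cases i <;> simp [hopf, h, h0, h1]
  · have hpos : 0 < (1 + x 2) / 2 := by
      have : -1 ≤ x 2 := by nlinarith [sq_nonneg (x 0), sq_nonneg (x 1)]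
      have := lt_of_le_of_ne this (Ne.symm h)
      linarith
    set r := √((1 + x 2) / 2) with hr
    have hr2 : r ^ 2 = (1 + x 2) / 2 := Real.sq_sqrt hpos.le
    have hr0 : r ≠ 0 := (Real.sqrt_pos.2 hpos).ne'
    have hs : (x 0 / (2 * r)) ^ 2 + (x 1 / (2 * r)) ^ 2 = (1 - x 2) / 2 := by
      have : 1 + x 2 ≠ 0 := by linarith
      rw [div_pow, div_pow, mul_pow, hr2]
      field_simp
      linear_combination hx2
    refine ⟨!₂[⟨x 0 / (2 * r), x 1 / (2 * r)⟩, ⟨r, 0⟩], ?_, ?_⟩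
    · rw [norm_eq_one_iff]
      simp
      linear_combination hs + hr2
    · ext i
      fin_cases i
      · simp only [Fin.zero_eta, hopf_zero]
        simp
        field_simp
      · simp only [Fin.mk_one, hopf_one]
        simp
        field_simp
      · simp only [Fin.reduceFinMk, hopf_two]
        simp
        linear_combination hr2 - hs

/-- The velocity of a horizontal curve in `S³` over a curve in `S²` which moves with velocity `v`:
half the traceless Hermitian matrix of `v` applied to `c`. As it is given by a formula in `v` and `c`,
a parallel lift solves a linear ordinary differential equation and inherits the smoothness of the
base curve. -/
def horizontalLift (v : E3) (c : C2) : C2 :=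
  !₂[(-(v 2) * c 0 + (v 0 + Complex.I * v 1) * c 1) / 2,
    ((v 0 - Complex.I * v 1) * c 0 + v 2 * c 1) / 2]

theorem horizontalLift_tangent (c : C2) (hc : ‖c‖ = 1) (l : ℂ) :
    horizontalLift (tangent c l) c = l • perp c := by
  rw [norm_eq_one_iff] at hc
  ext i
  fin_cases i
  all_goals
    simp only [Fin.zero_eta, Fin.mk_one, horizontalLift, perp, tangent_zero, tangent_one,
      tangent_two]
    apply Complex.ext
    all_goals simp [pow_two]
  · linear_combination (-l.re * (c 1).re - l.im * (c 1).im) * hc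
  · linear_combination (l.re * (c 1).im - l.im * (c 1).re) * hc
  · linear_combination (l.re * (c 0).re + l.im * (c 0).im) * hc
  · linear_combination (-l.re * (c 0).im + l.im * (c 0).re) * hc

namespace IsParallelLift

variable {c : ℝ → C2} {γ : ℝ → E3}

/-- The complex speed of a parallel lift, in the frame `perp`. -/
def speed (c : ℝ → C2) (t : ℝ) : ℂ := wedge (c t) (deriv c t)

theorem deriv_eq (h : IsParallelLift c γ) (t : ℝ) : deriv c t = speed c t • perp (c t) :=
  eq_smul_perp (h.norm_eq t) (h.parallel t)

theorem hasDerivAt (h : IsParallelLift c γ) (t : ℝ) : HasDerivAt c (deriv c t) t :=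
  (h.differentiable t).hasDerivAt

theorem hasDerivAt_coord (h : IsParallelLift c γ) (t : ℝ) (i : Fin 2) :
    HasDerivAt (fun t => c t i) (deriv c t i) t :=
  (PiLp.proj (𝕜 := ℝ) 2 (fun _ : Fin 2 => ℂ) i).hasFDerivAt.comp_hasDerivAt t (h.hasDerivAt t)

theorem hasDerivAt_base (h : IsParallelLift c γ) (t : ℝ) :
    HasDerivAt γ (tangent (c t) (speed c t)) t := by
  have e : γ = fun t => hopf (c t) := funext fun t => (h.lies_over t).symm
  rw [e]
  have h0 := h.hasDerivAt_coord t 0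
  have h1 := h.hasDerivAt_coord t 1
  rw [h.deriv_eq] at h0 h1
  set l := speed c t
  have r0 := Complex.reCLM.hasFDerivAt.comp_hasDerivAt t h0
  have i0 := Complex.imCLM.hasFDerivAt.comp_hasDerivAt t h0
  have r1 := Complex.reCLM.hasFDerivAt.comp_hasDerivAt t h1
  have i1 := Complex.imCLM.hasFDerivAt.comp_hasDerivAt t h1
  simp only [Function.comp_def, Complex.reCLM_apply, Complex.imCLM_apply] at r0 i0 r1 i1
  have key : HasDerivAt (fun t i => hopf (c t) i) (tangent (c t) l).ofLp t := by
    rw [hasDerivAt_pi]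
    intro i
    fin_cases i
    all_goals
      simp only [Fin.zero_eta, Fin.mk_one, Fin.reduceFinMk, hopf_zero, hopf_one, hopf_two,
        tangent_zero, tangent_one, tangent_two]
    · refine HasDerivAt.congr_deriv (((r0.mul r1).add (i0.mul i1)).const_mul 2) ?_
      simp [perp]
      ring
    · refine HasDerivAt.congr_deriv (((i0.mul r1).sub (r0.mul i1)).const_mul 2) ?_
      simp [perp]
      ring
    · refine HasDerivAt.congr_deriv ((((r1.pow 2).add (i1.pow 2)).sub (r0.pow 2)).sub (i0.pow 2)) ?_
      simp [perp]
      ring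
  exact (PiLp.continuousLinearEquiv 2 ℝ (fun _ : Fin 3 => ℝ)).symm.hasFDerivAt.comp_hasDerivAt t key

theorem deriv_base (h : IsParallelLift c γ) (t : ℝ) :
    deriv γ t = tangent (c t) (speed c t) := (h.hasDerivAt_base t).deriv

theorem deriv_eq_horizontalLift (h : IsParallelLift c γ) (t : ℝ) :
    deriv c t = horizontalLift (deriv γ t) (c t) := by
  rw [h.deriv_base, horizontalLift_tangent _ (h.norm_eq t), h.deriv_eq]

theorem continuous (h : IsParallelLift c γ) : Continuous c := h.differentiable.continuous

theorem differentiable_deriv (h : IsParallelLift c γ) (hγ : ContDiff ℝ ∞ γ) :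
    Differentiable ℝ (deriv c) := by
  have e : deriv c = fun t => horizontalLift (deriv γ t) (c t) :=
    funext fun t => h.deriv_eq_horizontalLift t
  rw [e]
  have hγ' : Differentiable ℝ (deriv γ) :=
    ((contDiff_infty_iff_deriv.1 hγ).2).differentiable (by simp)
  have h1 : ∀ i, Differentiable ℝ fun t => ((deriv γ t i : ℝ) : ℂ) := fun i =>
    Complex.ofRealCLM.differentiable.comp (differentiable_euclidean.1 hγ' i)
  have h2 : ∀ i, Differentiable ℝ fun t => c t i := fun i t =>
    (h.hasDerivAt_coord t i).differentiableAt
  have := h1 0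
  have := h1 1
  have := h1 2
  have := h2 0
  have := h2 1
  have key : Differentiable ℝ fun t i => horizontalLift (deriv γ t) (c t) i := by
    rw [differentiable_pi]
    intro i
    fin_cases i <;> simp [horizontalLift] <;> fun_prop
  exact (PiLp.continuousLinearEquiv 2 ℝ (fun _ : Fin 2 => ℂ)).symm.differentiable.comp key

/-- The translate of a parallel lift by a period differs from it by a phase, which is constant
because both curves are horizontal. -/
theorem add_period (h : IsParallelLift c γ) {T : ℝ} (hT : ∀ t, γ (t + T) = γ t) (t : ℝ) :
    c (t + T) = holonomy c T • c t := by
  set u : ℝ → ℂ := fun t => inner ℂ (c t) (c (t + T)) with hu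
  have hcu : ∀ t, c (t + T) = u t • c t := fun t =>
    eq_smul_of_hopf_eq (h.norm_eq _) (h.norm_eq _) (by rw [h.lies_over, h.lies_over, hT])
  have hd : ∀ t, HasDerivAt u 0 t := fun t => by
    have h1 : HasDerivAt (fun t => c (t + T)) (deriv c (t + T)) t :=
      (h.hasDerivAt (t + T)).comp_add_const t T
    have h2 := (h.hasDerivAt t).inner ℂ h1
    have e1 : inner ℂ (c t) (deriv c (t + T)) = 0 := by
      have e2 := h.parallel (t + T)
      rw [hcu, inner_smul_left] at e2
      refine (mul_eq_zero.1 e2).resolve_left fun e3 => ?_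
      have e4 := h.norm_eq (t + T)
      rw [hcu, (map_eq_zero _).1 e3] at e4
      simp at e4
    have e2 : inner ℂ (deriv c t) (c (t + T)) = 0 := by
      rw [hcu, inner_smul_right, ← inner_conj_symm, h.parallel]
      simp
    rwa [e1, e2, add_zero] at h2
  have hconst := is_const_of_deriv_eq_zero (fun t => (hd t).differentiableAt)
    (fun t => (hd t).deriv) t 0
  rw [hcu t, hconst]
  simp [hu, holonomy]

theorem norm_holonomy (h : IsParallelLift c γ) {T : ℝ} (hT : ∀ t, γ (t + T) = γ t) :
    ‖holonomy c T‖ = 1 := by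
  have := congrArg norm (h.add_period hT 0)
  rw [norm_smul, h.norm_eq, h.norm_eq, mul_one] at this
  exact this.symm

theorem norm_speed_sq (h : IsParallelLift c γ) (t : ℝ) :
    ‖deriv γ t‖ ^ 2 = 4 * ‖speed c t‖ ^ 2 := by
  rw [h.deriv_base, ← real_inner_self_eq_norm_sq, inner_tangent _ (h.norm_eq t),
    ← Complex.normSq_eq_norm_sq, Complex.normSq_apply]
  simp

end IsParallelLift

/-! ### The reproducing kernel -/

theorem integral_coordMeasure_mul (g h : ℝ → ℂ) :
    ∫ y, g y.1 * h y.2 ∂coordMeasure =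
      (∫ t in (0 : ℝ)..π, (sin t : ℂ) * g t) * ∫ t in (0 : ℝ)..(2 * π), h t := by
  unfold coordMeasure
  have hm : Measurable fun y : ℝ × ℝ => ENNReal.ofReal (sin y.1) := by fun_prop
  rw [integral_withDensity_eq_integral_toReal_smul hm (by simp)]
  have h1 : ∀ y ∈ Ioo 0 π ×ˢ Ioo 0 (2 * π), (ENNReal.ofReal (sin y.1)).toReal • (g y.1 * h y.2) =
      ((sin y.1 : ℂ) * g y.1) * h y.2 := by
    intro y hy
    rw [ENNReal.toReal_ofReal (sin_pos_of_mem_Ioo hy.1).le, Complex.real_smul, Complex.ofReal_sin,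
      mul_assoc]
  rw [setIntegral_congr_fun (measurableSet_Ioo.prod measurableSet_Ioo) h1,
    intervalIntegral.integral_of_le pi_pos.le, intervalIntegral.integral_of_le two_pi_pos.le,
    integral_Ioc_eq_integral_Ioo, integral_Ioc_eq_integral_Ioo, Measure.volume_eq_prod,
    ← Measure.prod_restrict]
  exact integral_prod_mul (fun t : ℝ => (sin t : ℂ) * g t) h

/-- A Beta integral, in the angle variable; it is computed by induction on `b` and integration by
parts. -/
theorem integral_half_angle_pow (a b : ℕ) :
    ∫ t in (0 : ℝ)..π, sin t * (sin (t / 2) ^ (2 * a) * cos (t / 2) ^ (2 * b)) =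
      2 * a.factorial * b.factorial / (a + b + 1).factorial := by
  have hs : ∀ t : ℝ, HasDerivAt (fun t => sin (t / 2)) (cos (t / 2) / 2) t := fun t => by
    refine ((hasDerivAt_sin (t / 2)).comp t ((hasDerivAt_id t).div_const 2)).congr_deriv ?_
    ring
  have hc : ∀ t : ℝ, HasDerivAt (fun t => cos (t / 2)) (-(sin (t / 2)) / 2) t := fun t => by
    refine ((hasDerivAt_cos (t / 2)).comp t ((hasDerivAt_id t).div_const 2)).congr_deriv ?_
    ring
  have h2 : ∀ t : ℝ, sin t = 2 * sin (t / 2) * cos (t / 2) := fun t => by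
    rw [← sin_two_mul]
    congr 1
    ring
  induction b generalizing a with
  | zero =>
    have hd : ∀ t : ℝ, HasDerivAt (fun t => 2 * sin (t / 2) ^ (2 * a + 2) / (a + 1))
        (sin t * (sin (t / 2) ^ (2 * a) * cos (t / 2) ^ (2 * 0))) t := fun t => by
      refine ((((hs t).pow (2 * a + 2)).const_mul 2).div_const (a + 1 : ℝ)).congr_deriv ?_
      rw [h2 t]
      push_cast
      field_simp
      ring
    rw [intervalIntegral.integral_eq_sub_of_hasDerivAt (fun t _ => hd t)
      (Continuous.intervalIntegrable (by fun_prop) _ _)]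
    simp [Nat.factorial_succ]
    field_simp
  | succ b ih =>
    have hd : ∀ t : ℝ, HasDerivAt
        (fun t => 2 * (sin (t / 2) ^ (2 * a + 2) * cos (t / 2) ^ (2 * b + 2)))
        ((a + 1) * (sin t * (sin (t / 2) ^ (2 * a) * cos (t / 2) ^ (2 * (b + 1)))) -
          (b + 1) * (sin t * (sin (t / 2) ^ (2 * (a + 1)) * cos (t / 2) ^ (2 * b)))) t := fun t => by
      refine ((((hs t).pow (2 * a + 2)).mul
        ((hc t).pow (2 * b + 2))).const_mul 2).congr_deriv ?_
      rw [h2 t]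
      push_cast
      simp
      ring
    have h0 := intervalIntegral.integral_eq_sub_of_hasDerivAt (a := 0) (b := π) (fun t _ => hd t)
      (Continuous.intervalIntegrable (by fun_prop) _ _)
    rw [intervalIntegral.integral_sub (Continuous.intervalIntegrable (by fun_prop) _ _)
      (Continuous.intervalIntegrable (by fun_prop) _ _), intervalIntegral.integral_const_mul,
      intervalIntegral.integral_const_mul, ih (a + 1)] at h0
    simp at h0
    have e : a + 1 + b + 1 = a + (b + 1) + 1 := by ring
    rw [e] at h0
    have h1 : (a + 1 : ℝ) ≠ 0 := by positivity
    have h3 := eq_of_sub_eq_zero h0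
    apply mul_left_cancel₀ h1
    rw [h3, Nat.factorial_succ a, Nat.factorial_succ b]
    push_cast
    ring

theorem integral_circle_pow (a j : ℕ) :
    ∫ t in (0 : ℝ)..(2 * π), star (Complex.exp (Complex.I * t)) ^ j * Complex.exp (Complex.I * t) ^ a
      = if j = a then 2 * π else 0 := by
  have h1 : ∀ t : ℝ, star (Complex.exp (Complex.I * t)) ^ j * Complex.exp (Complex.I * t) ^ a =
      Complex.exp ((((a : ℤ) - (j : ℤ) : ℤ) * Complex.I) * t) := fun t => by
    rw [Complex.star_def, ← Complex.exp_conj, ← Complex.exp_nat_mul, ← Complex.exp_nat_mul,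
      ← Complex.exp_add]
    congr 1
    simp
    ring
  simp only [h1]
  split_ifs with h
  · simp [h]
  · have hn : (((a : ℤ) - (j : ℤ) : ℤ) * Complex.I : ℂ) ≠ 0 := by
      refine mul_ne_zero ?_ Complex.I_ne_zero
      rw [Int.cast_ne_zero]
      omega
    rw [integral_exp_mul_complex hn]
    have : Complex.exp ((((a : ℤ) - (j : ℤ) : ℤ) * Complex.I) * ((2 * π : ℝ) : ℂ)) = 1 := by
      rw [Complex.exp_eq_one_iff]
      exact ⟨(a : ℤ) - j, by push_cast; ring⟩
    rw [this]
    simp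

/-- The monomials of degree `a + b` are orthogonal for the global inner product, which gives the
reproducing property of the kernel `(a + b + 1) / (2 π) * ⟨q, y⟩ ^ (a + b)` on them. -/
theorem integral_kernel_monomial (q : C2) (a b : ℕ) :
    (1 / 2 : ℂ) * ∫ y, star ((a + b + 1 : ℂ) / (2 * π) * inner ℂ q (fibrePoint y) ^ (a + b)) *
      (fibrePoint y 0 ^ a * fibrePoint y 1 ^ b) ∂coordMeasure = q 0 ^ a * q 1 ^ b := by
  have h1 : ∀ y, star ((a + b + 1 : ℂ) / (2 * π) * inner ℂ q (fibrePoint y) ^ (a + b)) *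
      (fibrePoint y 0 ^ a * fibrePoint y 1 ^ b) =
      ∑ j ∈ Finset.range (a + b + 1), ((a + b + 1 : ℂ) / (2 * π) * q 0 ^ j * q 1 ^ (a + b - j) *
        ((a + b).choose j)) *
        (((sin (y.1 / 2) ^ (j + a) * cos (y.1 / 2) ^ (a + b - j + b) : ℝ) : ℂ) *
        (star (Complex.exp (Complex.I * y.2)) ^ j * Complex.exp (Complex.I * y.2) ^ a)) := by
    intro y
    have e0 : fibrePoint y 0 = ((sin (y.1 / 2) : ℝ) : ℂ) * Complex.exp (Complex.I * y.2) := by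
      simp [fibrePoint]
    have e1 : fibrePoint y 1 = ((cos (y.1 / 2) : ℝ) : ℂ) := by simp [fibrePoint]
    have e2 : star ((a + b + 1 : ℂ) / (2 * π)) = (a + b + 1 : ℂ) / (2 * π) := by simp
    have e3 : ∀ r : ℝ, star (r : ℂ) = (r : ℂ) := Complex.conj_ofReal
    rw [star_mul', e2, star_pow, inner_C2, star_add, star_mul', star_mul', star_star, star_star,
      add_pow, e0, e1, star_mul', e3, e3, Finset.mul_sum, Finset.sum_mul]
    refine Finset.sum_congr rfl fun j _ => ?_
    push_cast
    ring
  have hcont : ∀ j : ℕ, Continuous fun y : ℝ × ℝ =>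
      (((sin (y.1 / 2) ^ (j + a) * cos (y.1 / 2) ^ (a + b - j + b) : ℝ) : ℂ) *
        (star (Complex.exp (Complex.I * y.2)) ^ j * Complex.exp (Complex.I * y.2) ^ a)) := by
    intro j
    fun_prop
  simp only [h1]
  rw [integral_finsetSum _ fun j _ => (integrable_coord (hcont j)).const_mul _]
  simp only [integral_const_mul]
  rw [Finset.sum_eq_single a]
  · rw [integral_coordMeasure_mul (fun t => ((sin (t / 2) ^ (a + a) *
      cos (t / 2) ^ (a + b - a + b) : ℝ) : ℂ))
      (fun t => star (Complex.exp (Complex.I * t)) ^ a * Complex.exp (Complex.I * t) ^ a),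
      integral_circle_pow, if_pos rfl]
    have e : ∀ t : ℝ, (sin t : ℂ) * ((sin (t / 2) ^ (a + a) * cos (t / 2) ^ (a + b - a + b) : ℝ) : ℂ)
        = ((sin t * (sin (t / 2) ^ (2 * a) * cos (t / 2) ^ (2 * b)) : ℝ) : ℂ) := fun t => by
      rw [← two_mul, Nat.add_sub_cancel_left, ← two_mul]
      push_cast
      ring
    simp only [e]
    rw [intervalIntegral.integral_ofReal, integral_half_angle_pow, Nat.add_sub_cancel_left,
      Nat.choose_symm_add, Nat.add_choose, Nat.cast_div (Nat.factorial_mul_factorial_dvd_factorial_add a b)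
        (Nat.cast_ne_zero.2 (mul_ne_zero a.factorial_ne_zero b.factorial_ne_zero)),
      Nat.factorial_succ]
    have := Nat.factorial_ne_zero a
    have := Nat.factorial_ne_zero b
    have := Nat.factorial_ne_zero (a + b)
    have hpi : (π : ℂ) ≠ 0 := by exact_mod_cast pi_ne_zero
    have hab : (a + b + 1 : ℂ) ≠ 0 := by exact_mod_cast Nat.succ_ne_zero (a + b)
    push_cast
    field_simp
  · intro j _ hj
    rw [integral_coordMeasure_mul (fun t => ((sin (t / 2) ^ (j + a) *
      cos (t / 2) ^ (a + b - j + b) : ℝ) : ℂ))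
      (fun t => star (Complex.exp (Complex.I * t)) ^ j * Complex.exp (Complex.I * t) ^ a),
      integral_circle_pow, if_neg hj]
    simp
  · intro h
    exact absurd (Finset.mem_range.2 (by omega)) h

/-- The coherent state at `q` as a polynomial. -/
def kernelPoly (k : ℕ) (q : C2) : V k :=
  ⟨MvPolynomial.C ((k + 1 : ℂ) / (2 * π)) * (MvPolynomial.C (star (q 0)) * MvPolynomial.X 0 +
      MvPolynomial.C (star (q 1)) * MvPolynomial.X 1) ^ k, by
    rw [MvPolynomial.mem_homogeneousSubmodule]
    have h : ∀ i, (MvPolynomial.C (star (q i)) * MvPolynomial.X i :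
        MvPolynomial (Fin 2) ℂ).IsHomogeneous 1 := fun i =>
      (MvPolynomial.isHomogeneous_X ℂ i).C_mul _
    have := (((h 0).add (h 1)).pow k).C_mul ((k + 1 : ℂ) / (2 * π))
    simpa using this⟩

theorem evalAt_kernelPoly (k : ℕ) (q p : C2) :
    evalAt k p (kernelPoly k q) = (k + 1 : ℂ) / (2 * π) * inner ℂ q p ^ k := by
  rw [inner_C2]
  show MvPolynomial.aeval (R := ℂ) (fun i => p i)
    (MvPolynomial.C ((k + 1 : ℂ) / (2 * π)) * (MvPolynomial.C (star (q 0)) * MvPolynomial.X 0 +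
      MvPolynomial.C (star (q 1)) * MvPolynomial.X 1) ^ k) = _
  simp

theorem evalAt_eq_sum (k : ℕ) (p : C2) (s : V k) : evalAt k p s =
    ∑ d ∈ (poly k s).support, (poly k s).coeff d * (p 0 ^ d 0 * p 1 ^ d 1) := by
  simp only [evalAt, LinearMap.comp_apply, AlgHom.toLinearMap_apply, MvPolynomial.aeval_def]
  rw [MvPolynomial.eval₂_eq']
  simp

/-- The kernel has the reproducing property on monomials, which determines the coherent state. -/
theorem coherentState_eq (k : ℕ) (q : C2) : coherentState k q = kernelPoly k q := by
  refine ext_inner_right ℂ fun s => ?_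
  rw [inner_coherentState, inner_eq_globalInner, globalInner]
  simp only [evalAt_kernelPoly]
  simp only [evalAt_eq_sum k _ s, Finset.mul_sum]
  rw [integral_finsetSum, Finset.mul_sum]
  · refine Finset.sum_congr rfl fun d hd => ?_
    have hdeg : d 0 + d 1 = k := by
      have h := (show (poly k s).IsHomogeneous k from s.2)
      have hdeg := h (MvPolynomial.mem_support_iff.mp hd)
      rw [← hdeg, Finsupp.weight_apply, Finsupp.sum_fintype _ _ (by simp)]
      simp
    have hk : (k : ℂ) = d 0 + d 1 := by rw [← hdeg]; push_cast; rfl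
    have := integral_kernel_monomial q (d 0) (d 1)
    rw [hdeg, ← hk] at this
    rw [← this, mul_left_comm, ← integral_const_mul]
    congr 1
    refine integral_congr_ae (Eventually.of_forall fun y => ?_)
    ring
  · intro d _
    refine integrable_coord ?_
    have := continuous_fibrePoint
    fun_prop

theorem inner_coherentState_coherentState (k : ℕ) (p q : C2) :
    inner ℂ (coherentState k p) (coherentState k q) = (k + 1 : ℂ) / (2 * π) * inner ℂ q p ^ k := by
  rw [inner_coherentState, coherentState_eq, evalAt_kernelPoly]

theorem continuous_coherentState (k : ℕ) : Continuous (coherentState k) := by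
  unfold coherentState
  refine (LinearIsometryEquiv.continuous _).comp ?_
  rw [continuous_clm_apply]
  intro s
  show Continuous fun q => evalAt k q s
  simp only [evalAt_eq_sum k _ s]
  fun_prop

/-- The pairing of two loop states as a double integral of a power of the overlap, the
conjugate-linearity in the first slot being responsible for the order `⟨d s, c t⟩`. -/
theorem inner_loopState (k : ℕ) {c d : ℝ → C2} (hc : Continuous c) (hd : Continuous d) (T S : ℝ) :
    inner ℂ (loopState k c T) (loopState k d S) =
      (k + 1 : ℂ) / (2 * π) * ∫ t in (0 : ℝ)..T, ∫ s in (0 : ℝ)..S, inner ℂ (d s) (c t) ^ k := by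
  have hc' : Continuous fun t => coherentState k (c t) := (continuous_coherentState k).comp hc
  have hd' : Continuous fun t => coherentState k (d t) := (continuous_coherentState k).comp hd
  have h1 : ∀ t, inner ℂ (coherentState k (c t)) (loopState k d S) =
      (k + 1 : ℂ) / (2 * π) * ∫ s in (0 : ℝ)..S, inner ℂ (d s) (c t) ^ k := fun t => by
    have := (innerSL ℂ (coherentState k (c t))).intervalIntegral_comp_comm
      (μ := volume) (hd'.intervalIntegrable 0 S)
    simp only [innerSL_apply_apply] at this
    rw [loopState, ← this, ← intervalIntegral.integral_const_mul]
    simp only [inner_coherentState_coherentState]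
  have h2 := (innerSL ℂ (loopState k d S)).intervalIntegral_comp_comm (μ := volume)
    (hc'.intervalIntegrable 0 T)
  simp only [innerSL_apply_apply] at h2
  rw [← inner_conj_symm, ← intervalIntegral.integral_const_mul]
  simp only [← h1]
  rw [show inner ℂ (loopState k d S) (loopState k c T) = _ from h2.symm,
    ← intervalIntegral.intervalIntegral_conj]
  simp only [inner_conj_symm]

/-! ### The Laplace method in the plane -/

/-- The second order Taylor expansion of a function of one real variable at a critical point. -/
theorem tendsto_second_order {f f' : ℝ → ℂ} {a : ℂ} (hf : ∀ x, HasDerivAt f (f' x) x)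
    (h0 : f' 0 = 0) (hf' : HasDerivAt f' a 0) :
    Tendsto (fun x : ℝ => (f x - f 0) / (x : ℂ) ^ 2) (𝓝[≠] 0) (𝓝 (a / 2)) := by
  rw [Metric.tendsto_nhdsWithin_nhds]
  intro ε hε
  have h1 := hf'.isLittleO
  rw [Asymptotics.isLittleO_iff] at h1
  obtain ⟨δ, hδ, hb⟩ := Metric.eventually_nhds_iff.1 (h1 (half_pos hε))
  refine ⟨δ, hδ, fun x hx0 hx => ?_⟩
  have hg : ∀ y ∈ segment ℝ 0 x, HasDerivWithinAt (fun y : ℝ => f y - a / 2 * (y : ℂ) ^ 2)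
      (f' y - a * y) (segment ℝ 0 x) y := fun y _ => by
    have h2 : HasDerivAt (fun y : ℝ => (y : ℂ)) 1 y := Complex.ofRealCLM.hasDerivAt
    refine ((hf y).sub ((h2.pow 2).const_mul (a / 2))).hasDerivWithinAt.congr_deriv ?_
    simp
    ring
  have hbound : ∀ y ∈ segment ℝ 0 x, ‖f' y - a * y‖ ≤ ε / 2 * |x| := fun y hy => by
    have hyx : |y| ≤ |x| := by
      rw [segment_eq_uIcc] at hy
      have := abs_sub_left_of_mem_uIcc hy
      simpa using this
    have := hb (y := y) (by
      rw [Real.dist_eq, sub_zero] at hx ⊢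
      exact hyx.trans_lt hx)
    rw [h0, sub_zero, sub_zero, Complex.real_smul, mul_comm (y : ℂ), Real.norm_eq_abs] at this
    exact this.trans (by gcongr)
  have key := (convex_segment (0 : ℝ) x).norm_image_sub_le_of_norm_hasDerivWithin_le hg hbound
    (left_mem_segment ℝ 0 x) (right_mem_segment ℝ 0 x)
  have hx' : (x : ℂ) ≠ 0 := by exact_mod_cast hx0
  have hxp : 0 < |x| := abs_pos.2 hx0
  rw [dist_eq_norm]
  have e : (f x - f 0) / (x : ℂ) ^ 2 - a / 2 =
      (f x - a / 2 * (x : ℂ) ^ 2 - (f 0 - a / 2 * ((0 : ℝ) : ℂ) ^ 2)) / (x : ℂ) ^ 2 := by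
    field_simp
    simp
    ring
  rw [e, norm_div, norm_pow, Complex.norm_real, Real.norm_eq_abs, div_lt_iff₀ (by positivity)]
  rw [sub_zero, Real.norm_eq_abs] at key
  calc _ ≤ ε / 2 * |x| * |x| := key
    _ < ε * |x| ^ 2 := by nlinarith [mul_pos hε (mul_pos hxp hxp)]

theorem integrable_gaussian_plane {a : ℝ} (ha : 0 < a) :
    Integrable fun y : ℝ × ℝ => Real.exp (-a * (y.1 ^ 2 + y.2 ^ 2)) := by
  have := (integrable_exp_neg_mul_sq ha).mul_prod (integrable_exp_neg_mul_sq ha)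
  rw [← Measure.volume_eq_prod] at this
  refine this.congr (Eventually.of_forall fun y => ?_)
  simp only
  rw [← Real.exp_add]
  congr 1
  ring

/-- Laplace's method at a nondegenerate maximum of `‖G‖`, located at the origin. -/
theorem laplace_origin {G : ℝ × ℝ → ℂ} (hG : Continuous G) {a δ : ℝ} (ha : 0 < a) (hδ : 0 < δ)
    (hbound : ∀ y ∈ Metric.closedBall (0 : ℝ × ℝ) δ, ‖G y‖ ≤ Real.exp (-a * (y.1 ^ 2 + y.2 ^ 2)))
    {q : ℝ × ℝ → ℂ} (hq : ∀ y, Tendsto (fun x : ℝ => (G (x • y) - 1) / (x : ℂ) ^ 2) (𝓝[≠] 0)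
      (𝓝 (q y))) :
    Tendsto (fun k : ℕ => (k : ℂ) * ∫ y in Metric.closedBall (0 : ℝ × ℝ) δ, G y ^ k) atTop
      (𝓝 (∫ y, Complex.exp (q y))) := by
  set B := Metric.closedBall (0 : ℝ × ℝ) δ with hB
  have hBm : MeasurableSet B := Metric.isClosed_closedBall.measurableSet
  have hx : ∀ k : ℕ, 0 < k → ((√k)⁻¹ : ℝ) ^ 2 = (k : ℝ)⁻¹ := fun k hk => by
    rw [inv_pow, Real.sq_sqrt (Nat.cast_nonneg k)]
  have h1 : ∀ᶠ k : ℕ in atTop, ∫ y, B.indicator (fun y => G y ^ k) ((√k)⁻¹ • y) =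
      (k : ℂ) * ∫ y in B, G y ^ k := by
    filter_upwards [eventually_gt_atTop 0] with k hk
    rw [Measure.integral_comp_smul, Module.finrank_prod, Module.finrank_self, hx k hk, inv_inv,
      integral_indicator hBm, abs_of_nonneg (Nat.cast_nonneg k), Complex.real_smul]
    simp
  refine Tendsto.congr' h1 ?_
  have hlim : Tendsto (fun k : ℕ => (√k)⁻¹) atTop (𝓝[≠] (0 : ℝ)) := by
    rw [tendsto_nhdsWithin_iff]
    refine ⟨(tendsto_inv_atTop_zero.comp (Real.tendsto_sqrt_atTop.comp
      tendsto_natCast_atTop_atTop)), ?_⟩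
    filter_upwards [eventually_gt_atTop 0] with k hk
    have : (0 : ℝ) < k := Nat.cast_pos.2 hk
    exact (inv_pos.2 (Real.sqrt_pos.2 this)).ne'
  -- after rescaling by `1 / √k` the integrands converge pointwise, under a fixed Gaussian bound
  refine tendsto_integral_filter_of_dominated_convergence
    (fun y => Real.exp (-a * (y.1 ^ 2 + y.2 ^ 2))) ?_ ?_ (integrable_gaussian_plane ha) ?_
  · refine Eventually.of_forall fun k => ?_
    have hm : Measurable (B.indicator fun y => G y ^ k) :=
      (hG.pow k).measurable.indicator hBm
    exact (hm.comp (measurable_const_smul _)).aestronglyMeasurable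
  · filter_upwards [eventually_gt_atTop 0] with k hk
    refine Eventually.of_forall fun y => ?_
    by_cases hy : (√k)⁻¹ • y ∈ B
    · rw [indicator_of_mem hy, norm_pow]
      refine (pow_le_pow_left₀ (norm_nonneg _) (hbound _ hy) k).trans (le_of_eq ?_)
      rw [← Real.exp_nat_mul]
      congr 1
      have := hx k hk
      have hk' : (k : ℝ) ≠ 0 := by positivity
      simp only [Prod.smul_fst, Prod.smul_snd, smul_eq_mul, mul_pow, this]
      field_simp
    · rw [indicator_of_notMem hy, norm_zero]
      positivity
  · refine Eventually.of_forall fun y => ?_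
    have h2 := (hq y).comp hlim
    have h3 : Tendsto (fun k : ℕ => (k : ℂ) * (G ((√k)⁻¹ • y) - 1)) atTop (𝓝 (q y)) := by
      refine Tendsto.congr' ?_ h2
      filter_upwards [eventually_gt_atTop 0] with k hk
      have := hx k hk
      simp only [Function.comp_apply]
      rw [← Complex.ofReal_pow, this]
      push_cast
      rw [div_inv_eq_mul, mul_comm]
    have h4 := Complex.tendsto_one_add_pow_exp_of_tendsto h3
    refine Tendsto.congr' ?_ h4
    have h5 : Tendsto (fun k : ℕ => (√k)⁻¹ • y) atTop (𝓝 0) := by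
      have := (tendsto_nhds_of_tendsto_nhdsWithin hlim).smul_const y
      rwa [zero_smul] at this
    filter_upwards [h5 (Metric.closedBall_mem_nhds 0 hδ)] with k hk
    rw [indicator_of_mem (show (√k)⁻¹ • y ∈ B from hk)]
    ring

/-- The exponent of the Laplace integral at a crossing, for curves of speed `√2`. The parameter is
`w = e^{-iν}` at a crossing at which `γ'` is turned by the signed angle `ν` to `σ'`. -/
def crossForm (w : ℂ) (y : ℝ × ℝ) : ℂ := -((y.1 : ℂ) ^ 2 + (y.2 : ℂ) ^ 2 - 2 * w * y.1 * y.2) / 4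

theorem integrable_crossForm {w : ℂ} (hw : |w.re| < 1) :
    Integrable fun y => Complex.exp (crossForm w y) := by
  refine (integrable_gaussian_plane (a := (1 - |w.re|) / 4) (by linarith)).mono'
    (Continuous.aestronglyMeasurable (by unfold crossForm; fun_prop)) (Eventually.of_forall ?_)
  intro y
  rw [Complex.norm_exp]
  refine Real.exp_le_exp.2 ?_
  have e : (crossForm w y).re = -(y.1 ^ 2 + y.2 ^ 2 - 2 * w.re * y.1 * y.2) / 4 := by
    simp [crossForm, pow_two]
  rw [e]
  have h1 : 2 * |w.re * (y.1 * y.2)| ≤ |w.re| * (y.1 ^ 2 + y.2 ^ 2) := by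
    rw [abs_mul, abs_mul]
    have := two_mul_le_add_sq |y.1| |y.2|
    rw [sq_abs, sq_abs] at this
    nlinarith [abs_nonneg w.re]
  have h2 := le_abs_self (w.re * (y.1 * y.2))
  nlinarith

/-- The Gaussian integral at a positive crossing. Its phase is that of `(1 - e^{-2iν}) ^ (-1/2)`. -/
theorem integral_crossForm {ν : ℝ} (hν : 0 < sin ν) (hν0 : 0 < ν) (hνπ : ν < π) :
    ∫ y, Complex.exp (crossForm (Complex.exp (-(Complex.I * ν))) y) =
      2 * π * (√(2 / sin ν) * Complex.exp (Complex.I * (ν / 2 - π / 4 : ℝ))) := by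
  set w := Complex.exp (-(Complex.I * ν)) with hw
  have hwe : w = cos ν - sin ν * Complex.I := by
    rw [hw, show -(Complex.I * (ν : ℂ)) = ((-ν : ℝ) : ℂ) * Complex.I by push_cast; ring,
      Complex.exp_mul_I, ← Complex.ofReal_cos, ← Complex.ofReal_sin, cos_neg, sin_neg]
    push_cast
    ring
  have hwre : w.re = cos ν := by
    rw [hwe]
    simp [-Complex.ofReal_cos, -Complex.ofReal_sin]
  have hcos : |cos ν| < 1 := by
    rw [← sq_lt_one_iff_abs_lt_one]
    nlinarith [sin_sq_add_cos_sq ν]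
  have hint := integrable_crossForm (w := w) (by rwa [hwre])
  rw [Measure.volume_eq_prod] at hint ⊢
  rw [integral_prod _ hint]
  have h1 : ∀ x : ℝ, ∫ y : ℝ, Complex.exp (crossForm w (x, y)) =
      (2 * √π : ℝ) * Complex.exp (-((1 - w ^ 2) / 4) * (x : ℂ) ^ 2) := fun x => by
    have := integral_cexp_quadratic (b := -1 / 4) (by norm_num) (w * x / 2) (-(x : ℂ) ^ 2 / 4)
    have e : ((π : ℂ) / -(-1 / 4)) ^ (1 / 2 : ℂ) = (2 * √π : ℝ) := by
      rw [show (π : ℂ) / -(-1 / 4) = ((4 * π : ℝ) : ℂ) by push_cast; ring,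
        show (1 / 2 : ℂ) = ((1 / 2 : ℝ) : ℂ) by push_cast; ring,
        ← Complex.ofReal_cpow (by positivity), ← Real.sqrt_eq_rpow,
        Real.sqrt_mul (by norm_num), show (4 : ℝ) = 2 ^ 2 by norm_num,
        Real.sqrt_sq (by norm_num)]
    rw [e] at this
    rw [show -((1 - w ^ 2) / 4) * (x : ℂ) ^ 2 =
      -(x : ℂ) ^ 2 / 4 - (w * x / 2) ^ 2 / (4 * (-1 / 4)) by ring, ← this]
    congr 1
    ext y
    congr 1
    simp only [crossForm]
    ring
  simp only [h1]
  rw [integral_const_mul]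
  have hw2 : 1 - w ^ 2 = 2 * sin ν * Complex.exp (Complex.I * (π / 2 - ν : ℝ)) := by
    have e1 : Complex.exp (Complex.I * (π / 2 - ν : ℝ)) = sin ν + cos ν * Complex.I := by
      rw [mul_comm, Complex.exp_mul_I, ← Complex.ofReal_cos, ← Complex.ofReal_sin,
        cos_pi_div_two_sub, sin_pi_div_two_sub]
    rw [e1, hwe]
    have : (sin ν : ℂ) ^ 2 + (cos ν : ℂ) ^ 2 = 1 := by exact_mod_cast sin_sq_add_cos_sq ν
    linear_combination (-1 : ℂ) * this - (sin ν : ℂ) ^ 2 * Complex.I_sq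
  have hre : 0 < ((1 - w ^ 2) / 4).re := by
    rw [hwe]
    have : ((1 - ((cos ν : ℂ) - sin ν * Complex.I) ^ 2) / 4).re =
      (1 - cos ν ^ 2 + sin ν ^ 2) / 4 := by
      simp [pow_two, -Complex.ofReal_cos, -Complex.ofReal_sin]
      ring
    rw [this]
    nlinarith [sin_sq_add_cos_sq ν]
  rw [integral_gaussian_complex hre]
  set u : ℂ := √(2 * π / sin ν) * Complex.exp (Complex.I * (ν / 2 - π / 4 : ℝ)) with hu
  have hu2 : u ^ 2 = π / ((1 - w ^ 2) / 4) := by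
    rw [hw2, hu, mul_pow, ← Complex.exp_nat_mul, ← Complex.ofReal_pow,
      Real.sq_sqrt (by positivity)]
    have e2 : Complex.exp ((2 : ℕ) * (Complex.I * (ν / 2 - π / 4 : ℝ))) =
        (Complex.exp (Complex.I * (π / 2 - ν : ℝ)))⁻¹ := by
      rw [← Complex.exp_neg]
      congr 1
      push_cast
      ring
    rw [e2]
    have : (sin ν : ℂ) ≠ 0 := by exact_mod_cast hν.ne'
    have := Complex.exp_ne_zero (Complex.I * (π / 2 - ν : ℝ))
    push_cast at *
    field_simp
    ring
  -- the principal branch of the square root is the one with positive real part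
  have hure : 0 < u.re := by
    rw [hu, Complex.re_ofReal_mul, mul_comm Complex.I, Complex.exp_ofReal_mul_I_re]
    have : 0 < cos (ν / 2 - π / 4) := cos_pos_of_mem_Ioo ⟨by linarith, by linarith⟩
    positivity
  rw [← hu2, one_div, Complex.sq_cpow_two_inv hure, hu]
  have hs : √π * √(2 * π / sin ν) = π * √(2 / sin ν) := by
    rw [← Real.sqrt_mul pi_pos.le, show π * (2 * π / sin ν) = π ^ 2 * (2 / sin ν) by ring,
      Real.sqrt_mul (by positivity), Real.sqrt_sq pi_pos.le]
  have hs' : (√π : ℂ) * (√(2 * π / sin ν) : ℝ) = π * (√(2 / sin ν) : ℝ) := by exact_mod_cast hs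
  push_cast
  linear_combination 2 * Complex.exp (Complex.I * (ν / 2 - π / 4)) * hs'

/-! ### The contribution of a crossing -/

variable {γ σ : ℝ → E3} {T S : ℝ} {c d : ℝ → C2}

/-- The overlap of the coherent states of degree one along two curves in `S³`. -/
def overlap (c d : ℝ → C2) (y : ℝ × ℝ) : ℂ := inner ℂ (d y.2) (c y.1)

theorem continuous_overlap (hc : IsParallelLift c γ) (hd : IsParallelLift d σ) :
    Continuous (overlap c d) :=
  (hd.continuous.comp continuous_snd).inner (hc.continuous.comp continuous_fst)

/-- The overlap has absolute value one exactly where the curves meet, and decays quadratically with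
the distance of their points. -/
theorem norm_overlap_sq (hc : IsParallelLift c γ) (hd : IsParallelLift d σ) (y : ℝ × ℝ) :
    ‖overlap c d y‖ ^ 2 = 1 - ‖γ y.1 - σ y.2‖ ^ 2 / 4 := by
  have h1 : ‖γ y.1‖ = 1 := by rw [← hc.lies_over, norm_hopf _ (hc.norm_eq _)]
  have h2 : ‖σ y.2‖ = 1 := by rw [← hd.lies_over, norm_hopf _ (hd.norm_eq _)]
  rw [overlap, inner_hopf _ _ (hc.norm_eq _) (hd.norm_eq _), hc.lies_over, hd.lies_over,
    norm_sub_sq_real, h1, h2]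
  ring

theorem norm_overlap_lt_one (hc : IsParallelLift c γ) (hd : IsParallelLift d σ) {y : ℝ × ℝ}
    (h : γ y.1 ≠ σ y.2) : ‖overlap c d y‖ < 1 := by
  have h1 := norm_overlap_sq hc hd y
  have h2 : 0 < ‖γ y.1 - σ y.2‖ := norm_pos_iff.2 (sub_ne_zero.2 h)
  rw [← sq_lt_one_iff₀ (norm_nonneg _), h1]
  have : 0 < ‖γ y.1 - σ y.2‖ ^ 2 := by positivity
  linarith

theorem IsLoop.norm_speed (hγ : IsLoop γ T) (hc : IsParallelLift c γ) (t : ℝ) :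
    ‖deriv c t‖ ^ 2 = 1 / 2 := by
  have h := hc.norm_speed_sq t
  rw [hγ.speed, Real.sq_sqrt (by norm_num)] at h
  rw [hc.deriv_eq, norm_smul, norm_perp, hc.norm_eq, mul_one]
  linarith

theorem IsLoop.differentiable (hγ : IsLoop γ T) : Differentiable ℝ γ :=
  hγ.smooth.differentiable (by simp)

theorem orient_smul (p : E3) (a b : ℝ) (v w : E3) :
    orient p (a • v) (b • w) = a * b * orient p v w := by
  simp only [orient, inner_E3, cross_zero, cross_one, cross_two, PiLp.smul_apply, smul_eq_mul]
  ring

theorem orient_swap (p v w : E3) : orient p v w = -orient p w v := by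
  simp only [orient, inner_E3, cross_zero, cross_one, cross_two]
  ring

theorem orient_self (p v : E3) : orient p v v = 0 := by
  simp only [orient, inner_E3, cross_zero, cross_one, cross_two]
  ring

/-- Transverse curves separate linearly at a crossing. -/
theorem exists_separation (hγ : IsLoop γ T) (hσ : IsLoop σ S) {t₀ s₀ : ℝ} (h0 : γ t₀ = σ s₀)
    (h : orient (γ t₀) (deriv γ t₀) (deriv σ s₀) ≠ 0) :
    ∃ m > 0, ∀ᶠ y : ℝ × ℝ in 𝓝 0, m * ‖y‖ ≤ ‖γ (t₀ + y.1) - σ (s₀ + y.2)‖ := by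
  set L : ℝ × ℝ →L[ℝ] E3 := (ContinuousLinearMap.fst ℝ ℝ ℝ).smulRight (deriv γ t₀) -
    (ContinuousLinearMap.snd ℝ ℝ ℝ).smulRight (deriv σ s₀) with hL
  have hker : LinearMap.ker (L : ℝ × ℝ →ₗ[ℝ] E3) = ⊥ := by
    rw [LinearMap.ker_eq_bot']
    intro y hy
    have hy' : y.1 • deriv γ t₀ = y.2 • deriv σ s₀ := sub_eq_zero.1 hy
    have e1 := orient_smul (γ t₀) y.1 1 (deriv γ t₀) (deriv σ s₀)
    have e2 := orient_smul (γ t₀) 1 y.2 (deriv γ t₀) (deriv σ s₀)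
    rw [hy', one_smul, ← one_smul ℝ (deriv σ s₀), smul_smul, orient_smul, orient_self] at e1
    rw [← hy', one_smul, ← one_smul ℝ (deriv γ t₀), smul_smul, orient_smul, orient_self] at e2
    simp only [one_smul, mul_zero, mul_one, one_mul] at e1 e2
    ext
    · exact (mul_eq_zero.1 e1.symm).resolve_right h
    · exact (mul_eq_zero.1 e2.symm).resolve_right h
  obtain ⟨K, hK0, hK⟩ := LinearMap.exists_antilipschitzWith (L : ℝ × ℝ →ₗ[ℝ] E3) hker
  have hK0' : (0 : ℝ) < K := hK0
  have hf : HasFDerivAt (fun y : ℝ × ℝ => γ (t₀ + y.1) - σ (s₀ + y.2)) L 0 := by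
    have h1 : HasFDerivAt (fun y : ℝ × ℝ => t₀ + y.1) (ContinuousLinearMap.fst ℝ ℝ ℝ) 0 :=
      hasFDerivAt_fst.const_add t₀
    have h2 : HasFDerivAt (fun y : ℝ × ℝ => s₀ + y.2) (ContinuousLinearMap.snd ℝ ℝ ℝ) 0 :=
      hasFDerivAt_snd.const_add s₀
    have h3 : HasDerivAt γ (deriv γ t₀) (t₀ + (0 : ℝ × ℝ).1) := by
      simpa using (hγ.differentiable t₀).hasDerivAt
    have h4 : HasDerivAt σ (deriv σ s₀) (s₀ + (0 : ℝ × ℝ).2) := by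
      simpa using (hσ.differentiable s₀).hasDerivAt
    refine ((h3.hasFDerivAt.comp (0 : ℝ × ℝ) h1).sub
      (h4.hasFDerivAt.comp (0 : ℝ × ℝ) h2)).congr_fderiv ?_
    ext <;> simp [hL]
  have hK2 : (0 : ℝ) < (K : ℝ)⁻¹ / 2 := by positivity
  refine ⟨(K : ℝ)⁻¹ / 2, hK2, ?_⟩
  have ho := hf.isLittleO
  rw [Asymptotics.isLittleO_iff] at ho
  filter_upwards [ho hK2] with y hy
  simp only [sub_zero, Prod.fst_zero, Prod.snd_zero, add_zero, h0, sub_self] at hy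
  have h5 : (K : ℝ)⁻¹ * ‖y‖ ≤ ‖L y‖ := by
    have := hK.le_mul_dist y 0
    rw [map_zero, dist_zero_right, dist_zero_right] at this
    rw [inv_mul_le_iff₀ hK0']
    exact this
  have h6 := norm_sub_norm_le (L y) (L y - (γ (t₀ + y.1) - σ (s₀ + y.2)))
  rw [sub_sub_cancel, norm_sub_rev (L y)] at h6
  linarith

/-- The mixed derivative of the overlap at a crossing. Its imaginary part is the symplectic form,
which distinguishes positive from negative crossings. -/
theorem inner_deriv_deriv (hc : IsParallelLift c γ) (hd : IsParallelLift d σ) {t₀ s₀ : ℝ} {u : ℂ}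
    (hu : c t₀ = u • d s₀) :
    star u * inner ℂ (deriv d s₀) (deriv c t₀) =
      ((inner ℝ (deriv γ t₀) (deriv σ s₀) : ℝ) -
        Complex.I * (orient (γ t₀) (deriv γ t₀) (deriv σ s₀) : ℝ)) / 4 := by
  have hu1 : ‖u‖ = 1 := by
    have := hc.norm_eq t₀
    rwa [hu, norm_smul, hd.norm_eq, mul_one] at this
  have huu : star u * u = 1 := by
    have := Complex.conj_mul' u
    rw [hu1] at this
    simpa using this
  have hσ' : deriv σ s₀ = tangent (c t₀) (u ^ 2 * IsParallelLift.speed d s₀) := by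
    rw [hd.deriv_base, hu]
    simp only [tangent, PiLp.smul_apply, smul_eq_mul]
    have e : ∀ l x y : ℂ, star (u ^ 2 * l) * (u * x) ^ 2 - u ^ 2 * l * star (u * y) ^ 2 =
        star l * x ^ 2 - l * star y ^ 2 := fun l x y => by
      rw [star_mul', star_mul', star_pow]
      linear_combination (star l * x ^ 2 - l * star y ^ 2) * (star u * u + 1) * huu
    have e2 : ∀ l x y : ℂ, u ^ 2 * l * star (u * x) * star (u * y) = l * star x * star y :=
      fun l x y => by
      rw [star_mul', star_mul']
      linear_combination (l * star x * star y) * (star u * u + 1) * huu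
    rw [e, e2]
  rw [hσ', hc.deriv_base, ← hc.lies_over t₀, inner_tangent _ (hc.norm_eq t₀),
    orient_tangent _ (hc.norm_eq t₀), hc.deriv_eq, hd.deriv_eq]
  set l := IsParallelLift.speed c t₀
  set m := IsParallelLift.speed d s₀
  have hp : inner ℂ (perp (d s₀)) (perp (c t₀)) = star u := by
    have e := star_mul_self_C2 (d s₀) (hd.norm_eq s₀)
    rw [inner_C2, hu]
    simp only [perp, PiLp.smul_apply, smul_eq_mul, star_mul']
    simp
    simp at e
    linear_combination (starRingEnd ℂ u) * e
  rw [inner_smul_left, inner_smul_right, hp]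
  apply Complex.ext
  · simp [pow_two]
    ring
  · simp [pow_two]
    ring

/-- The second order expansion of the overlap, in every direction, at a crossing with relative phase
`u` of the lifts. -/
theorem overlap_second_order (hγ : IsLoop γ T) (hσ : IsLoop σ S) (hc : IsParallelLift c γ)
    (hd : IsParallelLift d σ) {t₀ s₀ : ℝ} {u : ℂ} (hu : c t₀ = u • d s₀) (y : ℝ × ℝ) :
    Tendsto (fun x : ℝ => (star u * overlap c d ((t₀, s₀) + x • y) - 1) / (x : ℂ) ^ 2) (𝓝[≠] 0)
      (𝓝 (crossForm (((inner ℝ (deriv γ t₀) (deriv σ s₀) : ℝ) -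
        Complex.I * (orient (γ t₀) (deriv γ t₀) (deriv σ s₀) : ℝ)) / 2) y)) := by
  have hu1 : ‖u‖ = 1 := by
    have := hc.norm_eq t₀
    rwa [hu, norm_smul, hd.norm_eq, mul_one] at this
  have huu : star u * u = 1 := by
    have := Complex.conj_mul' u
    rw [hu1] at this
    simpa using this
  have hmix := inner_deriv_deriv hc hd hu
  have hlin : ∀ a b x : ℝ, HasDerivAt (fun x : ℝ => a + x * b) b x := fun a b x => by
    simpa using ((hasDerivAt_id x).mul_const b).const_add a
  have hsm : ∀ (r : ℝ) (v : C2), r • v = (r : ℂ) • v := fun r v => by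
    ext i
    simp
  have hcx : ∀ x : ℝ, HasDerivAt (fun x : ℝ => c (t₀ + x * y.1))
      ((y.1 : ℂ) • deriv c (t₀ + x * y.1)) x := fun x =>
    ((hc.hasDerivAt _).scomp x (hlin t₀ y.1 x)).congr_deriv (hsm _ _)
  have hdx : ∀ x : ℝ, HasDerivAt (fun x : ℝ => d (s₀ + x * y.2))
      ((y.2 : ℂ) • deriv d (s₀ + x * y.2)) x := fun x =>
    ((hd.hasDerivAt _).scomp x (hlin s₀ y.2 x)).congr_deriv (hsm _ _)
  have hc' : ∀ x : ℝ, HasDerivAt (fun x : ℝ => deriv c (t₀ + x * y.1))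
      ((y.1 : ℂ) • deriv (deriv c) (t₀ + x * y.1)) x := fun x =>
    (((hc.differentiable_deriv hγ.smooth) _).hasDerivAt.scomp x (hlin t₀ y.1 x)).congr_deriv
      (hsm _ _)
  have hd' : ∀ x : ℝ, HasDerivAt (fun x : ℝ => deriv d (s₀ + x * y.2))
      ((y.2 : ℂ) • deriv (deriv d) (s₀ + x * y.2)) x := fun x =>
    (((hd.differentiable_deriv hσ.smooth) _).hasDerivAt.scomp x (hlin s₀ y.2 x)).congr_deriv
      (hsm _ _)
  -- differentiating the horizontality condition gives the second derivative along the lift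
  have hsec : ∀ {e : ℝ → C2} {ρ : ℝ → E3} {R : ℝ} (_ : IsLoop ρ R) (_ : IsParallelLift e ρ) (t : ℝ),
      inner ℂ (e t) (deriv (deriv e) t) = -1 / 2 := by
    intro e ρ R hρ he t
    have h1 := (he.hasDerivAt t).inner ℂ ((he.differentiable_deriv hρ.smooth) t).hasDerivAt
    have h2 : (fun t => inner ℂ (e t) (deriv e t)) = fun _ => (0 : ℂ) := funext he.parallel
    rw [h2] at h1
    have h3 := h1.unique (hasDerivAt_const t (0 : ℂ))
    have h4 : inner ℂ (deriv e t) (deriv e t) = (1 / 2 : ℂ) := by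
      rw [inner_self_eq_norm_sq_to_K]
      have := hρ.norm_speed he t
      show ((‖deriv e t‖ : ℝ) : ℂ) ^ 2 = _
      rw [← Complex.ofReal_pow, this]
      norm_num
    rw [h4] at h3
    linear_combination h3
  set f : ℝ → ℂ := fun x => star u * inner ℂ (d (s₀ + x * y.2)) (c (t₀ + x * y.1)) with hf
  set f' : ℝ → ℂ := fun x => star u *
    (y.1 * inner ℂ (d (s₀ + x * y.2)) (deriv c (t₀ + x * y.1)) +
      y.2 * inner ℂ (deriv d (s₀ + x * y.2)) (c (t₀ + x * y.1))) with hf'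
  have h1 : ∀ x, HasDerivAt f (f' x) x := fun x => by
    refine (((hdx x).inner ℂ (hcx x)).const_mul (star u)).congr_deriv ?_
    rw [inner_smul_left, inner_smul_right, Complex.conj_ofReal]
  have h2 := (((((hdx 0).inner ℂ (hc' 0)).const_mul (y.1 : ℂ))).add
    (((hd' 0).inner ℂ (hcx 0)).const_mul (y.2 : ℂ))).const_mul (star u)
  have hd0 : d s₀ = star u • c t₀ := by rw [hu, smul_smul, huu, one_smul]
  have e1 : inner ℂ (d s₀) (deriv c t₀) = 0 := by
    rw [hd0, inner_smul_left, hc.parallel, mul_zero]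
  have e2 : inner ℂ (deriv d s₀) (c t₀) = 0 := by
    rw [hu, inner_smul_right, ← inner_conj_symm, hd.parallel, map_zero, mul_zero]
  have h3 : f' 0 = 0 := by
    simp only [hf', zero_mul, add_zero, e1, e2, mul_zero]
  have h4 := tendsto_second_order h1 h3 h2
  have e3 : star u * inner ℂ (d s₀) (deriv (deriv c) t₀) = -1 / 2 := by
    have := hsec hγ hc t₀
    rwa [hu, inner_smul_left] at this
  have e4 : star u * inner ℂ (deriv (deriv d) s₀) (c t₀) = -1 / 2 := by
    have h5 : inner ℂ (deriv (deriv d) s₀) (d s₀) = -1 / 2 := by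
      rw [← inner_conj_symm, hsec hσ hd s₀]
      simp [Complex.conj_ofNat]
    rw [hu, inner_smul_right, h5, ← mul_assoc, huu, one_mul]
  have e5 : f 0 = 1 := by
    simp only [hf, zero_mul, add_zero]
    rw [hu, inner_smul_right, inner_self_eq_norm_sq_to_K, hd.norm_eq, ← mul_assoc, huu]
    simp
  rw [e5] at h4
  refine Eq.subst (motive := fun z => Tendsto (fun x : ℝ =>
    (star u * overlap c d ((t₀, s₀) + x • y) - 1) / (x : ℂ) ^ 2) (𝓝[≠] 0) (𝓝 z)) ?_ h4
  simp only [zero_mul, add_zero, inner_smul_left, inner_smul_right, crossForm,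
    Complex.conj_ofReal]
  linear_combination (y.1 : ℂ) * y.2 * hmix + (y.1 : ℂ) ^ 2 / 2 * e3 + (y.2 : ℂ) ^ 2 / 2 * e4

/-- The part of the double integral near a crossing, divided by the phase of the crossing,
converges to a Gaussian integral. -/
theorem laplace_crossing (hγ : IsLoop γ T) (hσ : IsLoop σ S) (hc : IsParallelLift c γ)
    (hd : IsParallelLift d σ) {t₀ s₀ : ℝ} {u : ℂ} (hu : c t₀ = u • d s₀)
    (h : orient (γ t₀) (deriv γ t₀) (deriv σ s₀) ≠ 0) :
    ∃ δ₀ > 0, ∀ δ, 0 < δ → δ ≤ δ₀ → Tendsto (fun k : ℕ => (k : ℂ) * (star u ^ k *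
      ∫ y in Metric.closedBall (t₀, s₀) δ, overlap c d y ^ k)) atTop
      (𝓝 (∫ y, Complex.exp (crossForm (((inner ℝ (deriv γ t₀) (deriv σ s₀) : ℝ) -
        Complex.I * (orient (γ t₀) (deriv γ t₀) (deriv σ s₀) : ℝ)) / 2) y))) := by
  have hu1 : ‖u‖ = 1 := by
    have := hc.norm_eq t₀
    rwa [hu, norm_smul, hd.norm_eq, mul_one] at this
  have h0 : γ t₀ = σ s₀ := by
    rw [← hc.lies_over, ← hd.lies_over, hu, hopf_smul u hu1]
  obtain ⟨m, hm, hsep⟩ := exists_separation hγ hσ h0 h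
  obtain ⟨δ₁, hδ₁, hball⟩ := Metric.eventually_nhds_iff.1 hsep
  refine ⟨δ₁ / 2, half_pos hδ₁, fun δ hδ hδ2 => ?_⟩
  have hcont := continuous_overlap hc hd
  have key := laplace_origin (G := fun y => star u * overlap c d ((t₀, s₀) + y)) (by fun_prop)
    (a := m ^ 2 / 16) (δ := δ) (by positivity) hδ ?_
    (overlap_second_order hγ hσ hc hd hu)
  · refine key.congr fun k => ?_
    congr 1
    simp only [mul_pow]
    rw [integral_const_mul]
    congr 1
    have hpre : (fun y : ℝ × ℝ => (t₀, s₀) + y) ⁻¹' Metric.closedBall (t₀, s₀) δ =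
        Metric.closedBall 0 δ := by
      simp
    rw [← hpre]
    exact (measurePreserving_add_left volume ((t₀, s₀) : ℝ × ℝ)).setIntegral_preimage_emb
      (Homeomorph.addLeft ((t₀, s₀) : ℝ × ℝ)).measurableEmbedding (fun y => overlap c d y ^ k) _
  · intro y hy
    have hy' : dist y 0 < δ₁ := lt_of_le_of_lt hy (by linarith)
    have h1 := hball hy'
    have h2 := norm_overlap_sq hc hd ((t₀, s₀) + y)
    have h3 : y.1 ^ 2 + y.2 ^ 2 ≤ 2 * ‖y‖ ^ 2 := by
      have e1 := norm_fst_le y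
      have e2 := norm_snd_le y
      rw [Real.norm_eq_abs] at e1 e2
      have := pow_le_pow_left₀ (abs_nonneg _) e1 2
      have := pow_le_pow_left₀ (abs_nonneg _) e2 2
      rw [sq_abs] at *
      linarith
    have h4 : (m * ‖y‖) ^ 2 ≤ ‖γ (t₀ + y.1) - σ (s₀ + y.2)‖ ^ 2 :=
      pow_le_pow_left₀ (by positivity) h1 2
    have h5 : ‖overlap c d ((t₀, s₀) + y)‖ ^ 2 ≤
        Real.exp (-(m ^ 2 / 16) * (y.1 ^ 2 + y.2 ^ 2)) ^ 2 := by
      rw [h2, ← Real.exp_nat_mul]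
      refine le_trans ?_ (Real.add_one_le_exp _)
      have : m ^ 2 * (y.1 ^ 2 + y.2 ^ 2) ≤ 2 * (m * ‖y‖) ^ 2 := by
        rw [mul_pow]
        nlinarith [sq_nonneg m]
      push_cast
      simp only [Prod.fst_add, Prod.snd_add]
      nlinarith
    rw [norm_mul, norm_star, hu1, one_mul]
    exact (pow_le_pow_iff_left₀ (norm_nonneg _) (Real.exp_pos _).le two_ne_zero).1 h5

theorem tendsto_succ_mul_pow {r : ℝ} (h0 : 0 ≤ r) (h1 : r < 1) :
    Tendsto (fun k : ℕ => ((k : ℝ) + 1) * r ^ k) atTop (𝓝 0) := by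
  have e1 := tendsto_self_mul_const_pow_of_lt_one h0 h1
  have e2 := tendsto_pow_atTop_nhds_zero_of_lt_one h0 h1
  have := e1.add e2
  rw [add_zero] at this
  exact this.congr fun k => by ring

/-- On a compact set on which `‖F‖ < 1`, the integral of `F ^ k` decays exponentially. -/
theorem tendsto_integral_pow_compact {F : ℝ × ℝ → ℂ} (hF : Continuous F) {K : Set (ℝ × ℝ)}
    (hK : IsCompact K) (hlt : ∀ y ∈ K, ‖F y‖ < 1) :
    Tendsto (fun k : ℕ => ((k : ℂ) + 1) * ∫ y in K, F y ^ k) atTop (𝓝 0) := by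
  rcases K.eq_empty_or_nonempty with rfl | hne
  · simp
  obtain ⟨y₀, hy₀, hmax⟩ := hK.exists_isMaxOn hne hF.norm.continuousOn
  have h1 := (tendsto_succ_mul_pow (norm_nonneg (F y₀)) (hlt y₀ hy₀)).mul_const (volume.real K)
  rw [zero_mul] at h1
  refine squeeze_zero_norm (fun k => ?_) h1
  rw [norm_mul, mul_assoc]
  have h2 : ‖(k : ℂ) + 1‖ = (k : ℝ) + 1 := by
    rw [← Nat.cast_succ, Complex.norm_natCast]
    push_cast
    rfl
  rw [h2]
  refine mul_le_mul_of_nonneg_left ?_ (by positivity)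
  refine norm_setIntegral_le_of_norm_le_const hK.measure_lt_top fun y hy => ?_
  rw [norm_pow]
  exact pow_le_pow_left₀ (norm_nonneg _) (hmax hy) k

/-! ### The double integral over a period -/

/-- The normalization of the kernel and the phase of the crossing are restored. Replacing `k` by `k
+ 1` is harmless because the unnormalized integral tends to zero. -/
theorem tendsto_crossing_phase {I : ℕ → ℂ} {u g : ℂ} (hu : ‖u‖ = 1)
    (h : Tendsto (fun k : ℕ => (k : ℂ) * (star u ^ k * I k)) atTop (𝓝 (2 * π * g))) :
    Tendsto (fun k : ℕ => ((k : ℂ) + 1) / (2 * π) * I k - u ^ k * g) atTop (𝓝 0) := by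
  have huu : star u * u = 1 := by
    have := Complex.conj_mul' u
    rw [hu] at this
    simpa using this
  have hpi : (2 * π : ℂ) ≠ 0 := by exact_mod_cast two_pi_pos.ne'
  have h1 : Tendsto (fun k : ℕ => star u ^ k * I k) atTop (𝓝 0) := by
    have h2 : Tendsto (fun k : ℕ => ((k : ℂ))⁻¹) atTop (𝓝 0) := by
      have := tendsto_inv_atTop_nhds_zero_nat (𝕜 := ℂ)
      exact this
    have h3 := h2.mul h
    rw [zero_mul] at h3
    refine h3.congr' ?_
    filter_upwards [eventually_gt_atTop 0] with k hk
    have : (k : ℂ) ≠ 0 := by exact_mod_cast hk.ne'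
    field_simp
  have h4 := ((h.add h1).div_const (2 * π : ℂ)).sub_const g
  rw [add_zero, mul_div_cancel_left₀ _ hpi, sub_self] at h4
  rw [tendsto_zero_iff_norm_tendsto_zero] at h4 ⊢
  refine h4.congr fun k => ?_
  have e : ((k : ℂ) + 1) / (2 * π) * I k - u ^ k * g =
      u ^ k * (((k : ℂ) * (star u ^ k * I k) + star u ^ k * I k) / (2 * π) - g) := by
    have huk : star u ^ k * u ^ k = 1 := by rw [← mul_pow, huu, one_pow]
    field_simp
    linear_combination (-((k : ℂ) + 1) * I k) * huk
  rw [e, norm_mul, norm_pow, hu, one_pow, one_mul]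

/-- A loop takes the same value only at parameters which differ by a multiple of the period. -/
theorem IsLoop.eq_add_zsmul (hγ : IsLoop γ T) {t t' : ℝ} (h : γ t = γ t') :
    ∃ m : ℤ, t' = t + m * T := by
  have hper : Function.Periodic γ T := hγ.periodic
  have hz : ∀ (x : ℝ) (m : ℤ), γ (x - m * T) = γ x := fun x m => hper.sub_int_mul_eq m
  have e : toIcoMod hγ.pos 0 t = toIcoMod hγ.pos 0 t' := by
    refine hγ.injOn ?_ ?_ ?_
    · simpa using toIcoMod_mem_Ico hγ.pos 0 t
    · simpa using toIcoMod_mem_Ico hγ.pos 0 t'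
    · rw [toIcoMod, toIcoMod, zsmul_eq_mul, zsmul_eq_mul, hz, hz, h]
  rw [toIcoMod, toIcoMod, zsmul_eq_mul, zsmul_eq_mul] at e
  refine ⟨toIcoDiv hγ.pos 0 t' - toIcoDiv hγ.pos 0 t, ?_⟩
  push_cast
  linarith

theorem IsLoop.eq_of_abs_sub_lt (hγ : IsLoop γ T) {t t' : ℝ} (h : γ t = γ t')
    (hlt : |t' - t| < T) : t' = t := by
  obtain ⟨m, hm⟩ := hγ.eq_add_zsmul h
  have hT := hγ.pos
  rw [hm, add_sub_cancel_left, abs_mul, abs_of_pos hT] at hlt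
  have h1 : |(m : ℝ)| < 1 := by
    by_contra hcon
    nlinarith [not_lt.1 hcon]
  have h2 : m = 0 := by
    rw [← Int.abs_lt_one_iff]
    exact_mod_cast h1
  simpa [h2] using hm

/-- The asymptotics of the double integral over a period of each of two curves which cross once
positively and once negatively. The Gaussian integral at the negative crossing is the complex
conjugate of the one at the positive crossing. -/
theorem laplace_period (hγ : IsLoop γ T) (hσ : IsLoop σ S) (hc : IsParallelLift c γ)
    (hd : IsParallelLift d σ) {a b t₀ t₁ s₀ s₁ : ℝ} {u v : ℂ} {ν : ℝ} (hν0 : 0 < ν) (hνπ : ν < π)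
    (ht₀ : t₀ ∈ Ioo a (a + T)) (ht₁ : t₁ ∈ Ioo a (a + T)) (hs₀ : s₀ ∈ Ioo b (b + S))
    (hs₁ : s₁ ∈ Ioo b (b + S)) (hne : t₀ ≠ t₁)
    (hinter : ∀ t ∈ Icc a (a + T), ∀ s ∈ Icc b (b + S), γ t = σ s →
      (t = t₀ ∧ s = s₀) ∨ (t = t₁ ∧ s = s₁))
    (hu : c t₀ = u • d s₀) (hv : c t₁ = v • d s₁)
    (ho₀ : orient (γ t₀) (deriv γ t₀) (deriv σ s₀) = 2 * sin ν)
    (ho₁ : orient (γ t₁) (deriv γ t₁) (deriv σ s₁) = -(2 * sin ν))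
    (hi₀ : inner ℝ (deriv γ t₀) (deriv σ s₀) = 2 * cos ν)
    (hi₁ : inner ℝ (deriv γ t₁) (deriv σ s₁) = 2 * cos ν) :
    Tendsto (fun k : ℕ => ((k : ℂ) + 1) / (2 * π) *
      (∫ t in a..(a + T), ∫ s in b..(b + S), inner ℂ (d s) (c t) ^ k) -
      (u ^ k * (√(2 / sin ν) * Complex.exp (Complex.I * (ν / 2 - π / 4 : ℝ))) +
        v ^ k * (√(2 / sin ν) * Complex.exp (-(Complex.I * (ν / 2 - π / 4 : ℝ))))))
      atTop (𝓝 0) := by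
  have hsin : 0 < sin ν := sin_pos_of_pos_of_lt_pi hν0 hνπ
  have hnorm : ∀ {t s : ℝ} {w : ℂ}, c t = w • d s → ‖w‖ = 1 := fun {t s w} h => by
    have := hc.norm_eq t
    rwa [h, norm_smul, hd.norm_eq, mul_one] at this
  have hcont := continuous_overlap hc hd
  have hG := integral_crossForm hsin hν0 hνπ
  have hG' : ∫ y, Complex.exp (crossForm (Complex.exp (Complex.I * ν)) y) =
      2 * π * (√(2 / sin ν) * Complex.exp (-(Complex.I * (ν / 2 - π / 4 : ℝ)))) := by
    have := congrArg (starRingEnd ℂ) hG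
    rw [← integral_conj] at this
    have e : ∀ y : ℝ × ℝ, (starRingEnd ℂ) (Complex.exp (crossForm
        (Complex.exp (-(Complex.I * ν))) y)) =
        Complex.exp (crossForm (Complex.exp (Complex.I * ν)) y) := fun y => by
      rw [← Complex.exp_conj]
      simp only [crossForm, map_div₀, map_neg, map_sub, map_add, map_mul, map_pow,
        Complex.conj_ofReal, ← Complex.exp_conj, Complex.conj_I, Complex.conj_ofNat, neg_mul,
        neg_neg]
    simp only [e] at this
    rw [this]
    simp only [map_mul, ← Complex.exp_conj, Complex.conj_ofReal, Complex.conj_I, Complex.conj_ofNat,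
      neg_mul]
  have ew : ∀ x : ℝ, ((2 * cos ν : ℝ) - Complex.I * (2 * sin x : ℝ)) / 2 =
      (cos ν : ℂ) - Complex.I * sin x := fun x => by
    push_cast
    ring
  have e₀ : (((2 * cos ν : ℝ) : ℂ) - Complex.I * (2 * sin ν : ℝ)) / 2 =
      Complex.exp (-(Complex.I * ν)) := by
    rw [show -(Complex.I * (ν : ℂ)) = ((-ν : ℝ) : ℂ) * Complex.I by push_cast; ring,
      Complex.exp_mul_I, ← Complex.ofReal_cos, ← Complex.ofReal_sin, cos_neg, sin_neg]
    push_cast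
    ring
  have e₁ : (((2 * cos ν : ℝ) : ℂ) - Complex.I * (-(2 * sin ν) : ℝ)) / 2 =
      Complex.exp (Complex.I * ν) := by
    rw [mul_comm Complex.I (ν : ℂ), Complex.exp_mul_I]
    push_cast
    ring
  obtain ⟨δ₀, hδ₀, hL₀⟩ := laplace_crossing hγ hσ hc hd hu (by rw [ho₀]; positivity)
  obtain ⟨δ₁, hδ₁, hL₁⟩ := laplace_crossing hγ hσ hc hd hv (by
    rw [ho₁, neg_ne_zero]; positivity)
  rw [ho₀, hi₀, e₀, hG] at hL₀
  rw [ho₁, hi₁, e₁, hG'] at hL₁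
  set R : Set (ℝ × ℝ) := Icc a (a + T) ×ˢ Icc b (b + S) with hR
  have hRn : ∀ {t s : ℝ}, t ∈ Ioo a (a + T) → s ∈ Ioo b (b + S) → R ∈ 𝓝 (t, s) := fun ht hs =>
    prod_mem_nhds (Icc_mem_nhds ht.1 ht.2) (Icc_mem_nhds hs.1 hs.2)
  obtain ⟨η₀, hη₀, hB₀⟩ := Metric.nhds_basis_closedBall.mem_iff.1 (hRn ht₀ hs₀)
  obtain ⟨η₁, hη₁, hB₁⟩ := Metric.nhds_basis_closedBall.mem_iff.1 (hRn ht₁ hs₁)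
  have hdist : 0 < |t₀ - t₁| := abs_pos.2 (sub_ne_zero.2 hne)
  set δ := min (min (min δ₀ δ₁) (min η₀ η₁)) (|t₀ - t₁| / 3) with hδdef
  have hδ : 0 < δ := by positivity
  have hδa : δ ≤ min (min δ₀ δ₁) (min η₀ η₁) := min_le_left _ _
  have hδb : δ ≤ |t₀ - t₁| / 3 := min_le_right _ _
  have k1 : δ ≤ δ₀ := hδa.trans ((min_le_left _ _).trans (min_le_left _ _))
  have k2 : δ ≤ δ₁ := hδa.trans ((min_le_left _ _).trans (min_le_right _ _))
  have k3 : δ ≤ η₀ := hδa.trans ((min_le_right _ _).trans (min_le_left _ _))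
  have k4 : δ ≤ η₁ := hδa.trans ((min_le_right _ _).trans (min_le_right _ _))
  set B₀ := Metric.closedBall ((t₀, s₀) : ℝ × ℝ) δ with hB₀d
  set B₁ := Metric.closedBall ((t₁, s₁) : ℝ × ℝ) δ with hB₁d
  have hB₀R : B₀ ⊆ R := (Metric.closedBall_subset_closedBall k3).trans hB₀
  have hB₁R : B₁ ⊆ R := (Metric.closedBall_subset_closedBall k4).trans hB₁
  have hdisj : Disjoint B₀ B₁ := by
    rw [Set.disjoint_left]
    intro y hy0 hy1
    have e1 : |y.1 - t₀| ≤ δ := by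
      have : dist y.1 t₀ ≤ dist y ((t₀, s₀) : ℝ × ℝ) := le_max_left _ _
      exact this.trans hy0
    have e2 : |y.1 - t₁| ≤ δ := by
      have : dist y.1 t₁ ≤ dist y ((t₁, s₁) : ℝ × ℝ) := le_max_left _ _
      exact this.trans hy1
    have e3 := abs_sub_le t₀ y.1 t₁
    rw [abs_sub_comm t₀ y.1] at e3
    linarith
  have hRc : IsCompact R := isCompact_Icc.prod isCompact_Icc
  have hint : ∀ k : ℕ, ∀ {A : Set (ℝ × ℝ)}, A ⊆ R →
      IntegrableOn (fun y => overlap c d y ^ k) A := fun k A hA =>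
    ((hcont.pow k).continuousOn.integrableOn_compact hRc).mono_set hA
  -- away from the two crossings the overlap is uniformly smaller than one
  set K := R \ (Metric.ball ((t₀, s₀) : ℝ × ℝ) δ ∪ Metric.ball ((t₁, s₁) : ℝ × ℝ) δ) with hKd
  have hK : IsCompact K := hRc.diff (Metric.isOpen_ball.union Metric.isOpen_ball)
  have hrest := tendsto_integral_pow_compact hcont hK fun y hy => norm_overlap_lt_one hc hd
    fun heq => by
      rcases hinter y.1 hy.1.1 y.2 hy.1.2 heq with ⟨h1, h2⟩ | ⟨h1, h2⟩
      · exact hy.2 (Or.inl (by rw [show y = (t₀, s₀) from Prod.ext h1 h2]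
                               exact Metric.mem_ball_self hδ))
      · exact hy.2 (Or.inr (by rw [show y = (t₁, s₁) from Prod.ext h1 h2]
                               exact Metric.mem_ball_self hδ))
  have hT₀ := tendsto_crossing_phase (hnorm hu) (hL₀ δ hδ k1)
  have hT₁ := tendsto_crossing_phase (hnorm hv) (hL₁ δ hδ k2)
  have hsum := (hT₀.add hT₁).add (hrest.div_const (2 * π : ℂ))
  simp only [zero_div, add_zero] at hsum
  refine hsum.congr fun k => ?_
  have hI : (∫ t in a..(a + T), ∫ s in b..(b + S), inner ℂ (d s) (c t) ^ k) =
      ∫ y in R, overlap c d y ^ k := by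
    rw [hR, Measure.volume_eq_prod, setIntegral_prod _ (by
      rw [← Measure.volume_eq_prod]
      exact hint k subset_rfl), intervalIntegral.integral_of_le (by linarith [hγ.pos]),
      integral_Icc_eq_integral_Ioc]
    refine setIntegral_congr_fun measurableSet_Ioc fun t _ => ?_
    rw [intervalIntegral.integral_of_le (by linarith [hσ.pos]), integral_Icc_eq_integral_Ioc]
    rfl
  have hsplit : ∫ y in R, overlap c d y ^ k = (∫ y in B₀, overlap c d y ^ k) +
      (∫ y in B₁, overlap c d y ^ k) + ∫ y in K, overlap c d y ^ k := by
    have hBm : MeasurableSet (B₀ ∪ B₁) :=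
      (Metric.isClosed_closedBall.union Metric.isClosed_closedBall).measurableSet
    have hKae : (K : Set (ℝ × ℝ)) =ᵐ[volume] (R \ (B₀ ∪ B₁) : Set (ℝ × ℝ)) := by
      have hball : ∀ P : ℝ × ℝ, Metric.ball P δ =ᵐ[volume] Metric.closedBall P δ := fun P =>
        ae_eq_of_subset_of_measure_ge Metric.ball_subset_closedBall
          (Measure.addHaar_closedBall_eq_addHaar_ball volume P δ).le
          Metric.isOpen_ball.measurableSet.nullMeasurableSet measure_closedBall_lt_top.ne
      exact (ae_eq_refl R).diff (ae_eq_set_union (hball _) (hball _))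
    rw [setIntegral_congr_set hKae, ← setIntegral_union hdisj
      Metric.isClosed_closedBall.measurableSet (hint k hB₀R) (hint k hB₁R),
      setIntegral_sdiff hBm (hint k subset_rfl) (union_subset hB₀R hB₁R)]
    ring
  rw [hI, hsplit]
  ring

/-! ### Rotation invariance of the area of the sphere -/

theorem continuous_spherePoint : Continuous spherePoint := by
  unfold spherePoint
  refine (PiLp.continuous_toLp 2 _).comp (continuous_pi fun i => ?_)
  fin_cases i <;> simp <;> fun_prop

theorem norm_spherePoint (y : ℝ × ℝ) : ‖spherePoint y‖ = 1 := by
  rw [← pow_eq_one_iff_of_nonneg (norm_nonneg _) two_ne_zero, ← real_inner_self_eq_norm_sq,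
    inner_E3]
  simp [spherePoint]
  have h1 := sin_sq_add_cos_sq y.1
  have h2 := sin_sq_add_cos_sq y.2
  linear_combination (sin y.1 ^ 2) * h2 + h1

/-- Spherical coordinates `(r, θ, φ)` of three-space. -/
def sphericalMap (y : Fin 3 → ℝ) : Fin 3 → ℝ :=
  ![y 0 * (sin (y 1) * cos (y 2)), y 0 * (sin (y 1) * sin (y 2)), y 0 * cos (y 1)]

theorem toLp_sphericalMap (y : Fin 3 → ℝ) :
    WithLp.toLp 2 (sphericalMap y) = y 0 • spherePoint (y 1, y 2) := by
  ext i
  fin_cases i <;> simp [sphericalMap, spherePoint]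

/-- The differential of `sphericalMap`. -/
def sphericalDeriv (y : Fin 3 → ℝ) : (Fin 3 → ℝ) →L[ℝ] (Fin 3 → ℝ) :=
  (Matrix.toLin' !![sin (y 1) * cos (y 2), y 0 * (cos (y 1) * cos (y 2)),
      -(y 0 * (sin (y 1) * sin (y 2)));
    sin (y 1) * sin (y 2), y 0 * (cos (y 1) * sin (y 2)), y 0 * (sin (y 1) * cos (y 2));
    cos (y 1), -(y 0 * sin (y 1)), 0]).toContinuousLinearMap

theorem det_sphericalDeriv (y : Fin 3 → ℝ) : (sphericalDeriv y).det = y 0 ^ 2 * sin (y 1) := by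
  rw [sphericalDeriv, LinearMap.det_toContinuousLinearMap, LinearMap.det_toLin',
    Matrix.det_fin_three]
  simp
  have h1 := sin_sq_add_cos_sq (y 1)
  have h2 := sin_sq_add_cos_sq (y 2)
  linear_combination (y 0 ^ 2 * sin (y 1)) * h1 + (y 0 ^ 2 * sin (y 1)) * h2 *
    (sin (y 1) ^ 2 + cos (y 1) ^ 2)

theorem hasFDerivAt_sphericalMap (y : Fin 3 → ℝ) :
    HasFDerivAt sphericalMap (sphericalDeriv y) y := by
  have hp : ∀ i : Fin 3, HasFDerivAt (fun y : Fin 3 → ℝ => y i)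
      (ContinuousLinearMap.proj (R := ℝ) (φ := fun _ : Fin 3 => ℝ) i) y := fun i =>
    hasFDerivAt_apply i y
  have h0 := hp 0
  have hs1 := (hp 1).sin
  have hc1 := (hp 1).cos
  have hs2 := (hp 2).sin
  have hc2 := (hp 2).cos
  rw [hasFDerivAt_pi']
  intro i
  fin_cases i
  · refine (h0.mul (hs1.mul hc2)).congr_fderiv ?_
    ext v
    simp [sphericalDeriv, Matrix.toLin'_apply, dotProduct, Fin.sum_univ_three]
    ring
  · refine (h0.mul (hs1.mul hs2)).congr_fderiv ?_
    ext v
    simp [sphericalDeriv, Matrix.toLin'_apply, dotProduct, Fin.sum_univ_three]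
    ring
  · refine (h0.mul hc1).congr_fderiv ?_
    ext v
    simp [sphericalDeriv, Matrix.toLin'_apply, dotProduct, Fin.sum_univ_three]
    ring

theorem spherePoint_injOn : InjOn spherePoint (Ioo 0 π ×ˢ Ioo 0 (2 * π)) := by
  intro y hy z hz h
  have h0 := congrArg (fun x : E3 => x 0) h
  have h1 := congrArg (fun x : E3 => x 1) h
  have h2 := congrArg (fun x : E3 => x 2) h
  simp [spherePoint] at h0 h1 h2
  have e1 : y.1 = z.1 := injOn_cos (Ioo_subset_Icc_self hy.1) (Ioo_subset_Icc_self hz.1) h2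
  have hs : sin z.1 ≠ 0 := (sin_pos_of_mem_Ioo hz.1).ne'
  rw [e1] at h0 h1
  have hcos := mul_left_cancel₀ hs h0
  have hsin := mul_left_cancel₀ hs h1
  have hone : cos (y.2 - z.2) = 1 := by
    rw [cos_sub, hcos, hsin]
    have := sin_sq_add_cos_sq z.2
    linear_combination this
  have e2 := (cos_eq_one_iff_of_lt_of_lt (by linarith [hy.2.1, hz.2.2])
    (by linarith [hy.2.2, hz.2.1])).1 hone
  exact Prod.ext e1 (sub_eq_zero.1 e2)

/-- The coordinate rectangle misses the meridian `φ = 0`, which lies in the null set `x 1 = 0`. -/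
theorem exists_spherePoint_eq {x : E3} (hx : ‖x‖ = 1) (hx1 : x 1 ≠ 0) :
    ∃ y ∈ Ioo 0 π ×ˢ Ioo 0 (2 * π), spherePoint y = x := by
  have hx2 : x 0 ^ 2 + x 1 ^ 2 + x 2 ^ 2 = 1 := by
    have := real_inner_self_eq_norm_sq x
    rw [hx, inner_E3] at this
    linarith
  have hpos : 0 < x 1 ^ 2 := by positivity
  set z : ℂ := ⟨-x 0, -x 1⟩ with hz
  have hz0 : z ≠ 0 := fun h => hx1 (by simpa [hz] using congrArg Complex.im h)
  have hnz : ‖z‖ = sin (arccos (x 2)) := by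
    rw [sin_arccos, Complex.norm_def, Complex.normSq_apply]
    congr 1
    simp [hz]
    linear_combination hx2
  have hlt : x 2 ^ 2 < 1 := by nlinarith [sq_nonneg (x 0)]
  have hlt' := abs_lt.1 ((sq_lt_one_iff_abs_lt_one _).1 hlt)
  refine ⟨(arccos (x 2), π + z.arg), ⟨⟨?_, ?_⟩, ⟨?_, ?_⟩⟩, ?_⟩
  · exact arccos_pos.2 hlt'.2
  · refine lt_of_le_of_ne (arccos_le_pi _) fun h => ?_
    rw [arccos_eq_pi] at h
    linarith
  · have := Complex.neg_pi_lt_arg z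
    simp only
    linarith
  · have h1 : z.arg ≠ π := fun h => by
      have := (Complex.arg_eq_pi_iff.1 h).2
      simp [hz, hx1] at this
    have := lt_of_le_of_ne (Complex.arg_le_pi z) h1
    simp only
    linarith
  · have hzn : ‖z‖ ≠ 0 := norm_ne_zero_iff.2 hz0
    ext i
    fin_cases i
    · simp [spherePoint]
      rw [add_comm π, cos_add_pi, Complex.cos_arg hz0, ← hnz]
      field_simp
      simp [hz]
    · simp [spherePoint]
      rw [add_comm π, sin_add_pi, Complex.sin_arg, ← hnz]
      field_simp
      simp [hz]
    · simp [spherePoint]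
      exact cos_arccos hlt'.1.le hlt'.2.le

/-- The part of the open unit ball which projects radially to `B`. -/
def coneOver (B : Set E3) : Set E3 := {x | 0 < ‖x‖ ∧ ‖x‖ < 1 ∧ ‖x‖⁻¹ • x ∈ B}

/-- The area of a set on the sphere is three times the volume of the cone over it. This expresses
`sphereArea` without coordinates. -/
theorem volume_coneOver {B : Set E3} (hB : MeasurableSet B) :
    sphereArea B = 3 * volume (coneOver B) := by
  set D : Set (ℝ × ℝ) := (Ioo 0 π ×ˢ Ioo 0 (2 * π)) ∩ spherePoint ⁻¹' B with hD
  have hU : MeasurableSet (Ioo 0 π ×ˢ Ioo (0 : ℝ) (2 * π)) := measurableSet_Ioo.prod measurableSet_Ioo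
  have hBm : MeasurableSet (spherePoint ⁻¹' B) := continuous_spherePoint.measurable hB
  have hDm : MeasurableSet D := hU.inter hBm
  have hA : sphereArea B = ∫⁻ w in D, ENNReal.ofReal (sin w.1) := by
    rw [sphereArea, Measure.map_apply continuous_spherePoint.measurable hB, coordMeasure,
      withDensity_apply _ hBm, Measure.restrict_restrict hBm, inter_comm]
  set e : (Fin 3 → ℝ) ≃ᵐ ℝ × (ℝ × ℝ) := (MeasurableEquiv.piFinSuccAbove (fun _ => ℝ) 0).trans
    ((MeasurableEquiv.refl ℝ).prodCongr MeasurableEquiv.finTwoArrow) with he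
  have hevol : MeasurePreserving e volume (volume.prod volume) :=
    (volume_preserving_piFinSuccAbove (fun _ : Fin 3 => ℝ) 0).trans
      ((MeasurePreserving.id volume).prod (volume_preserving_finTwoArrow ℝ))
  have hey : ∀ y : Fin 3 → ℝ, e y = (y 0, (y 1, y 2)) := fun y => rfl
  set s : Set (Fin 3 → ℝ) := e ⁻¹' (Ioo (0 : ℝ) 1 ×ˢ D) with hs
  have hsm : MeasurableSet s := e.measurable (measurableSet_Ioo.prod hDm)
  have hmem : ∀ y, y ∈ s ↔ y 0 ∈ Ioo (0 : ℝ) 1 ∧ (y 1, y 2) ∈ D := fun y => Iff.rfl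
  have hinj : InjOn sphericalMap s := by
    intro y hy z hz h
    rw [hmem] at hy hz
    have h' : y 0 • spherePoint (y 1, y 2) = z 0 • spherePoint (z 1, z 2) := by
      rw [← toLp_sphericalMap, ← toLp_sphericalMap, h]
    have h0 : y 0 = z 0 := by
      have := congrArg norm h'
      rwa [norm_smul, norm_smul, norm_spherePoint, norm_spherePoint, mul_one, mul_one,
        Real.norm_of_nonneg hy.1.1.le, Real.norm_of_nonneg hz.1.1.le] at this
    rw [h0] at h'
    have h1 := spherePoint_injOn hy.2.1 hz.2.1 (smul_right_injective _ hz.1.1.ne' h')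
    ext i
    fin_cases i
    · exact h0
    · exact congrArg Prod.fst h1
    · exact congrArg Prod.snd h1
  have hjac := lintegral_abs_det_fderiv_eq_addHaar_image volume hsm
    (fun y _ => (hasFDerivAt_sphericalMap y).hasFDerivWithinAt) hinj
  have hlhs : ∫⁻ y in s, ENNReal.ofReal |(sphericalDeriv y).det| =
      ENNReal.ofReal (1 / 3) * sphereArea B := by
    have h1 : ∀ y ∈ s, ENNReal.ofReal |(sphericalDeriv y).det| =
        ENNReal.ofReal ((e y).1 ^ 2) * ENNReal.ofReal (sin (e y).2.1) := fun y hy => by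
      rw [hmem] at hy
      rw [det_sphericalDeriv, hey, ← ENNReal.ofReal_mul (sq_nonneg _), abs_of_nonneg
        (mul_nonneg (sq_nonneg _) (sin_pos_of_mem_Ioo hy.2.1.1).le)]
    rw [setLIntegral_congr_fun hsm h1, hs, hevol.setLIntegral_comp_preimage
      (measurableSet_Ioo.prod hDm)
      (f := fun z => ENNReal.ofReal (z.1 ^ 2) * ENNReal.ofReal (sin z.2.1)) (by fun_prop),
      ← Measure.prod_restrict, lintegral_prod_mul (f := fun r : ℝ => ENNReal.ofReal (r ^ 2))
        (g := fun w : ℝ × ℝ => ENNReal.ofReal (sin w.1)) (by fun_prop) (by fun_prop), hA]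
    congr 1
    rw [← ofReal_integral_eq_lintegral_ofReal, ← integral_Ioc_eq_integral_Ioo,
      ← intervalIntegral.integral_of_le zero_le_one]
    · congr 1
      rw [integral_pow]
      norm_num
    · exact (Continuous.integrableOn_Icc (by fun_prop)).mono_set Ioo_subset_Icc_self
    · exact Eventually.of_forall fun r => sq_nonneg r
  have himg : volume (sphericalMap '' s) = volume (coneOver B) := by
    have h1 : volume (coneOver B) = volume (WithLp.toLp 2 ⁻¹' (coneOver B) : Set (Fin 3 → ℝ)) :=
      ((EuclideanSpace.volume_preserving_symm_measurableEquiv_toLp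
        (Fin 3)).symm.measure_preimage_equiv _).symm
    rw [h1]
    refine measure_congr (ae_eq_set.2 ⟨?_, ?_⟩)
    · rw [sdiff_eq_empty.2, measure_empty]
      rintro _ ⟨y, hy, rfl⟩
      rw [hmem] at hy
      have hn : ‖y 0 • spherePoint (y 1, y 2)‖ = y 0 := by
        rw [norm_smul, norm_spherePoint, mul_one, Real.norm_of_nonneg hy.1.1.le]
      show WithLp.toLp 2 (sphericalMap y) ∈ coneOver B
      rw [toLp_sphericalMap]
      refine ⟨by rw [hn]; exact hy.1.1, by rw [hn]; exact hy.1.2, ?_⟩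
      rw [hn, smul_smul, inv_mul_cancel₀ hy.1.1.ne', one_smul]
      exact hy.2.2
    · refine measure_mono_null (t := {x : Fin 3 → ℝ | x 1 = 0}) ?_ ?_
      · rintro x ⟨hx, hxs⟩
        by_contra hx1
        refine hxs ?_
        obtain ⟨hx0, hx2, hx3⟩ := hx
        set v : E3 := WithLp.toLp 2 x with hv
        have hn : ‖‖v‖⁻¹ • v‖ = 1 := by
          rw [norm_smul, norm_inv, norm_norm, inv_mul_cancel₀ hx0.ne']
        obtain ⟨w, hw, hwx⟩ := exists_spherePoint_eq hn (by
          simp only [PiLp.smul_apply, smul_eq_mul]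
          exact mul_ne_zero (inv_ne_zero hx0.ne') hx1)
        refine ⟨![‖v‖, w.1, w.2], ?_, ?_⟩
        · rw [hmem]
          refine ⟨⟨hx0, hx2⟩, hw, ?_⟩
          show spherePoint w ∈ B
          rw [hwx]
          exact hx3
        · have h2 := toLp_sphericalMap ![‖v‖, w.1, w.2]
          have h3 : spherePoint (![‖v‖, w.1, w.2] 1, ![‖v‖, w.1, w.2] 2) = ‖v‖⁻¹ • v := hwx
          rw [h3] at h2
          have h4 : (![‖v‖, w.1, w.2] : Fin 3 → ℝ) 0 = ‖v‖ := rfl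
          rw [h4, smul_smul, mul_inv_cancel₀ hx0.ne', one_smul] at h2
          exact (WithLp.toLp_injective 2) h2
      · exact Measure.pi_hyperplane _ 1 0
  rw [hlhs, himg] at hjac
  rw [← hjac, ← mul_assoc]
  have : (3 : ENNReal) * ENNReal.ofReal (1 / 3) = 1 := by
    rw [show (3 : ENNReal) = ENNReal.ofReal 3 by simp, ← ENNReal.ofReal_mul (by norm_num)]
    norm_num
  rw [this, one_mul]

/-- The area of the sphere is invariant under linear isometries, because the Lebesgue measure is. -/
theorem measurePreserving_sphereArea (R : E3 ≃ₗᵢ[ℝ] E3) :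
    MeasurePreserving R sphereArea sphereArea := by
  refine ⟨R.continuous.measurable, Measure.ext fun B hB => ?_⟩
  have hB' : MeasurableSet (R ⁻¹' B) := R.continuous.measurable hB
  rw [Measure.map_apply R.continuous.measurable hB, volume_coneOver hB, volume_coneOver hB']
  congr 1
  have h1 : coneOver (R ⁻¹' B) = R.toMeasurableEquiv ⁻¹' coneOver B := by
    ext x
    simp [coneOver]
  rw [h1]
  exact R.measurePreserving.measure_preimage_equiv (f := R.toMeasurableEquiv) _

theorem sphereArea_univ : sphereArea univ = ENNReal.ofReal (4 * π) := by
  have hm : Measurable fun y : ℝ × ℝ => ENNReal.ofReal (sin y.1) := by fun_prop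
  rw [sphereArea, Measure.map_apply continuous_spherePoint.measurable MeasurableSet.univ,
    preimage_univ, coordMeasure, withDensity_apply _ MeasurableSet.univ, Measure.restrict_univ,
    Measure.volume_eq_prod, ← Measure.prod_restrict]
  have := lintegral_prod_mul (μ := volume.restrict (Ioo (0 : ℝ) π))
    (ν := volume.restrict (Ioo (0 : ℝ) (2 * π))) (f := fun r : ℝ => ENNReal.ofReal (sin r))
    (g := fun _ => 1) (by fun_prop) (by fun_prop)
  simp only [mul_one] at this
  rw [this, ← ofReal_integral_eq_lintegral_ofReal, ← integral_Ioc_eq_integral_Ioo,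
    ← intervalIntegral.integral_of_le pi_pos.le]
  · simp
    rw [← ENNReal.ofReal_ofNat, ← ENNReal.ofReal_ofNat, ← ENNReal.ofReal_mul (by norm_num),
      ← ENNReal.ofReal_mul (by norm_num), ← ENNReal.ofReal_mul (by norm_num)]
    congr 1
    ring
  · exact (Continuous.integrableOn_Icc (by fun_prop)).mono_set Ioo_subset_Icc_self
  · filter_upwards [ae_restrict_mem measurableSet_Ioo] with t ht
    exact (sin_pos_of_mem_Ioo ht).le

instance : IsFiniteMeasure sphereArea := ⟨by rw [sphereArea_univ]; exact ENNReal.ofReal_lt_top⟩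

theorem ae_norm_eq_one : ∀ᵐ x ∂sphereArea, ‖x‖ = 1 := by
  rw [sphereArea, ae_map_iff continuous_spherePoint.aemeasurable
    (measurableSet_eq_fun continuous_norm.measurable measurable_const)]
  exact Eventually.of_forall norm_spherePoint

/-- A differentiable curve on the sphere is a null set. -/
theorem sphereArea_range_eq_zero {γ : ℝ → E3} (hγ : Differentiable ℝ γ) (hc : IsClosed (range γ)) :
    sphereArea (range γ) = 0 := by
  rw [volume_coneOver hc.measurableSet, mul_eq_zero]
  right
  -- the cone over the curve is the image of a map of three-space which ignores one coordinate
  set g : E3 → E3 := fun y => y 0 • γ (y 1) with hg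
  set pr : Fin 3 → E3 →L[ℝ] ℝ := fun i => PiLp.proj (𝕜 := ℝ) 2 (fun _ : Fin 3 => ℝ) i with hpr
  set g' : E3 → E3 →L[ℝ] E3 := fun y => y 0 • (pr 1).smulRight (deriv γ (y 1)) +
    (pr 0).smulRight (γ (y 1)) with hg'
  have hd : ∀ y, HasFDerivAt g (g' y) y := fun y => by
    have h0 : HasFDerivAt (fun y : E3 => y 0) (pr 0) y := (pr 0).hasFDerivAt
    have h1 : HasFDerivAt (fun y : E3 => y 1) (pr 1) y := (pr 1).hasFDerivAt
    refine (h0.smul ((hγ (y 1)).hasDerivAt.hasFDerivAt.comp y h1)).congr_fderiv ?_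
    ext v : 1
    simp [hg']
  have hdet : ∀ y, (g' y).det = 0 := fun y => by
    show LinearMap.det (g' y : E3 →ₗ[ℝ] E3) = 0
    rw [LinearMap.det_eq_zero_iff_ker_ne_bot]
    intro h
    have h2 : EuclideanSpace.single (2 : Fin 3) (1 : ℝ) ∈ LinearMap.ker (g' y : E3 →ₗ[ℝ] E3) := by
      simp [hg', hpr]
    rw [h, Submodule.mem_bot] at h2
    simpa using congrArg (fun x : E3 => x 2) h2
  refine measure_mono_null (t := g '' univ) ?_
    (addHaar_image_eq_zero_of_det_fderivWithin_eq_zero volume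
      (fun y _ => (hd y).hasFDerivWithinAt) fun y _ => hdet y)
  rintro x ⟨hx0, _, t, ht⟩
  refine ⟨!₂[‖x‖, t, 0], mem_univ _, ?_⟩
  simp only [hg]
  show ‖x‖ • γ t = x
  rw [ht, smul_smul, mul_inv_cancel₀ hx0.ne', one_smul]

/-- The integrand is odd under the reflection in the plane orthogonal to `v`, which fixes `y`. -/
theorem integral_odd_eq_zero {y v : E3} (hyv : inner ℝ y v = 0) (f : ℝ → ℝ) :
    ∫ x, inner ℝ x v * f (inner ℝ x y) ∂sphereArea = 0 := by
  set R := (ℝ ∙ v)ᗮ.reflection with hR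
  have hRv : R v = -v := Submodule.reflection_orthogonalComplement_singleton_eq_neg v
  have hRy : R y = y := by
    refine Submodule.reflection_mem_subspace_eq_self ?_
    rw [Submodule.mem_orthogonal_singleton_iff_inner_left]
    exact hyv
  have h1 := (measurePreserving_sphereArea R).integral_comp
    R.toHomeomorph.measurableEmbedding (fun x => inner ℝ x v * f (inner ℝ x y))
  have h2 : ∀ x, inner ℝ (R x) v * f (inner ℝ (R x) y) = -(inner ℝ x v * f (inner ℝ x y)) :=
      fun x => by
    have e1 : inner ℝ (R x) v = -inner ℝ x v := by
      have := R.inner_map_map x v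
      rw [hRv, inner_neg_right] at this
      linarith
    have e2 : inner ℝ (R x) y = inner ℝ x y := by
      conv_lhs => rw [← hRy]
      rw [R.inner_map_map]
    rw [e1, e2]
    ring
  simp only [h2, integral_neg] at h1
  linarith

/-- The function `1 / |x - y|` is integrable on the sphere: in polar coordinates around `y`, the
area element `sin θ dθ dφ` compensates the singularity. -/
theorem lintegral_inv_sqrt_le {y : E3} (hy : ‖y‖ = 1) :
    ∫⁻ x, ENNReal.ofReal (1 / √(1 - inner ℝ x y)) ∂sphereArea ≤
      ENNReal.ofReal (√2) * volume (Ioo 0 π ×ˢ Ioo (0 : ℝ) (2 * π)) := by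
  set e : E3 := EuclideanSpace.single (2 : Fin 3) (1 : ℝ) with he
  have hen : ‖e‖ = 1 := by simp [he]
  set R := (ℝ ∙ (y - e))ᗮ.reflection with hR
  have hRy : R y = e := Submodule.reflection_sub (by rw [hy, hen])
  have h1 := (measurePreserving_sphereArea R).lintegral_comp_emb
    R.toHomeomorph.measurableEmbedding (fun x => ENNReal.ofReal (1 / √(1 - inner ℝ x e)))
  have h2 : ∀ x, inner ℝ (R x) e = inner ℝ x y := fun x => by
    rw [← hRy, R.inner_map_map]
  simp only [h2] at h1
  have hm : Measurable fun y : ℝ × ℝ => ENNReal.ofReal (sin y.1) := by fun_prop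
  have hme : Measurable fun x : E3 => ENNReal.ofReal (1 / √(1 - inner ℝ x e)) := by fun_prop
  rw [h1, sphereArea, lintegral_map hme continuous_spherePoint.measurable, coordMeasure,
    lintegral_withDensity_eq_lintegral_mul _ hm
      (g := fun a => ENNReal.ofReal (1 / √(1 - inner ℝ (spherePoint a) e)))
      (hme.comp continuous_spherePoint.measurable)]
  refine (setLIntegral_mono measurable_const fun w hw => ?_).trans
    (setLIntegral_const _ _).le
  have h3 : inner ℝ (spherePoint w) e = cos w.1 := by
    rw [inner_E3]
    simp [spherePoint, he]
  simp only [Pi.mul_apply, h3]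
  have hs := sin_pos_of_mem_Ioo hw.1
  rw [← ENNReal.ofReal_mul hs.le]
  refine ENNReal.ofReal_le_ofReal ?_
  have h4 := sin_sq_add_cos_sq w.1
  have h5 : 0 < 1 - cos w.1 := by
    have h6 := cos_le_one w.1
    refine lt_of_le_of_ne (by linarith) fun h => ?_
    have : cos w.1 = 1 := by linarith
    rw [this] at h4
    nlinarith
  rw [mul_one_div, div_le_iff₀ (Real.sqrt_pos.2 h5), ← Real.sqrt_mul (by norm_num)]
  refine Real.le_sqrt_of_sq_le ?_
  have := cos_le_one w.1
  have := neg_one_le_cos w.1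
  nlinarith

/-! ### The angle form of a curve seen from a point -/

/-- Twice the rate of change of the argument of `wedge q (c t)` along a parallel lift `c` of `γ`,
where `q` lies over `x`. At `x = γ t`, where `wedge q (c t)` vanishes, the quotient is zero. -/
def angleRate (γ : ℝ → E3) (x : E3) (t : ℝ) : ℝ :=
  inner ℝ x (cross (γ t) (deriv γ t)) / (1 - inner ℝ x (γ t))

/-- The change of the argument of `wedge q (c t)` for `t` between `a` and `b`, where `q` lies over
`x` and `c` is a parallel lift of `γ`. -/
def angleChange (γ : ℝ → E3) (a b : ℝ) (x : E3) : ℝ := 1 / 2 * ∫ t in a..b, angleRate γ x t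

theorem inner_cross_self (v w : E3) : inner ℝ v (cross v w) = 0 := by
  simp only [inner_E3, cross_zero, cross_one, cross_two]
  ring

theorem inner_cross_right (v w : E3) : inner ℝ w (cross v w) = 0 := by
  simp only [inner_E3, cross_zero, cross_one, cross_two]
  ring

theorem IsLoop.continuous_deriv (hγ : IsLoop γ T) : Continuous (deriv γ) :=
  hγ.smooth.continuous_deriv (by simp)

theorem IsLoop.contDiff_deriv (hγ : IsLoop γ T) : ContDiff ℝ ∞ (deriv γ) :=
  (contDiff_infty_iff_deriv.1 hγ.smooth).2

theorem IsLoop.continuous (hγ : IsLoop γ T) : Continuous γ := hγ.smooth.continuous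

theorem IsLoop.inner_deriv (hγ : IsLoop γ T) (t : ℝ) : inner ℝ (γ t) (deriv γ t) = 0 := by
  have h1 := (hγ.differentiable t).hasDerivAt
  have h2 := h1.inner ℝ h1
  have h3 : (fun t => inner ℝ (γ t) (γ t)) = fun _ => (1 : ℝ) := funext fun t => by
    rw [real_inner_self_eq_norm_sq, hγ.mem_sphere, one_pow]
  rw [h3] at h2
  have h4 := h2.unique (hasDerivAt_const t (1 : ℝ))
  rw [real_inner_comm (γ t)] at h4
  linarith

theorem norm_cross_sq (v w : E3) :
    ‖cross v w‖ ^ 2 = ‖v‖ ^ 2 * ‖w‖ ^ 2 - inner ℝ v w ^ 2 := by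
  rw [← real_inner_self_eq_norm_sq, ← real_inner_self_eq_norm_sq, ← real_inner_self_eq_norm_sq]
  simp only [inner_E3, cross_zero, cross_one, cross_two]
  ring

theorem IsLoop.norm_normal_sq (hγ : IsLoop γ T) (t : ℝ) :
    ‖cross (γ t) (deriv γ t)‖ ^ 2 = 2 := by
  rw [norm_cross_sq, hγ.inner_deriv, hγ.mem_sphere, hγ.speed, Real.sq_sqrt (by norm_num)]
  norm_num

theorem continuous_cross {α : Type*} [TopologicalSpace α] {f g : α → E3} (hf : Continuous f)
    (hg : Continuous g) : Continuous fun a => cross (f a) (g a) := by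
  refine (PiLp.continuous_toLp 2 _).comp (continuous_pi fun i => ?_)
  fin_cases i <;> simp [crossProduct] <;> fun_prop

/-- The singularity of the rate of change at `x = γ t` is of order `1 / |x - γ t|` only. -/
theorem IsLoop.abs_angleRate_le (hγ : IsLoop γ T) {x : E3} (hx : ‖x‖ = 1) (t : ℝ) :
    |angleRate γ x t| ≤ 2 * (1 / √(1 - inner ℝ x (γ t))) := by
  set u := inner ℝ x (γ t) with hu
  set n := cross (γ t) (deriv γ t) with hn
  have hu1 : |u| ≤ 1 := by
    have := abs_real_inner_le_norm x (γ t)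
    rwa [hx, hγ.mem_sphere, one_mul] at this
  have hu2 := abs_le.1 hu1
  have h1 : (inner ℝ x n) ^ 2 ≤ 4 * (1 - u) := by
    have e1 : inner ℝ x n = inner ℝ (x - u • γ t) n := by
      rw [inner_sub_left, inner_smul_left, hn, inner_cross_self]
      simp
    have e2 : ‖x - u • γ t‖ ^ 2 = 1 - u ^ 2 := by
      rw [norm_sub_sq_real, norm_smul, inner_smul_right, hx, hγ.mem_sphere, ← hu, mul_one,
        Real.norm_eq_abs, sq_abs]
      ring
    have e3 := abs_real_inner_le_norm (x - u • γ t) n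
    have e4 := pow_le_pow_left₀ (abs_nonneg _) e3 2
    rw [sq_abs, mul_pow, e2, hn, hγ.norm_normal_sq] at e4
    rw [e1]
    nlinarith
  rcases eq_or_lt_of_le (show 0 ≤ 1 - u by linarith) with h0 | h0
  · unfold angleRate
    rw [← hu, ← h0]
    simp
  · have hs := Real.sqrt_pos.2 h0
    have hss := Real.mul_self_sqrt h0.le
    unfold angleRate
    rw [abs_div, ← hu, abs_of_pos h0, mul_one_div, div_le_div_iff₀ h0 hs]
    have h2 : |inner ℝ x n| ≤ 2 * √(1 - u) := by
      refine abs_le_of_sq_le_sq ?_ (by positivity)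
      rw [mul_pow, Real.sq_sqrt h0.le]
      linarith
    calc |inner ℝ x n| * √(1 - u) ≤ 2 * √(1 - u) * √(1 - u) := by gcongr
      _ = 2 * (1 - u) := by rw [mul_assoc, hss]

theorem IsLoop.measurable_angleRate (hγ : IsLoop γ T) :
    Measurable fun z : E3 × ℝ => angleRate γ z.1 z.2 := by
  have h1 := continuous_cross hγ.continuous hγ.continuous_deriv
  have h2 := hγ.continuous
  refine Measurable.div (Continuous.measurable ?_) (Continuous.measurable ?_)
  · exact continuous_fst.inner (h1.comp continuous_snd)
  · exact continuous_const.sub (continuous_fst.inner (h2.comp continuous_snd))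

/-- The rate of change is integrable over the sphere and the parameter together, although the angle
form is singular on the curve; this permits the exchange of the integrals. -/
theorem IsLoop.integrable_angleRate (hγ : IsLoop γ T) (a b : ℝ) :
    Integrable (fun z : E3 × ℝ => angleRate γ z.1 z.2)
      (sphereArea.prod (volume.restrict (Ioc a b))) := by
  refine ⟨hγ.measurable_angleRate.aestronglyMeasurable, ?_⟩
  rw [HasFiniteIntegral, lintegral_prod_symm _ (hγ.measurable_angleRate.enorm.aemeasurable)]
  set C := ENNReal.ofReal 2 *
    (ENNReal.ofReal (√2) * volume (Ioo 0 π ×ˢ Ioo (0 : ℝ) (2 * π))) with hC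
  have hCfin : C < ⊤ := by
    refine ENNReal.mul_lt_top ENNReal.ofReal_lt_top (ENNReal.mul_lt_top ENNReal.ofReal_lt_top ?_)
    exact (Metric.isBounded_Ioo _ _).prod (Metric.isBounded_Ioo _ _) |>.measure_lt_top
  have h1 : ∀ t : ℝ, ∫⁻ x, ‖angleRate γ x t‖ₑ ∂sphereArea ≤ C := fun t => by
    have h2 : ∫⁻ x, ‖angleRate γ x t‖ₑ ∂sphereArea ≤
        ∫⁻ x, ENNReal.ofReal 2 * ENNReal.ofReal (1 / √(1 - inner ℝ x (γ t))) ∂sphereArea := by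
      refine lintegral_mono_ae ?_
      filter_upwards [ae_norm_eq_one] with x hx
      rw [← ENNReal.ofReal_mul (by norm_num), Real.enorm_eq_ofReal_abs]
      exact ENNReal.ofReal_le_ofReal (hγ.abs_angleRate_le hx t)
    refine h2.trans ?_
    rw [lintegral_const_mul _ (by fun_prop)]
    exact mul_le_mul' le_rfl (lintegral_inv_sqrt_le (hγ.mem_sphere t))
  calc ∫⁻ t in Ioc a b, ∫⁻ x, ‖angleRate γ x t‖ₑ ∂sphereArea ≤ ∫⁻ _ in Ioc a b, C :=
        lintegral_mono h1
    _ = C * volume (Ioc a b) := by rw [setLIntegral_const]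
    _ < ⊤ := ENNReal.mul_lt_top hCfin measure_Ioc_lt_top

theorem IsLoop.integrable_angleChange (hγ : IsLoop γ T) {a b : ℝ} (hab : a ≤ b) :
    Integrable (angleChange γ a b) sphereArea := by
  have := (hγ.integrable_angleRate a b).integral_prod_left.const_mul (1 / 2)
  refine this.congr (Eventually.of_forall fun x => ?_)
  simp only [angleChange]
  rw [intervalIntegral.integral_of_le hab]

/-- The average over the sphere of the change of argument vanishes, because the reflection in the
plane of `γ t` and `γ' t` changes the sign of the rate of change. -/
theorem IsLoop.integral_angleChange (hγ : IsLoop γ T) {a b : ℝ} (hab : a ≤ b) :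
    ∫ x, angleChange γ a b x ∂sphereArea = 0 := by
  simp only [angleChange, integral_const_mul]
  have h1 := integral_integral_swap (f := fun x t => angleRate γ x t) (hγ.integrable_angleRate a b)
  simp only [intervalIntegral.integral_of_le hab]
  rw [h1]
  have h2 : ∀ t : ℝ, ∫ x, angleRate γ x t ∂sphereArea = 0 := fun t => by
    have := integral_odd_eq_zero (inner_cross_self (γ t) (deriv γ t)) fun u => (1 - u)⁻¹
    simpa only [angleRate, div_eq_mul_inv] using this
  simp [h2]

/-! ### The phase of the wedge product along a lift -/

theorem wedge_add_left (p q v : C2) : wedge (p + q) v = wedge p v + wedge q v := by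
  simp [wedge]
  ring

theorem wedge_smul_left (r : ℂ) (q v : C2) : wedge (r • q) v = r * wedge q v := by
  simp [wedge]
  ring

theorem wedge_smul_right (r : ℂ) (q v : C2) : wedge q (r • v) = r * wedge q v := by
  simp [wedge]
  ring

theorem IsParallelLift.hasDerivAt_wedge (hc : IsParallelLift c γ) (q : C2) (t : ℝ) :
    HasDerivAt (fun t => wedge q (c t)) (wedge q (deriv c t)) t :=
  ((hc.hasDerivAt_coord t 1).const_mul (q 0)).sub ((hc.hasDerivAt_coord t 0).const_mul (q 1))

theorem IsParallelLift.continuous_wedge (hc : IsParallelLift c γ) (q : C2) :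
    Continuous fun t => wedge q (c t) :=
  continuous_iff_continuousAt.2 fun t => (hc.hasDerivAt_wedge q t).continuousAt

theorem IsParallelLift.continuous_wedge_deriv (hc : IsParallelLift c γ) (hγ : IsLoop γ T)
    (q : C2) : Continuous fun t => wedge q (deriv c t) := by
  have := (hc.differentiable_deriv hγ.smooth).continuous
  unfold wedge
  fun_prop

theorem wedge_ne_zero_iff {q v : C2} (hq : ‖q‖ = 1) (hv : ‖v‖ = 1) :
    wedge q v ≠ 0 ↔ 1 - inner ℝ (hopf q) (hopf v) ≠ 0 := by
  rw [not_iff_not]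
  have := norm_wedge_sq q v hq hv
  constructor
  · intro h
    rw [h] at this
    simp at this
    linarith
  · intro h
    rw [h] at this
    simpa using this

/-- The connecting identity: the rate of change of the argument of the holomorphic section `wedge q`
along a parallel lift depends only on the base curve and on the point under `q`. -/
theorem im_logDeriv_wedge (hc : IsParallelLift c γ) {q : C2} (hq : ‖q‖ = 1) (t : ℝ) :
    (wedge q (deriv c t) / wedge q (c t)).im = 1 / 2 * angleRate γ (hopf q) t := by
  set w := wedge q (c t) with hw
  have h1 := wedge_perp q (c t) (IsParallelLift.speed c t)
  rw [← hc.deriv_eq, ← cross_tangent _ (hc.norm_eq t), ← hc.deriv_base, hc.lies_over] at h1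
  have h2 := norm_wedge_sq q (c t) hq (hc.norm_eq t)
  rw [hc.lies_over] at h2
  rw [Complex.div_im]
  have h3 := congrArg Complex.im h1
  simp at h3
  have h4 : Complex.normSq w = (1 - inner ℝ (hopf q) (γ t)) / 2 := by
    rw [Complex.normSq_eq_norm_sq, h2]
  unfold angleRate
  rw [← sub_div, h4]
  rcases eq_or_ne (1 - inner ℝ (hopf q) (γ t)) 0 with h0 | h0
  · rw [h0]
    simp
  · field_simp
    linear_combination 4 * h3

theorem continuousOn_logDeriv_wedge (hc : IsParallelLift c γ) (hγ : IsLoop γ T) {q : C2}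
    {A : Set ℝ} (h : ∀ t ∈ A, wedge q (c t) ≠ 0) :
    ContinuousOn (fun t => wedge q (deriv c t) / wedge q (c t)) A :=
  (hc.continuous_wedge_deriv hγ q).continuousOn.div (hc.continuous_wedge q).continuousOn h

theorem im_integral_logDeriv (hc : IsParallelLift c γ) (hγ : IsLoop γ T) {q : C2}
    (hq : ‖q‖ = 1) {a b : ℝ} (h : ∀ t ∈ uIcc a b, wedge q (c t) ≠ 0) :
    (∫ t in a..b, wedge q (deriv c t) / wedge q (c t)).im = angleChange γ a b (hopf q) := by
  have hint : IntervalIntegrable (fun t => wedge q (deriv c t) / wedge q (c t)) volume a b :=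
    (continuousOn_logDeriv_wedge hc hγ h).intervalIntegrable
  have := Complex.imCLM.intervalIntegral_comp_comm (μ := volume) hint
  simp only [Complex.imCLM_apply] at this
  rw [← this, angleChange, ← intervalIntegral.integral_const_mul]
  simp only [im_logDeriv_wedge hc hq]

/-- A nowhere vanishing function is recovered from the integral of its logarithmic derivative. -/
theorem exp_integral_logDeriv {f f' : ℝ → ℂ} {a b : ℝ} (hab : a ≤ b)
    (hf : ∀ t, HasDerivAt f (f' t) t) (hf' : Continuous f') (h : ∀ t ∈ Icc a b, f t ≠ 0) :
    f b = Complex.exp (∫ t in a..b, f' t / f t) * f a := by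
  have hfc : Continuous f := continuous_iff_continuousAt.2 fun t => (hf t).continuousAt
  have hI : ∀ t ∈ Icc a b, HasDerivAt (fun t => ∫ s in a..t, f' s / f s) (f' t / f t) t := by
    intro t ht
    refine intervalIntegral.integral_hasDerivAt_right ?_ ?_ ?_
    · refine ContinuousOn.intervalIntegrable (hf'.continuousOn.div hfc.continuousOn fun s hs => ?_)
      rw [uIcc_of_le ht.1] at hs
      exact h s ⟨hs.1, hs.2.trans ht.2⟩
    · exact (hf'.measurable.div hfc.measurable).stronglyMeasurable.stronglyMeasurableAtFilter
    · exact hf'.continuousAt.div hfc.continuousAt (h t ht)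
  have hg : ∀ t ∈ Icc a b, HasDerivAt
      (fun t => Complex.exp (-∫ s in a..t, f' s / f s) * f t) 0 t := by
    intro t ht
    refine ((hI t ht).neg.cexp.mul (hf t)).congr_deriv ?_
    have := h t ht
    field_simp
    ring
  have key := constant_of_has_deriv_right_zero
    (fun t ht => (hg t ht).continuousAt.continuousWithinAt)
    (fun t ht => (hg t (Ico_subset_Icc_self ht)).hasDerivWithinAt) b (right_mem_Icc.2 hab)
  simp only [intervalIntegral.integral_same, neg_zero, Complex.exp_zero, one_mul] at key
  rw [← key, ← mul_assoc, ← Complex.exp_add, add_neg_cancel, Complex.exp_zero, one_mul]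

/-- The phase of `wedge q (c t)` changes by `angleChange`. -/
theorem exp_angleChange (hc : IsParallelLift c γ) (hγ : IsLoop γ T) {q : C2} (hq : ‖q‖ = 1)
    {a b : ℝ} (hab : a ≤ b) (h : ∀ t ∈ Icc a b, wedge q (c t) ≠ 0) :
    wedge q (c b) * ‖wedge q (c a)‖ =
      Complex.exp (Complex.I * angleChange γ a b (hopf q)) * wedge q (c a) * ‖wedge q (c b)‖ := by
  have h1 := exp_integral_logDeriv hab (hc.hasDerivAt_wedge q) (hc.continuous_wedge_deriv hγ q) h
  have h2 := im_integral_logDeriv hc hγ hq (a := a) (b := b) (by rwa [uIcc_of_le hab])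
  set J := ∫ t in a..b, wedge q (deriv c t) / wedge q (c t) with hJ
  have h3 : Complex.exp J = (Real.exp J.re : ℂ) * Complex.exp (Complex.I * J.im) := by
    conv_lhs => rw [← Complex.re_add_im J, Complex.exp_add]
    rw [Complex.ofReal_exp, mul_comm (J.im : ℂ)]
  have h4 : ‖wedge q (c b)‖ = Real.exp J.re * ‖wedge q (c a)‖ := by
    rw [h1, norm_mul, Complex.norm_exp]
  rw [h4, h1, h3, h2]
  push_cast
  ring

/-- The change of argument is continuous in the point from which the curve is seen. -/
theorem IsLoop.continuousAt_angleChange (hγ : IsLoop γ T) {a b : ℝ} (hab : a ≤ b) {x : E3}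
    (h : ∀ t ∈ Icc a b, 0 < 1 - inner ℝ x (γ t)) : ContinuousAt (angleChange γ a b) x := by
  have hγc := hγ.continuous
  have hn := continuous_cross hγ.continuous hγ.continuous_deriv
  obtain ⟨t₀, ht₀, hmin⟩ := isCompact_Icc.exists_isMinOn (nonempty_Icc.2 hab)
    (f := fun t => 1 - inner ℝ x (γ t)) (by fun_prop)
  set m := 1 - inner ℝ x (γ t₀) with hm
  have hm0 : 0 < m := h t₀ ht₀
  -- cutting off the denominator gives a function continuous everywhere, which agrees with
  -- `angleChange` near `x`
  have hcont : Continuous fun y : E3 => 1 / 2 * ∫ t in a..b,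
      inner ℝ y (cross (γ t) (deriv γ t)) / max (1 - inner ℝ y (γ t)) (m / 2) := by
    refine continuous_const.mul
      (intervalIntegral.continuous_parametric_intervalIntegral_of_continuous' ?_ a b)
    refine Continuous.div ?_ ?_ fun z => ?_
    · exact continuous_fst.inner (hn.comp continuous_snd)
    · exact (continuous_const.sub (continuous_fst.inner (hγc.comp continuous_snd))).max
        continuous_const
    · exact (lt_max_of_lt_right (by positivity)).ne'
  refine hcont.continuousAt.congr ?_
  filter_upwards [Metric.ball_mem_nhds x (half_pos hm0)] with y hy
  simp only [angleChange]
  congr 1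
  refine intervalIntegral.integral_congr fun t ht => ?_
  rw [uIcc_of_le hab] at ht
  simp only [angleRate]
  rw [max_eq_left]
  have h1 : m ≤ 1 - inner ℝ x (γ t) := hmin ht
  have h2 := abs_real_inner_le_norm (y - x) (γ t)
  rw [hγ.mem_sphere, mul_one, inner_sub_left] at h2
  rw [Metric.mem_ball, dist_eq_norm] at hy
  have := (abs_le.1 h2).2
  linarith

theorem one_sub_inner_pos {x y : E3} (hx : ‖x‖ = 1) (hy : ‖y‖ = 1) (h : x ≠ y) :
    0 < 1 - inner ℝ x y := by
  have h1 : 0 < ‖x - y‖ ^ 2 := by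
    have := norm_pos_iff.2 (sub_ne_zero.2 h)
    positivity
  rw [norm_sub_sq_real, hx, hy] at h1
  linarith

theorem IsLoop.intervalIntegrable_angleRate (hγ : IsLoop γ T) {a b : ℝ} {x : E3}
    (h : ∀ t ∈ uIcc a b, 1 - inner ℝ x (γ t) ≠ 0) :
    IntervalIntegrable (angleRate γ x) volume a b := by
  have hγc := hγ.continuous
  have hn := continuous_cross hγ.continuous hγ.continuous_deriv
  exact ContinuousOn.intervalIntegrable (ContinuousOn.div (continuous_const.inner hn).continuousOn
    (continuous_const.sub (continuous_const.inner hγc)).continuousOn h)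

theorem IsLoop.angleChange_add (hγ : IsLoop γ T) {a b e : ℝ} {x : E3}
    (h : ∀ t ∈ uIcc a b, 1 - inner ℝ x (γ t) ≠ 0) (h' : ∀ t ∈ uIcc b e, 1 - inner ℝ x (γ t) ≠ 0) :
    angleChange γ a b x + angleChange γ b e x = angleChange γ a e x := by
  simp only [angleChange]
  rw [← mul_add, intervalIntegral.integral_add_adjacent_intervals
    (hγ.intervalIntegrable_angleRate h) (hγ.intervalIntegrable_angleRate h')]

/-! ### The jump of the change of argument across a curve -/

/-- Points `η α + i β` with `η > 0`, `α` near `1` and `β` in a cone around the real axis avoid the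
cut of the logarithm. -/
theorem mem_slitPlane_of_cone {η τ : ℝ} (hη : 0 < η) {α β : ℂ} (hα : ‖α - 1‖ ≤ 1 / 2)
    (hβ : ‖β - τ‖ ≤ 1 / 4 * |τ|) : (η : ℂ) * α + Complex.I * β ∈ Complex.slitPlane := by
  have h1 := (Complex.abs_re_le_norm _).trans hα
  have h2 := (Complex.abs_im_le_norm _).trans hα
  have h3 := (Complex.abs_re_le_norm _).trans hβ
  have h4 := (Complex.abs_im_le_norm _).trans hβ
  simp only [Complex.sub_re, Complex.sub_im, Complex.one_re, Complex.one_im, Complex.ofReal_re,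
    Complex.ofReal_im, sub_zero] at h1 h2 h3 h4
  rw [abs_le] at h1 h2 h3 h4
  rw [Complex.mem_slitPlane_iff]
  by_contra! hcon
  obtain ⟨h5, h6⟩ := hcon
  simp only [Complex.add_re, Complex.add_im, Complex.re_ofReal_mul, Complex.im_ofReal_mul,
    Complex.I_mul_re, Complex.I_mul_im] at h5 h6
  have h7 : η * (1 / 2) ≤ η * α.re := by gcongr; linarith
  have h8 : η * α.im ≤ η * (1 / 2) := by gcongr; linarith
  have h9 : η * (-(1 / 2)) ≤ η * α.im := by gcongr; linarith
  rcases abs_cases τ with ⟨h, h'⟩ | ⟨h, h'⟩ <;> rw [h] at h3 h4 <;> linarith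

/-- If `α` is near `1` and `β` vanishes to first order at `t₀`, then for `η → 0+` the change of
argument of `η α + i β` across `t₀` is determined by the values of `β` at the ends. -/
theorem tendsto_change_arg {α β α' β' : ℝ → ℂ} (hα : ∀ t, HasDerivAt α (α' t) t)
    (hβ : ∀ t, HasDerivAt β (β' t) t) (hα' : Continuous α') (hβ' : Continuous β') {s t₀ δ : ℝ}
    (hs : |s| = 1) (hδ : 0 < δ) (hα0 : ∀ t ∈ Icc (t₀ - δ) (t₀ + δ), ‖α t - 1‖ ≤ 1 / 2)
    (hβ0 : ∀ t ∈ Icc (t₀ - δ) (t₀ + δ), ‖β t - (s * (t - t₀) : ℝ)‖ ≤ 1 / 4 * |s * (t - t₀)|) :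
    Tendsto (fun η : ℝ => (∫ t in (t₀ - δ)..(t₀ + δ),
        (η * α' t + Complex.I * β' t) / (η * α t + Complex.I * β t)).im) (𝓝[>] 0)
      (𝓝 (Complex.arg (Complex.I * β (t₀ + δ)) - Complex.arg (Complex.I * β (t₀ - δ)))) := by
  have hslit : ∀ η : ℝ, 0 < η → ∀ t ∈ Icc (t₀ - δ) (t₀ + δ),
      (η : ℂ) * α t + Complex.I * β t ∈ Complex.slitPlane := fun η hη t ht =>
    mem_slitPlane_of_cone hη (hα0 t ht) (hβ0 t ht)
  have hle : t₀ - δ ≤ t₀ + δ := by linarith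
  have hαc : Continuous α := continuous_iff_continuousAt.2 fun t => (hα t).continuousAt
  have hβc : Continuous β := continuous_iff_continuousAt.2 fun t => (hβ t).continuousAt
  have hint : ∀ η : ℝ, 0 < η → (∫ t in (t₀ - δ)..(t₀ + δ),
      (η * α' t + Complex.I * β' t) / (η * α t + Complex.I * β t)).im =
      Complex.arg (η * α (t₀ + δ) + Complex.I * β (t₀ + δ)) -
        Complex.arg (η * α (t₀ - δ) + Complex.I * β (t₀ - δ)) := by
    intro η hη
    rw [intervalIntegral.integral_eq_sub_of_hasDerivAt
      (f := fun t => Complex.log (η * α t + Complex.I * β t))]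
    · rw [Complex.sub_im, Complex.log_im, Complex.log_im]
    · intro t ht
      rw [uIcc_of_le hle] at ht
      exact (((hα t).const_mul (η : ℂ)).add ((hβ t).const_mul Complex.I)).clog_real (hslit η hη t ht)
    · refine ContinuousOn.intervalIntegrable (ContinuousOn.div (by fun_prop) (by fun_prop) ?_)
      intro t ht
      rw [uIcc_of_le hle] at ht
      exact Complex.slitPlane_ne_zero (hslit η hη t ht)
  have hend : ∀ t ∈ Icc (t₀ - δ) (t₀ + δ), t ≠ t₀ → Tendsto
      (fun η : ℝ => Complex.arg (η * α t + Complex.I * β t)) (𝓝[>] 0)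
      (𝓝 (Complex.arg (Complex.I * β t))) := by
    intro t ht hne
    have hmem : Complex.I * β t ∈ Complex.slitPlane := by
      rw [Complex.mem_slitPlane_iff]
      right
      rw [Complex.I_mul_im]
      intro h0
      have h3 := (Complex.abs_re_le_norm _).trans (hβ0 t ht)
      rw [Complex.sub_re, h0, Complex.ofReal_re, zero_sub, abs_neg, abs_mul, hs] at h3
      have := abs_pos.2 (sub_ne_zero.2 hne)
      linarith
    have h1 : Tendsto (fun η : ℝ => (η : ℂ) * α t + Complex.I * β t) (𝓝[>] 0)
        (𝓝 (Complex.I * β t)) := by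
      have : Continuous fun η : ℝ => (η : ℂ) * α t + Complex.I * β t := by fun_prop
      have h2 := this.tendsto 0
      simp only [Complex.ofReal_zero, zero_mul, zero_add] at h2
      exact h2.mono_left nhdsWithin_le_nhds
    exact (Complex.continuousAt_arg hmem).tendsto.comp h1
  refine ((hend _ (right_mem_Icc.2 hle) (by linarith)).sub
    (hend _ (left_mem_Icc.2 hle) (by linarith))).congr' ?_
  filter_upwards [self_mem_nhdsWithin] with η hη
  exact (hint η hη).symm

/-- The two sides of the curve use the arguments of `i β` and of `-i β`; at each end of the arc they
differ by half a turn. -/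
theorem arg_I_mul_sub_arg_neg {z : ℂ} (hz : 0 < z.re) :
    Complex.arg (Complex.I * z) - Complex.arg (Complex.I * -z) = π := by
  rw [mul_neg, Complex.arg_neg_eq_arg_sub_pi_of_im_pos (by simpa using hz)]
  ring

theorem wedge_perp_left (c v : C2) : wedge (perp c) v = -inner ℂ c v := by
  simp [wedge, perp, inner_C2]
  ring

/-- The horizontal line through `c` is mapped to a curve in the plane of `hopf c` and `tangent c l`.
-/
theorem hopf_add_smul_perp (c : C2) (l : ℂ) :
    hopf (c + l • perp c) = (1 - ‖l‖ ^ 2) • hopf c + tangent c l := by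
  rw [← Complex.normSq_eq_norm_sq, Complex.normSq_apply]
  ext i
  fin_cases i
  all_goals
    simp only [Fin.zero_eta, Fin.mk_one, Fin.reduceFinMk, PiLp.add_apply, PiLp.smul_apply,
      smul_eq_mul, hopf_zero, hopf_one, hopf_two, tangent_zero, tangent_one, tangent_two]
    simp [perp]
    ring

theorem hopf_ofReal_smul (r : ℝ) (q : C2) : hopf ((r : ℂ) • q) = r ^ 2 • hopf q := by
  ext i
  fin_cases i
  all_goals
    simp only [Fin.zero_eta, Fin.mk_one, Fin.reduceFinMk, PiLp.smul_apply,
      smul_eq_mul, hopf_zero, hopf_one, hopf_two]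
    simp
    ring

theorem tangent_ofReal_mul (c : C2) (r : ℝ) (l : ℂ) : tangent c (r * l) = r • tangent c l := by
  ext i
  fin_cases i
  all_goals
    simp only [Fin.zero_eta, Fin.mk_one, Fin.reduceFinMk, PiLp.smul_apply,
      smul_eq_mul, tangent_zero, tangent_one, tangent_two]
    simp
    ring

/-- The curve on the sphere through `γ t` which is the image of `c t + i η c' t` under the Hopf
map. It crosses `γ` from the right to the left. -/
def crossing (γ : ℝ → E3) (t η : ℝ) : E3 :=
  (1 + η ^ 2 / 2)⁻¹ • ((1 - η ^ 2 / 2) • γ t + η • cross (γ t) (deriv γ t))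

theorem crossing_zero (γ : ℝ → E3) (t : ℝ) : crossing γ t 0 = γ t := by
  simp [crossing]

theorem hasDerivAt_crossing (γ : ℝ → E3) (t : ℝ) :
    HasDerivAt (crossing γ t) (cross (γ t) (deriv γ t)) 0 := by
  have h1 : HasDerivAt (fun η : ℝ => η ^ 2 / 2) 0 0 := by
    simpa using ((hasDerivAt_id (0 : ℝ)).pow 2).div_const 2
  have h2 := ((h1.const_add 1).inv (by norm_num)).smul
    (((h1.const_sub 1).smul_const (γ t)).add
      ((hasDerivAt_id (0 : ℝ)).smul_const (cross (γ t) (deriv γ t))))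
  refine h2.congr_deriv ?_
  simp

theorem tendsto_crossing (γ : ℝ → E3) (t₀ : ℝ) : Tendsto (crossing γ t₀) (𝓝 0) (𝓝 (γ t₀)) := by
  have := (hasDerivAt_crossing γ t₀).continuousAt.tendsto
  rwa [crossing_zero] at this

/-- A unit vector over `crossing γ t η`. -/
theorem exists_hopf_eq_crossing (hc : IsParallelLift c γ) (hγ : IsLoop γ T) (t η : ℝ) :
    ∃ r : ℝ, r ≠ 0 ∧ ‖(r : ℂ) • (c t + (Complex.I * η) • deriv c t)‖ = 1 ∧
      hopf ((r : ℂ) • (c t + (Complex.I * η) • deriv c t)) = crossing γ t η := by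
  have hpos : 0 < 1 + η ^ 2 / 2 := by positivity
  have hD : ‖IsParallelLift.speed c t‖ ^ 2 = 1 / 2 := by
    have := hc.norm_speed_sq t
    rw [hγ.speed, sq_sqrt zero_le_two] at this
    linarith
  refine ⟨(√(1 + η ^ 2 / 2))⁻¹, inv_ne_zero (sqrt_pos.2 hpos).ne', ?_, ?_⟩
  · have h1 := norm_add_sq_eq_norm_sq_add_norm_sq_of_inner_eq_zero (𝕜 := ℂ) (c t)
      ((Complex.I * η) • deriv c t) (by rw [inner_smul_right, hc.parallel, mul_zero])
    have h2 : ‖c t + (Complex.I * η) • deriv c t‖ = √(1 + η ^ 2 / 2) := by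
      rw [eq_comm, sqrt_eq_iff_mul_self_eq hpos.le (norm_nonneg _), h1, hc.norm_eq, norm_smul,
        norm_mul, Complex.norm_I, Complex.norm_real, one_mul, Real.norm_eq_abs]
      have h3 := hγ.norm_speed hc t
      linear_combination (-η ^ 2) * h3 - ‖deriv c t‖ ^ 2 * abs_mul_abs_self η
    rw [norm_smul, h2, Complex.norm_real, norm_inv, Real.norm_eq_abs, abs_of_nonneg (sqrt_nonneg _)]
    exact inv_mul_cancel₀ (sqrt_pos.2 hpos).ne'
  · have h1 : Complex.I * η * IsParallelLift.speed c t =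
        η * (Complex.I * IsParallelLift.speed c t) := by ring
    rw [hopf_ofReal_smul, hc.deriv_eq, smul_smul, hopf_add_smul_perp, crossing, inv_pow,
      sq_sqrt hpos.le, hc.lies_over, hc.deriv_base, ← hc.lies_over, cross_tangent _ (hc.norm_eq t),
      ← tangent_ofReal_mul, h1, norm_mul, norm_mul, Complex.norm_I, one_mul, mul_pow, hD,
      Complex.norm_real, Real.norm_eq_abs, sq_abs]
    congr 3
    ring

theorem norm_crossing (hc : IsParallelLift c γ) (hγ : IsLoop γ T) (t η : ℝ) :
    ‖crossing γ t η‖ = 1 := by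
  obtain ⟨r, -, h1, h2⟩ := exists_hopf_eq_crossing hc hγ t η
  rw [← h2, norm_hopf _ h1]

/-- Up to a factor not depending on `v`, the value of `wedge` is of the form `η α + i β` to which
`tendsto_change_arg` applies. -/
theorem wedge_crossing (hc : IsParallelLift c γ) (t₀ η : ℝ) (hD : IsParallelLift.speed c t₀ ≠ 0)
    (v : C2) : wedge (c t₀ + (Complex.I * η) • deriv c t₀) v =
      -Complex.I * IsParallelLift.speed c t₀ *
        (η * inner ℂ (c t₀) v + Complex.I * (wedge (c t₀) v / IsParallelLift.speed c t₀)) := by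
  rw [wedge_add_left, wedge_smul_left, hc.deriv_eq, wedge_smul_left, wedge_perp_left]
  field_simp
  linear_combination wedge (c t₀) v * Complex.I_sq

/-- The change of argument seen from `crossing γ t₀ η` as the integral of the logarithmic derivative
of a function of the form `η α + i β`. -/
theorem angleChange_crossing (hc : IsParallelLift c γ) (hγ : IsLoop γ T) {a b t₀ η : ℝ}
    (hab : a ≤ b) (hD : IsParallelLift.speed c t₀ ≠ 0)
    (h : ∀ t ∈ Icc a b, η * inner ℂ (c t₀) (c t) +
      Complex.I * (wedge (c t₀) (c t) / IsParallelLift.speed c t₀) ≠ 0) :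
    angleChange γ a b (crossing γ t₀ η) = (∫ t in a..b, (η * inner ℂ (c t₀) (deriv c t) +
      Complex.I * (wedge (c t₀) (deriv c t) / IsParallelLift.speed c t₀)) /
      (η * inner ℂ (c t₀) (c t) +
      Complex.I * (wedge (c t₀) (c t) / IsParallelLift.speed c t₀))).im ∧
    ∀ t ∈ Icc a b, 1 - inner ℝ (crossing γ t₀ η) (γ t) ≠ 0 := by
  obtain ⟨r, hr, h1, h2⟩ := exists_hopf_eq_crossing hc hγ t₀ η
  have hr' : (r : ℂ) ≠ 0 := Complex.ofReal_ne_zero.2 hr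
  have hne : ∀ t ∈ Icc a b,
      wedge ((r : ℂ) • (c t₀ + (Complex.I * η) • deriv c t₀)) (c t) ≠ 0 := by
    intro t ht
    rw [wedge_smul_left, wedge_crossing hc _ _ hD]
    exact mul_ne_zero hr' (mul_ne_zero (mul_ne_zero (neg_ne_zero.2 Complex.I_ne_zero) hD) (h t ht))
  constructor
  · rw [← h2, ← im_integral_logDeriv hc hγ h1 (by rwa [uIcc_of_le hab])]
    congr 1
    refine intervalIntegral.integral_congr fun t ht => ?_
    simp only [wedge_smul_left, wedge_crossing hc _ _ hD]
    rw [mul_div_mul_left _ _ hr', mul_div_mul_left _ _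
      (mul_ne_zero (neg_ne_zero.2 Complex.I_ne_zero) hD)]
  · intro t ht
    rw [← h2, ← hc.lies_over, ← wedge_ne_zero_iff h1 (hc.norm_eq t)]
    exact hne t ht

theorem hasDerivAt_inner_lift (hc : IsParallelLift c γ) (q : C2) (t : ℝ) :
    HasDerivAt (fun t => inner ℂ q (c t)) (inner ℂ q (deriv c t)) t := by
  simp only [inner_C2]
  exact ((hc.hasDerivAt_coord t 0).const_mul _).add ((hc.hasDerivAt_coord t 1).const_mul _)

/-- The change of argument along an arc jumps by `2 π` where the arc is crossed from the right to
the left. -/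
theorem tendsto_jump (hc : IsParallelLift c γ) (hγ : IsLoop γ T) {a b t₀ : ℝ} (ha : a < t₀)
    (hb : t₀ < b) (hne : ∀ t ∈ Icc a b, γ t = γ t₀ → t = t₀) :
    Tendsto (fun η => angleChange γ a b (crossing γ t₀ η) - angleChange γ a b (crossing γ t₀ (-η)))
      (𝓝[>] 0) (𝓝 (2 * π)) := by
  set D := IsParallelLift.speed c t₀ with hDdef
  have hD : D ≠ 0 := by
    intro h0
    have := hc.norm_speed_sq t₀
    rw [hγ.speed, sq_sqrt zero_le_two, ← hDdef, h0] at this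
    norm_num at this
  set α : ℝ → ℂ := fun t => inner ℂ (c t₀) (c t) with hαdef
  set α' : ℝ → ℂ := fun t => inner ℂ (c t₀) (deriv c t) with hα'def
  set β : ℝ → ℂ := fun t => wedge (c t₀) (c t) / D with hβdef
  set β' : ℝ → ℂ := fun t => wedge (c t₀) (deriv c t) / D with hβ'def
  have hα : ∀ t, HasDerivAt α (α' t) t := fun t => hasDerivAt_inner_lift hc _ t
  have hβ : ∀ t, HasDerivAt β (β' t) t := fun t => (hc.hasDerivAt_wedge _ t).div_const D
  have hα' : Continuous α' :=
    continuous_const.inner (hc.differentiable_deriv hγ.smooth).continuous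
  have hβ' : Continuous β' := (hc.continuous_wedge_deriv hγ _).div_const D
  have hα0 : α t₀ = 1 := by
    rw [hαdef]
    simp only
    rw [inner_self_eq_norm_sq_to_K, hc.norm_eq]
    simp
  have hβ0 : β t₀ = 0 := by simp [hβdef, wedge, mul_comm]
  have hβ1 : β' t₀ = 1 := div_self hD
  have hα1 : ∀ᶠ t in 𝓝 t₀, ‖α t - 1‖ ≤ 1 / 2 := by
    have h1 : Tendsto (fun t => ‖α t - 1‖) (𝓝 t₀) (𝓝 0) := by
      have := ((hα t₀).continuousAt.sub (continuousAt_const (y := (1 : ℂ)))).norm.tendsto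
      simpa [hα0] using this
    exact (h1.eventually (gt_mem_nhds (by norm_num : (0 : ℝ) < 1 / 2))).mono fun t => le_of_lt
  have hβ2 : ∀ᶠ t in 𝓝 t₀, ‖β t - (t - t₀ : ℝ)‖ ≤ 1 / 4 * |t - t₀| := by
    have h1 := (hasDerivAt_iff_isLittleO.1 (hβ t₀)).def (c := 1 / 4) (by norm_num)
    filter_upwards [h1] with t ht
    simpa [hβ0, hβ1] using ht
  obtain ⟨δ₀, hδ₀, hball⟩ := Metric.eventually_nhds_iff_ball.1 (hα1.and hβ2)
  obtain ⟨δ, hδ, hδ'⟩ := exists_between (lt_min hδ₀ (lt_min (sub_pos.2 ha) (sub_pos.2 hb)))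
  have hδ1 : δ < δ₀ := hδ'.trans_le (min_le_left _ _)
  have hδa : a < t₀ - δ := by
    have := hδ'.trans_le ((min_le_right _ _).trans (min_le_left _ _))
    linarith
  have hδb : t₀ + δ < b := by
    have := hδ'.trans_le ((min_le_right _ _).trans (min_le_right _ _))
    linarith
  have hnear : ∀ t ∈ Icc (t₀ - δ) (t₀ + δ), ‖α t - 1‖ ≤ 1 / 2 ∧
      ‖β t - (t - t₀ : ℝ)‖ ≤ 1 / 4 * |t - t₀| := by
    intro t ht
    refine hball t ?_
    rw [Real.ball_eq_Ioo]
    exact ⟨by linarith [ht.1], by linarith [ht.2]⟩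
  have hle : t₀ - δ ≤ t₀ + δ := by linarith
  -- on the part of the arc near `t₀` the change of argument tends to a different limit on each side
  have hmid₁ := tendsto_change_arg hα hβ hα' hβ' (s := 1) (by simp) hδ (fun t ht => (hnear t ht).1)
    (fun t ht => by simpa only [one_mul] using (hnear t ht).2)
  have hmid₂ := tendsto_change_arg (β := fun t => -β t) (β' := fun t => -β' t) hα
    (fun t => (hβ t).neg) hα' hβ'.neg (s := -1) (by simp) hδ (fun t ht => (hnear t ht).1)
    (fun t ht => by
      rw [neg_one_mul, abs_neg, Complex.ofReal_neg, ← neg_sub', norm_neg]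
      exact (hnear t ht).2)
  have hre : ∀ t ∈ Icc (t₀ - δ) (t₀ + δ), |(β t).re - (t - t₀)| ≤ 1 / 4 * |t - t₀| := by
    intro t ht
    have := (Complex.abs_re_le_norm _).trans (hnear t ht).2
    rwa [Complex.sub_re, Complex.ofReal_re] at this
  have hre₁ : 0 < (β (t₀ + δ)).re := by
    have := (abs_le.1 (hre _ (right_mem_Icc.2 hle))).1
    rw [add_sub_cancel_left, abs_of_pos hδ] at this
    linarith
  have hre₂ : 0 < (-β (t₀ - δ)).re := by
    have := (abs_le.1 (hre _ (left_mem_Icc.2 hle))).2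
    rw [sub_sub_cancel_left, abs_neg, abs_of_pos hδ] at this
    rw [Complex.neg_re]
    linarith
  have hmid := hmid₁.sub hmid₂
  have harg : (Complex.arg (Complex.I * β (t₀ + δ)) - Complex.arg (Complex.I * β (t₀ - δ))) -
      (Complex.arg (Complex.I * -β (t₀ + δ)) - Complex.arg (Complex.I * -β (t₀ - δ))) = 2 * π := by
    have h1 := arg_I_mul_sub_arg_neg hre₁
    have h2 := arg_I_mul_sub_arg_neg hre₂
    rw [neg_neg] at h2
    linarith
  rw [harg] at hmid
  have hslit : ∀ η : ℝ, 0 < η → ∀ t ∈ Icc (t₀ - δ) (t₀ + δ),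
      (η : ℂ) * α t + Complex.I * β t ≠ 0 ∧ ((-η : ℝ) : ℂ) * α t + Complex.I * β t ≠ 0 := by
    intro η hη t ht
    constructor
    · exact Complex.slitPlane_ne_zero (mem_slitPlane_of_cone hη (hnear t ht).1 (hnear t ht).2)
    · have h1 := mem_slitPlane_of_cone (β := -β t) (τ := -(t - t₀)) hη (hnear t ht).1 (by
        rw [abs_neg, Complex.ofReal_neg, ← neg_sub', norm_neg]
        exact (hnear t ht).2)
      have h2 := neg_ne_zero.2 (Complex.slitPlane_ne_zero h1)
      convert h2 using 1
      push_cast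
      ring
  -- on the rest of the arc the change of argument is continuous at `γ t₀`
  have hcr := tendsto_crossing γ t₀
  have hcr₁ : Tendsto (crossing γ t₀) (𝓝[>] 0) (𝓝 (γ t₀)) := hcr.mono_left nhdsWithin_le_nhds
  have hcr₂ : Tendsto (fun η => crossing γ t₀ (-η)) (𝓝[>] 0) (𝓝 (γ t₀)) := by
    refine (hcr.comp ?_).mono_left nhdsWithin_le_nhds
    have := (continuous_neg (G := ℝ)).tendsto 0
    rwa [neg_zero] at this
  have houter : ∀ {x y : ℝ}, x ≤ y → (∀ t ∈ Icc x y, γ t₀ ≠ γ t) →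
      Tendsto (fun η => angleChange γ x y (crossing γ t₀ η) -
        angleChange γ x y (crossing γ t₀ (-η))) (𝓝[>] 0) (𝓝 0) ∧
      ∀ᶠ z in 𝓝 (γ t₀), ‖z‖ = 1 → ∀ t ∈ Icc x y, 1 - inner ℝ z (γ t) ≠ 0 := by
    intro x y hxy h
    constructor
    · have h1 := hγ.continuousAt_angleChange hxy (x := γ t₀) fun t ht =>
        one_sub_inner_pos (hγ.mem_sphere _) (hγ.mem_sphere _) (h t ht)
      simpa using (h1.tendsto.comp hcr₁).sub (h1.tendsto.comp hcr₂)
    · have hK : IsCompact (γ '' Icc x y) := isCompact_Icc.image hγ.continuous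
      have h1 : (γ '' Icc x y)ᶜ ∈ 𝓝 (γ t₀) := hK.isClosed.isOpen_compl.mem_nhds (by
        rintro ⟨t, ht, e⟩
        exact h t ht e.symm)
      filter_upwards [h1] with z hz hz1 t ht
      refine (one_sub_inner_pos hz1 (hγ.mem_sphere _) ?_).ne'
      rintro rfl
      exact hz ⟨t, ht, rfl⟩
  obtain ⟨hl, hl'⟩ := houter hδa.le fun t ht e => by
    have := hne t ⟨ht.1, by linarith [ht.2]⟩ e.symm
    linarith [ht.2]
  obtain ⟨hr, hr'⟩ := houter hδb.le fun t ht e => by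
    have := hne t ⟨by linarith [ht.1], ht.2⟩ e.symm
    linarith [ht.1]
  have htot := (hl.add hmid).add hr
  rw [zero_add, add_zero] at htot
  refine htot.congr' ?_
  filter_upwards [self_mem_nhdsWithin, hcr₁.eventually (hl'.and hr'), hcr₂.eventually (hl'.and hr')]
    with η hη h₁ h₂
  have hsplit : ∀ z, (∀ t ∈ Icc a (t₀ - δ), 1 - inner ℝ z (γ t) ≠ 0) →
      (∀ t ∈ Icc (t₀ - δ) (t₀ + δ), 1 - inner ℝ z (γ t) ≠ 0) →
      (∀ t ∈ Icc (t₀ + δ) b, 1 - inner ℝ z (γ t) ≠ 0) → angleChange γ a b z =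
        angleChange γ a (t₀ - δ) z + angleChange γ (t₀ - δ) (t₀ + δ) z +
          angleChange γ (t₀ + δ) b z := by
    intro z h1 h2 h3
    rw [hγ.angleChange_add, hγ.angleChange_add]
    · rw [uIcc_of_le (by linarith)]
      intro t ht
      rcases le_total t (t₀ - δ) with h | h
      · exact h1 t ⟨ht.1, h⟩
      · exact h2 t ⟨h, ht.2⟩
    · rwa [uIcc_of_le hδb.le]
    · rwa [uIcc_of_le hδa.le]
    · rwa [uIcc_of_le hle]
  obtain ⟨e1, e1'⟩ := angleChange_crossing hc hγ (η := η) hle hD fun t ht => (hslit η hη t ht).1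
  obtain ⟨e2, e2'⟩ := angleChange_crossing hc hγ (η := -η) hle hD fun t ht => (hslit η hη t ht).2
  rw [hsplit _ (h₁.1 (norm_crossing hc hγ _ _)) e1' (h₁.2 (norm_crossing hc hγ _ _)),
    hsplit _ (h₂.1 (norm_crossing hc hγ _ _)) e2' (h₂.2 (norm_crossing hc hγ _ _)), e1, e2]
  have e3 : ∀ t, (((-η : ℝ) : ℂ) * α' t + Complex.I * β' t) /
      (((-η : ℝ) : ℂ) * α t + Complex.I * β t) =
      (η * α' t + Complex.I * -β' t) / (η * α t + Complex.I * -β t) := by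
    intro t
    rw [← neg_div_neg_eq]
    congr 1 <;> push_cast <;> ring
  simp only [← hDdef, ← hαdef, ← hβdef] at *
  have e4 : (∫ t in (t₀ - δ)..(t₀ + δ), (((-η : ℝ) : ℂ) * α' t + Complex.I * β' t) /
      (((-η : ℝ) : ℂ) * α t + Complex.I * β t)) = ∫ t in (t₀ - δ)..(t₀ + δ),
      (η * α' t + Complex.I * -β' t) / (η * α t + Complex.I * -β t) :=
    intervalIntegral.integral_congr fun t _ => e3 t
  change _ = _ + (∫ t in (t₀ - δ)..(t₀ + δ),
      (η * α' t + Complex.I * β' t) / (η * α t + Complex.I * β t)).im + _ - (_ +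
      (∫ t in (t₀ - δ)..(t₀ + δ), (((-η : ℝ) : ℂ) * α' t + Complex.I * β' t) /
      (((-η : ℝ) : ℂ) * α t + Complex.I * β t)).im + _)
  rw [e4]
  ring

/-! ### The two sides of a curve -/

/-- The sphere without the curve `γ`. -/
def offCurve (γ : ℝ → E3) : Set E3 := Metric.sphere (0 : E3) 1 \ range γ

theorem contDiff_cross {f g : ℝ → E3} {n : WithTop ℕ∞} (hf : ContDiff ℝ n f)
    (hg : ContDiff ℝ n g) : ContDiff ℝ n fun t => cross (f t) (g t) := by
  rw [contDiff_euclidean] at hf hg ⊢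
  intro i
  have h : ∀ j k, ContDiff ℝ n fun t => f t j * g t k := fun j k => (hf j).mul (hg k)
  fin_cases i
  · simpa only [Fin.zero_eta, cross_zero] using (h 1 2).sub (h 2 1)
  · simpa only [Fin.mk_one, cross_one] using (h 2 0).sub (h 0 2)
  · simpa only [Fin.reduceFinMk, cross_two] using (h 0 1).sub (h 1 0)

/-- Coordinates near a curve: `t` along the curve, `ε` along its normal and the radius `r`. -/
def tube (γ : ℝ → E3) (z : ℝ × ℝ × ℝ) : E3 :=
  z.2.2 • (γ z.1 + z.2.1 • cross (γ z.1) (deriv γ z.1))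

theorem IsLoop.contDiff_tube (hγ : IsLoop γ T) : ContDiff ℝ 1 (tube γ) := by
  have h1 : ContDiff ℝ 1 γ := hγ.smooth.of_le (by simp)
  have h2 : ContDiff ℝ 1 (deriv γ) := hγ.contDiff_deriv.of_le (by simp)
  have h3 := contDiff_cross h1 h2
  have e1 : ContDiff ℝ 1 fun z : ℝ × ℝ × ℝ => γ z.1 := h1.comp contDiff_fst
  have e3 : ContDiff ℝ 1 fun z : ℝ × ℝ × ℝ => cross (γ z.1) (deriv γ z.1) := h3.comp contDiff_fst
  have e4 : ContDiff ℝ 1 fun z : ℝ × ℝ × ℝ => z.2.1 := contDiff_fst.comp contDiff_snd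
  have e5 : ContDiff ℝ 1 fun z : ℝ × ℝ × ℝ => z.2.2 := contDiff_snd.comp contDiff_snd
  exact e5.smul (e1.add (e4.smul e3))

/-- The linear map with the values `v`, `n`, `x` at the standard basis vectors. -/
def frame (v n x : E3) : ℝ × ℝ × ℝ →L[ℝ] E3 :=
  (ContinuousLinearMap.fst ℝ ℝ (ℝ × ℝ)).smulRight v +
    (((ContinuousLinearMap.fst ℝ ℝ ℝ).comp (ContinuousLinearMap.snd ℝ ℝ (ℝ × ℝ))).smulRight n +
      ((ContinuousLinearMap.snd ℝ ℝ ℝ).comp (ContinuousLinearMap.snd ℝ ℝ (ℝ × ℝ))).smulRight x)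

theorem frame_apply (v n x : E3) (z : ℝ × ℝ × ℝ) :
    frame v n x z = z.1 • v + (z.2.1 • n + z.2.2 • x) := rfl

theorem IsLoop.hasFDerivAt_tube (hγ : IsLoop γ T) (t : ℝ) :
    HasFDerivAt (tube γ) (frame (deriv γ t) (cross (γ t) (deriv γ t)) (γ t)) (t, 0, 1) := by
  have h := (hγ.contDiff_tube.differentiable one_ne_zero (t, 0, 1)).hasFDerivAt
  have key : ∀ w : ℝ × ℝ × ℝ, ∀ e : E3, (HasDerivAt (fun s : ℝ => tube γ ((t, 0, 1) + s • w)) e 0) →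
      fderiv ℝ (tube γ) (t, 0, 1) w = e := by
    intro w e he
    have h1 : HasDerivAt (fun s : ℝ => ((t, 0, 1) : ℝ × ℝ × ℝ) + s • w) w 0 := by
      simpa using ((hasDerivAt_id (0 : ℝ)).smul_const w).const_add ((t, 0, 1) : ℝ × ℝ × ℝ)
    have h2 : HasFDerivAt (tube γ) (fderiv ℝ (tube γ) (t, 0, 1))
        (((t, 0, 1) : ℝ × ℝ × ℝ) + (0 : ℝ) • w) := by simpa using h
    have h3 := HasFDerivAt.comp_hasDerivAt (0 : ℝ) h2 h1
    exact h3.unique he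
  have k1 := key (1, 0, 0) (deriv γ t) (by
    have : HasDerivAt (fun s : ℝ => γ (t + s)) (deriv γ t) 0 := by
      have h0 := (hγ.differentiable (t + 0)).hasDerivAt.comp_const_add t 0
      simpa using h0
    refine this.congr_of_eventuallyEq (Eventually.of_forall fun s => ?_)
    simp [tube])
  have k2 := key (0, 1, 0) (cross (γ t) (deriv γ t)) (by
    have := ((hasDerivAt_id (0 : ℝ)).smul_const (cross (γ t) (deriv γ t))).const_add (γ t)
    rw [one_smul] at this
    refine this.congr_of_eventuallyEq (Eventually.of_forall fun s => ?_)
    simp [tube])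
  have k3 := key (0, 0, 1) (γ t) (by
    have := ((hasDerivAt_id (0 : ℝ)).const_add 1).smul_const (γ t)
    rw [one_smul] at this
    refine this.congr_of_eventuallyEq (Eventually.of_forall fun s => ?_)
    simp [tube])
  refine h.congr_fderiv (ContinuousLinearMap.ext fun z => ?_)
  have hz : z = z.1 • ((1, 0, 0) : ℝ × ℝ × ℝ) + (z.2.1 • ((0, 1, 0) : ℝ × ℝ × ℝ) +
      z.2.2 • ((0, 0, 1) : ℝ × ℝ × ℝ)) := by
    ext <;> simp
  rw [frame_apply]
  conv_lhs => rw [hz]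
  simp only [map_add, map_smul, k1, k2, k3]

theorem IsLoop.inner_normal_frame (hγ : IsLoop γ T) (t : ℝ) (z : ℝ × ℝ × ℝ) :
    inner ℝ (cross (γ t) (deriv γ t))
      (frame (deriv γ t) (cross (γ t) (deriv γ t)) (γ t) z) = 2 * z.2.1 := by
  rw [frame_apply, inner_add_right, inner_add_right, inner_smul_right, inner_smul_right,
    inner_smul_right, real_inner_self_eq_norm_sq, hγ.norm_normal_sq,
    real_inner_comm, inner_cross_right, real_inner_comm (γ t), inner_cross_self]
  ring

/-- The velocity, the normal and the position vector are orthogonal and do not vanish. -/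
theorem IsLoop.frame_injective (hγ : IsLoop γ T) (t : ℝ) :
    Function.Injective (frame (deriv γ t) (cross (γ t) (deriv γ t)) (γ t)) := by
  rw [injective_iff_map_eq_zero]
  intro z hz
  have h2 := hγ.inner_normal_frame t z
  rw [hz, inner_zero_right] at h2
  have h2' : z.2.1 = 0 := by linarith
  rw [frame_apply, h2', zero_smul, zero_add] at hz
  have h3 := congrArg (inner ℝ (γ t)) hz
  rw [inner_add_right, inner_smul_right, inner_smul_right, hγ.inner_deriv,
    real_inner_self_eq_norm_sq, hγ.mem_sphere, inner_zero_right] at h3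
  have h3' : z.2.2 = 0 := by linarith
  rw [h3', zero_smul, add_zero] at hz
  have h4 := congrArg (inner ℝ (deriv γ t)) hz
  rw [inner_smul_right, real_inner_self_eq_norm_sq, hγ.speed, inner_zero_right,
    sq_sqrt zero_le_two] at h4
  have h4' : z.1 = 0 := by linarith
  ext <;> simp [h2', h3', h4']

/-- The derivative of `tube` on the curve, as an isomorphism. -/
def frameEquiv (hγ : IsLoop γ T) (t : ℝ) : (ℝ × ℝ × ℝ) ≃L[ℝ] E3 :=
  (LinearMap.linearEquivOfInjective
    (frame (deriv γ t) (cross (γ t) (deriv γ t)) (γ t)).toLinearMap (hγ.frame_injective t)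
    (by simp)).toContinuousLinearEquiv

theorem coe_frameEquiv (hγ : IsLoop γ T) (t : ℝ) :
    ((frameEquiv hγ t : (ℝ × ℝ × ℝ) ≃L[ℝ] E3) : ℝ × ℝ × ℝ →L[ℝ] E3) =
      frame (deriv γ t) (cross (γ t) (deriv γ t)) (γ t) :=
  ContinuousLinearMap.ext fun _ => rfl

theorem IsLoop.hasStrictFDerivAt_tube (hγ : IsLoop γ T) (t : ℝ) :
    HasStrictFDerivAt (tube γ) ((frameEquiv hγ t : (ℝ × ℝ × ℝ) ≃L[ℝ] E3) : ℝ × ℝ × ℝ →L[ℝ] E3)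
      (t, 0, 1) :=
  hγ.contDiff_tube.contDiffAt.hasStrictFDerivAt'
    (by rw [coe_frameEquiv]; exact hγ.hasFDerivAt_tube t) one_ne_zero

/-- `P` and `Q` are a left and a right side of `γ` near `γ t₀`, inside `N`: connected sets off the
curve which contain the points near `γ t₀` that lie to the left and to the right of the curve. -/
structure IsSides (γ : ℝ → E3) (t₀ : ℝ) (N P Q : Set E3) : Prop where
  isPreconnected_left : IsPreconnected P
  isPreconnected_right : IsPreconnected Q
  left_subset : P ⊆ N ∩ offCurve γ
  right_subset : Q ⊆ N ∩ offCurve γ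
  cover : ∀ᶠ x in 𝓝 (γ t₀), x ∈ offCurve γ → x ∈ P ∪ Q
  displaced_mem : ∀ᶠ z : ℝ × ℝ in 𝓝 (t₀, 0),
    (0 < z.2 → displaced γ z.1 z.2 ∈ P) ∧ (z.2 < 0 → displaced γ z.1 z.2 ∈ Q)
  crossing_mem : ∀ (y : ℝ → E3) (v : E3), (∀ s, ‖y s‖ = 1) → y 0 = γ t₀ → HasDerivAt y v 0 →
    0 < inner ℝ (cross (γ t₀) (deriv γ t₀)) v →
      (∀ᶠ s in 𝓝[>] (0 : ℝ), y s ∈ P) ∧ ∀ᶠ s in 𝓝[<] (0 : ℝ), y s ∈ Q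

theorem IsLoop.norm_add_normal_pos (hγ : IsLoop γ T) (t ε : ℝ) :
    0 < ‖γ t + ε • cross (γ t) (deriv γ t)‖ := by
  have h : ‖γ t + ε • cross (γ t) (deriv γ t)‖ ^ 2 = 1 + ε ^ 2 * 2 := by
    rw [norm_add_sq_real, inner_smul_right, inner_cross_self, hγ.mem_sphere, norm_smul, mul_pow,
      hγ.norm_normal_sq, Real.norm_eq_abs, sq_abs]
    ring
  refine lt_of_le_of_ne (norm_nonneg _) fun h0 => ?_
  rw [← h0] at h
  nlinarith [sq_nonneg ε]

theorem IsLoop.norm_displaced (hγ : IsLoop γ T) (t ε : ℝ) : ‖displaced γ t ε‖ = 1 := by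
  rw [displaced, norm_smul, norm_inv, norm_norm]
  exact inv_mul_cancel₀ (hγ.norm_add_normal_pos t ε).ne'

theorem IsLoop.displaced_zero (hγ : IsLoop γ T) (t : ℝ) : displaced γ t 0 = γ t := by
  simp [displaced, hγ.mem_sphere]

/-- The two sides are the images of two half boxes under `displaced`. The coordinates `tube` are a
local diffeomorphism by the inverse function theorem, which shows that the half boxes avoid the part
of the curve near `γ t₀`; the rest of the curve is compact and stays away from `γ t₀`. -/
theorem IsLoop.exists_sides (hγ : IsLoop γ T) (t₀ : ℝ) {N : Set E3} (hN : N ∈ 𝓝 (γ t₀)) :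
    ∃ P Q, IsSides γ t₀ N P Q := by
  set Φ := (hγ.hasStrictFDerivAt_tube t₀).toOpenPartialHomeomorph (tube γ) with hΦ
  have hΦc : ∀ z, Φ z = tube γ z := fun _ => rfl
  have hsrc : ((t₀, 0, 1) : ℝ × ℝ × ℝ) ∈ Φ.source :=
    (hγ.hasStrictFDerivAt_tube t₀).mem_toOpenPartialHomeomorph_source
  have htube : tube γ (t₀, 0, 1) = γ t₀ := by simp [tube]
  have hT := hγ.pos
  have hn := continuous_cross hγ.continuous hγ.continuous_deriv
  obtain ⟨ρ₁, hρ₁, hball⟩ := Metric.isOpen_iff.1 Φ.open_source _ hsrc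
  -- the part of the curve away from `t₀`
  set K := γ '' Icc (t₀ + ρ₁ / 2) (t₀ - ρ₁ / 2 + T) with hK
  have hKc : Kᶜ ∈ 𝓝 (γ t₀) := by
    refine (isCompact_Icc.image hγ.continuous).isClosed.isOpen_compl.mem_nhds ?_
    rintro ⟨t, ht, e⟩
    have := hγ.eq_of_abs_sub_lt e.symm (abs_lt.2 ⟨by linarith [ht.1], by linarith [ht.2]⟩)
    linarith [ht.1]
  -- the lift of the surface `displaced` to the coordinates
  set E : ℝ × ℝ → ℝ × ℝ × ℝ :=
    fun z => (z.1, z.2, ‖γ z.1 + z.2 • cross (γ z.1) (deriv γ z.1)‖⁻¹) with hE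
  have hEc : Continuous E := by
    refine continuous_fst.prodMk (continuous_snd.prodMk (Continuous.inv₀ ?_ fun z =>
      (hγ.norm_add_normal_pos z.1 z.2).ne'))
    exact ((hγ.continuous.comp continuous_fst).add
      (continuous_snd.smul (hn.comp continuous_fst))).norm
  have hE0 : E (t₀, 0) = (t₀, 0, 1) := by simp [hE, hγ.mem_sphere]
  have hdE : ∀ z : ℝ × ℝ, displaced γ z.1 z.2 = tube γ (E z) := fun z => rfl
  have hdc : Continuous fun z : ℝ × ℝ => displaced γ z.1 z.2 := by
    simp only [hdE]
    exact hγ.contDiff_tube.continuous.comp hEc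
  have hgood : ∀ᶠ z : ℝ × ℝ in 𝓝 (t₀, 0),
      E z ∈ Φ.source ∧ displaced γ z.1 z.2 ∈ Kᶜ ∩ N := by
    refine (hEc.tendsto (t₀, 0)).eventually ?_ |>.and ?_
    · rw [hE0]
      exact Φ.open_source.mem_nhds hsrc
    · have := hdc.tendsto (t₀, 0)
      simp only [hγ.displaced_zero] at this
      exact this (inter_mem hKc hN)
  obtain ⟨ρ, hρ, hgood⟩ := Metric.eventually_nhds_iff_ball.1 hgood
  have hbox : ∀ t ε : ℝ, |t - t₀| < ρ → |ε| < ρ → (t, ε) ∈ Metric.ball ((t₀, 0) : ℝ × ℝ) ρ := by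
    intro t ε h1 h2
    rw [Metric.mem_ball, Prod.dist_eq, max_lt_iff, Real.dist_eq, Real.dist_eq, sub_zero]
    exact ⟨h1, h2⟩
  have hoff : ∀ t ε : ℝ, |t - t₀| < ρ → |ε| < ρ → ε ≠ 0 →
      displaced γ t ε ∈ N ∩ offCurve γ := by
    intro t ε h1 h2 h3
    obtain ⟨g1, g2, g3⟩ := hgood _ (hbox t ε h1 h2)
    refine ⟨g3, by simp [hγ.norm_displaced], ?_⟩
    rintro ⟨t', ht'⟩
    obtain ⟨t'', ⟨h5, h6⟩, h7⟩ :=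
      Function.Periodic.exists_mem_Ico hγ.periodic hT t' (t₀ - ρ₁ / 2)
    rw [h7] at ht'
    have h8 : t'' < t₀ + ρ₁ / 2 := by
      by_contra! hcon
      exact g2 ⟨t'', ⟨hcon, h6.le⟩, ht'⟩
    have h9 : ((t'', 0, 1) : ℝ × ℝ × ℝ) ∈ Φ.source := by
      apply hball
      rw [Metric.mem_ball, Prod.dist_eq, dist_self, max_eq_left dist_nonneg, Real.dist_eq, abs_lt]
      constructor <;> linarith
    have h10 := Φ.injOn g1 h9 (by
      rw [hΦc, hΦc, ← hdE (t, ε), ← ht']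
      simp [tube])
    exact h3 (congrArg (fun z : ℝ × ℝ × ℝ => z.2.1) h10)
  have htgt : γ t₀ ∈ Φ.target := by
    rw [← htube]
    exact Φ.map_source hsrc
  have hsymm0 : Φ.symm (γ t₀) = (t₀, 0, 1) := by
    conv_lhs => rw [← htube]
    exact Φ.left_inv hsrc
  have hsymm : Tendsto Φ.symm (𝓝 (γ t₀)) (𝓝 (t₀, 0, 1)) := by
    rw [← hsymm0]
    exact Φ.continuousAt_symm htgt
  have hU : ∀ᶠ x in 𝓝 (γ t₀), x ∈ Φ.target ∧ |(Φ.symm x).1 - t₀| < ρ ∧ |(Φ.symm x).2.1| < ρ ∧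
      0 < (Φ.symm x).2.2 := by
    refine Filter.Eventually.and (p := fun x => x ∈ Φ.target) (Φ.open_target.mem_nhds htgt)
      (hsymm.eventually (p := fun z => |z.1 - t₀| < ρ ∧ |z.2.1| < ρ ∧ 0 < z.2.2) ?_)
    have o1 : IsOpen ({z : ℝ × ℝ × ℝ | |z.1 - t₀| < ρ} ∩
        ({z : ℝ × ℝ × ℝ | |z.2.1| < ρ} ∩ {z : ℝ × ℝ × ℝ | 0 < z.2.2})) :=
      (isOpen_lt (by fun_prop) (by fun_prop)).inter
        ((isOpen_lt (by fun_prop) (by fun_prop)).inter (isOpen_lt (by fun_prop) (by fun_prop)))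
    exact o1.mem_nhds ⟨by simpa using hρ, by simpa using hρ, by simp⟩
  have hrep : ∀ x, x ∈ Φ.target → ‖x‖ = 1 → 0 < (Φ.symm x).2.2 →
      x = displaced γ (Φ.symm x).1 (Φ.symm x).2.1 := by
    intro x hx h1 hr
    have h2 : tube γ (Φ.symm x) = x := Φ.right_inv hx
    have h3 := h1
    rw [← h2, tube, norm_smul, Real.norm_eq_abs, abs_of_pos hr] at h3
    rw [displaced, ← eq_inv_of_mul_eq_one_left h3]
    exact h2.symm
  set P := (fun z : ℝ × ℝ => displaced γ z.1 z.2) '' (Ioo (t₀ - ρ) (t₀ + ρ) ×ˢ Ioo 0 ρ) with hP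
  set Q := (fun z : ℝ × ℝ => displaced γ z.1 z.2) '' (Ioo (t₀ - ρ) (t₀ + ρ) ×ˢ Ioo (-ρ) 0) with hQ
  have hmemP : ∀ t ε : ℝ, |t - t₀| < ρ → |ε| < ρ → 0 < ε → displaced γ t ε ∈ P := by
    intro t ε h1 h2 h3
    rw [abs_lt] at h1 h2
    exact ⟨(t, ε), ⟨⟨by linarith [h1.1], by linarith [h1.2]⟩, h3, h2.2⟩, rfl⟩
  have hmemQ : ∀ t ε : ℝ, |t - t₀| < ρ → |ε| < ρ → ε < 0 → displaced γ t ε ∈ Q := by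
    intro t ε h1 h2 h3
    rw [abs_lt] at h1 h2
    exact ⟨(t, ε), ⟨⟨by linarith [h1.1], by linarith [h1.2]⟩, h2.1, h3⟩, rfl⟩
  refine ⟨P, Q, ?_, ?_, ?_, ?_, ?_, ?_, ?_⟩
  · exact (isPreconnected_Ioo.prod isPreconnected_Ioo).image _ hdc.continuousOn
  · exact (isPreconnected_Ioo.prod isPreconnected_Ioo).image _ hdc.continuousOn
  · rintro _ ⟨⟨t, ε⟩, ⟨h1, h2⟩, rfl⟩
    simp only [mem_Ioo] at h1 h2
    exact hoff t ε (abs_lt.2 ⟨by linarith, by linarith⟩) (abs_lt.2 ⟨by linarith, h2.2⟩) h2.1.ne'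
  · rintro _ ⟨⟨t, ε⟩, ⟨h1, h2⟩, rfl⟩
    simp only [mem_Ioo] at h1 h2
    exact hoff t ε (abs_lt.2 ⟨by linarith, by linarith⟩) (abs_lt.2 ⟨h2.1, by linarith⟩) h2.2.ne
  · filter_upwards [hU] with x hx hx'
    have h1 := hrep x hx.1 (by simpa using hx'.1) hx.2.2.2
    rcases lt_trichotomy (Φ.symm x).2.1 0 with h | h | h
    · right
      rw [h1]
      exact hmemQ _ _ hx.2.1 hx.2.2.1 h
    · rw [h, hγ.displaced_zero] at h1
      exact absurd ⟨_, h1.symm⟩ hx'.2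
    · left
      rw [h1]
      exact hmemP _ _ hx.2.1 hx.2.2.1 h
  · filter_upwards [Metric.ball_mem_nhds ((t₀, 0) : ℝ × ℝ) hρ] with z hz
    rw [Metric.mem_ball, Prod.dist_eq, max_lt_iff, Real.dist_eq, Real.dist_eq, sub_zero] at hz
    exact ⟨hmemP _ _ hz.1 hz.2, hmemQ _ _ hz.1 hz.2⟩
  · intro y v hy1 hy0 hy hv
    have hfd : HasFDerivAt Φ.symm ((frameEquiv hγ t₀).symm : E3 →L[ℝ] ℝ × ℝ × ℝ) (y 0) := by
      rw [hy0]
      refine Φ.hasFDerivAt_symm htgt ?_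
      rw [hsymm0]
      exact (hγ.hasStrictFDerivAt_tube t₀).hasFDerivAt
    have h1 : HasDerivAt (fun s => Φ.symm (y s)) ((frameEquiv hγ t₀).symm v) 0 :=
      hfd.comp_hasDerivAt (0 : ℝ) hy
    set l := (ContinuousLinearMap.fst ℝ ℝ ℝ).comp (ContinuousLinearMap.snd ℝ ℝ (ℝ × ℝ)) with hl
    have h2 : HasDerivAt (fun s => l (Φ.symm (y s))) (l ((frameEquiv hγ t₀).symm v)) 0 :=
      l.hasFDerivAt.comp_hasDerivAt (0 : ℝ) h1
    have h3 : 0 < ((frameEquiv hγ t₀).symm v).2.1 := by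
      have := hγ.inner_normal_frame t₀ ((frameEquiv hγ t₀).symm v)
      rw [← coe_frameEquiv hγ] at this
      rw [ContinuousLinearEquiv.coe_coe, ContinuousLinearEquiv.apply_symm_apply] at this
      linarith
    have h4 := eventually_nhdsWithin_sign_eq_of_deriv_pos (f := fun s => l (Φ.symm (y s)))
      (x₀ := 0) (by rw [h2.deriv]; exact h3) (by simp [hl, hy0, hsymm0])
    have h5 : Tendsto y (𝓝 0) (𝓝 (γ t₀)) := by
      rw [← hy0]
      exact hy.continuousAt
    have h6 := h5.eventually hU
    constructor
    · filter_upwards [nhdsWithin_le_nhds h4, nhdsWithin_le_nhds h6, self_mem_nhdsWithin]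
        with s hs hs' hs0
      rw [hrep _ hs'.1 (hy1 s) hs'.2.2.2]
      refine hmemP _ _ hs'.2.1 hs'.2.2.1 ?_
      rw [sub_zero, sign_pos (a := s) hs0] at hs
      exact sign_eq_one_iff.1 hs
    · filter_upwards [nhdsWithin_le_nhds h4, nhdsWithin_le_nhds h6, self_mem_nhdsWithin]
        with s hs hs' hs0
      rw [hrep _ hs'.1 (hy1 s) hs'.2.2.2]
      refine hmemQ _ _ hs'.2.1 hs'.2.2.1 ?_
      rw [sub_zero, _root_.sign_neg (a := s) hs0] at hs
      exact sign_eq_neg_one_iff.1 hs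

/-! ### Functions which are locally constant -/

/-- A function whose exponential `exp (i f)` is constant on a connected set is constant there. -/
theorem eq_of_exp_eq {X : Type*} [TopologicalSpace X] {f : X → ℝ} {P : Set X}
    (hP : IsPreconnected P) (hf : ContinuousOn f P) {w : ℂ}
    (h : ∀ x ∈ P, Complex.exp (Complex.I * f x) = w) {x y : X} (hx : x ∈ P) (hy : y ∈ P) :
    f x = f y := by
  wlog hlt : f x < f y generalizing x y
  · rcases lt_trichotomy (f x) (f y) with h1 | h1 | h1
    · exact absurd h1 hlt
    · exact h1
    · exact (this hy hx h1).symm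
  exfalso
  -- an intermediate value at distance less than `2 π` from `f x`
  obtain ⟨z, hz, hfz⟩ := hP.intermediate_value hx hy hf
    (show min (f y) (f x + 1) ∈ Icc (f x) (f y) from
      ⟨le_min hlt.le (by linarith), min_le_left _ _⟩)
  have h1 : 0 < f z - f x := by
    rw [hfz, sub_pos]
    exact lt_min hlt (by linarith)
  have h2 : f z - f x ≤ 1 := by
    rw [hfz]
    linarith [min_le_right (f y) (f x + 1)]
  have h3 : Complex.exp (Complex.I * f z) = Complex.exp (Complex.I * f x) := by
    rw [h z hz, h x hx]
  obtain ⟨m, hm⟩ := Complex.exp_eq_exp_iff_exists_int.1 h3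
  have h4 : f z = f x + m * (2 * π) := by
    have h5 : Complex.I * (f z : ℂ) = Complex.I * ((f x + m * (2 * π) : ℝ) : ℂ) := by
      rw [hm]
      push_cast
      ring
    exact_mod_cast mul_left_cancel₀ Complex.I_ne_zero h5
  have h6 : f z - f x = m * (2 * π) := by linarith
  have hpi := pi_gt_three
  have h7 : (0 : ℝ) < m := by
    by_contra! hcon
    nlinarith
  have h8 : (1 : ℝ) ≤ m := by exact_mod_cast h7
  nlinarith

/-- A function on a dense part `D` of a connected set `Ω` which is constant near every point of
`Ω` is constant. -/
theorem eq_of_locally_const {X Y : Type*} [TopologicalSpace X] {Ω D : Set X}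
    (hΩ : IsPreconnected Ω) (hcl : Ω ⊆ closure D) {f : X → Y}
    (hf : ∀ x ∈ Ω, ∃ z, ∀ᶠ y in 𝓝[D] x, f y = z) {x y : X} (hx : x ∈ D ∩ Ω) (hy : y ∈ D ∩ Ω) :
    f x = f y := by
  have : Nonempty Y := ⟨f x⟩
  choose! g hg using hf
  have hD : ∀ x ∈ D ∩ Ω, f x = g x := fun x hx => (hg x hx.2).self_of_nhdsWithin hx.1
  have hloc : IsLocallyConstant (fun a : Ω => g a) := by
    rw [IsLocallyConstant.iff_eventually_eq]
    intro a
    have h1 := eventually_nhdsWithin_iff.1 (hg a a.2)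
    have h2 := (continuous_subtype_val.tendsto a).eventually (eventually_eventually_nhds.2 h1)
    filter_upwards [h2] with b hb
    have hne : (𝓝[D] (b : X)).NeBot := mem_closure_iff_nhdsWithin_neBot.1 (hcl b.2)
    obtain ⟨z, h3, h4⟩ := ((hg b b.2).and (eventually_nhdsWithin_iff.2 hb)).exists
    exact h3.symm.trans h4
  have : PreconnectedSpace Ω := isPreconnected_iff_preconnectedSpace.1 hΩ
  rw [hD x hx, hD y hy]
  exact hloc.apply_eq_of_preconnectedSpace (⟨x, hx.2⟩ : Ω) ⟨y, hy.2⟩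

/-! ### The two regions of a loop -/

theorem IsLoop.isClosed_range (hγ : IsLoop γ T) : IsClosed (range γ) := by
  rw [← Function.Periodic.image_Icc hγ.periodic hγ.pos 0]
  exact (isCompact_Icc.image hγ.continuous).isClosed

theorem one_sub_inner_pos_of_offCurve (hγ : IsLoop γ T) {x : E3} (hx : x ∈ offCurve γ) (t : ℝ) :
    0 < 1 - inner ℝ x (γ t) :=
  one_sub_inner_pos (by simpa using hx.1) (hγ.mem_sphere t) fun e => hx.2 ⟨t, e.symm⟩

theorem IsLoop.continuousOn_angleChange (hγ : IsLoop γ T) {a b : ℝ} (hab : a ≤ b) :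
    ContinuousOn (angleChange γ a b) (offCurve γ) := fun _ hx =>
  (hγ.continuousAt_angleChange hab fun t _ =>
    one_sub_inner_pos_of_offCurve hγ hx t).continuousWithinAt

/-- Over a full period the change of argument is, modulo `2 π`, the argument of the holonomy. -/
theorem IsLoop.exp_angleChange_period (hγ : IsLoop γ T) (hc : IsParallelLift c γ) (a : ℝ) {x : E3}
    (hx : x ∈ offCurve γ) :
    Complex.exp (Complex.I * angleChange γ a (a + T) x) = holonomy c T := by
  obtain ⟨q, hq, rfl⟩ := exists_hopf_eq (x := x) (by simpa using hx.1)
  have hne : ∀ t, wedge q (c t) ≠ 0 := fun t => by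
    rw [wedge_ne_zero_iff hq (hc.norm_eq t), hc.lies_over]
    exact (one_sub_inner_pos_of_offCurve hγ hx t).ne'
  have h := exp_angleChange hc hγ hq (show a ≤ a + T by linarith [hγ.pos]) fun t _ => hne t
  rw [hc.add_period hγ.periodic, wedge_smul_right, norm_mul, hc.norm_holonomy hγ.periodic,
    one_mul] at h
  have h1 : ((‖wedge q (c a)‖ : ℝ) : ℂ) ≠ 0 := by simpa using hne a
  exact (mul_right_cancel₀ (hne a) (mul_right_cancel₀ h1 h)).symm

theorem IsLoop.deriv_periodic (hγ : IsLoop γ T) (t : ℝ) : deriv γ (t + T) = deriv γ t := by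
  rw [← deriv_comp_add_const, show (fun t => γ (t + T)) = γ from funext hγ.periodic]

theorem IsLoop.angleChange_period (hγ : IsLoop γ T) (a b : ℝ) (x : E3) :
    angleChange γ a (a + T) x = angleChange γ b (b + T) x := by
  have hper : Function.Periodic (angleRate γ x) T := fun t => by
    rw [angleRate, angleRate, hγ.periodic, hγ.deriv_periodic]
  rw [angleChange, angleChange, hper.intervalIntegral_add_eq]

namespace IsSides

variable {t₀ : ℝ} {N P Q : Set E3}

theorem eventually_crossing (h : IsSides γ t₀ N P Q) (hγ : IsLoop γ T) (hc : IsParallelLift c γ) :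
    ∀ᶠ η in 𝓝[>] (0 : ℝ), crossing γ t₀ η ∈ P ∧ crossing γ t₀ (-η) ∈ Q := by
  obtain ⟨h1, h2⟩ := h.crossing_mem (crossing γ t₀) _ (norm_crossing hc hγ t₀)
    (crossing_zero γ t₀) (hasDerivAt_crossing γ t₀)
    (by rw [real_inner_self_eq_norm_sq, hγ.norm_normal_sq]; norm_num)
  have h3 : Tendsto (fun η : ℝ => -η) (𝓝[>] 0) (𝓝[<] 0) := by
    simpa using tendsto_neg_nhdsGT (a := (0 : ℝ))
  exact h1.and (h3.eventually h2)

/-- A function which is constant on both sides of a curve takes values differing by its jump. -/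
theorem sub_eq_of_tendsto (h : IsSides γ t₀ N P Q) (hγ : IsLoop γ T) (hc : IsParallelLift c γ)
    {f : E3 → ℝ} (hP : ∀ x ∈ P, ∀ y ∈ P, f x = f y) (hQ : ∀ x ∈ Q, ∀ y ∈ Q, f x = f y) {l : ℝ}
    (hl : Tendsto (fun η => f (crossing γ t₀ η) - f (crossing γ t₀ (-η))) (𝓝[>] 0) (𝓝 l))
    {x y : E3} (hx : x ∈ P) (hy : y ∈ Q) : f x - f y = l := by
  refine tendsto_nhds_unique (tendsto_const_nhds.congr' ?_) hl
  filter_upwards [h.eventually_crossing hγ hc] with η hη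
  rw [hP x hx _ hη.1, hQ y hy _ hη.2]

end IsSides

/-- The values of the change of argument on the two sides of the curve do not depend on the point
of the curve. -/
theorem IsLoop.exists_level (hγ : IsLoop γ T) (hc : IsParallelLift c γ) :
    ∃ m, ∀ t₀ N P Q, IsSides γ t₀ N P Q →
      (∀ x ∈ P, angleChange γ 0 (0 + T) x = m + 2 * π) ∧
        ∀ x ∈ Q, angleChange γ 0 (0 + T) x = m := by
  set w := angleChange γ 0 (0 + T) with hw
  have hT := hγ.pos
  have hconst : ∀ P, IsPreconnected P → P ⊆ offCurve γ → ∀ x ∈ P, ∀ y ∈ P, w x = w y :=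
    fun P hP hPγ x hx y hy => eq_of_exp_eq hP
      ((hγ.continuousOn_angleChange (by linarith)).mono hPγ)
      (fun z hz => hγ.exp_angleChange_period hc 0 (hPγ hz)) hx hy
  have hjump : ∀ t₀ N P Q, IsSides γ t₀ N P Q → ∀ x ∈ P, ∀ y ∈ Q, w x - w y = 2 * π := by
    intro t₀ N P Q h x hx y hy
    refine h.sub_eq_of_tendsto hγ hc (hconst P h.isPreconnected_left fun z hz =>
      (h.left_subset hz).2) (hconst Q h.isPreconnected_right fun z hz =>
      (h.right_subset hz).2) ?_ hx hy
    have h1 := tendsto_jump hc hγ (a := t₀ - T / 2) (b := t₀ - T / 2 + T) (t₀ := t₀)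
      (by linarith) (by linarith) fun t ht e =>
        hγ.eq_of_abs_sub_lt e.symm (abs_lt.2 ⟨by linarith [ht.1], by linarith [ht.2]⟩)
    simpa only [hw, hγ.angleChange_period (t₀ - T / 2) 0] using h1
  have hval : ∀ t₀, ∃ v, ∀ N P Q, IsSides γ t₀ N P Q → ∀ x ∈ P, w x = v := by
    intro t₀
    obtain ⟨P, Q, h⟩ := hγ.exists_sides t₀ univ_mem
    obtain ⟨η, hη⟩ := (h.eventually_crossing hγ hc).exists
    refine ⟨w (crossing γ t₀ η), fun N' P' Q' h' x hx => ?_⟩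
    obtain ⟨η', hη'⟩ := ((h.eventually_crossing hγ hc).and (h'.eventually_crossing hγ hc)).exists
    rw [hconst P' h'.isPreconnected_left (fun z hz => (h'.left_subset hz).2) x hx _ hη'.2.1]
    exact hconst P h.isPreconnected_left (fun z hz => (h.left_subset hz).2) _ hη'.1.1 _ hη.1
  choose v hv using hval
  have hloc : IsLocallyConstant v := by
    rw [IsLocallyConstant.iff_eventually_eq]
    intro t₀
    obtain ⟨P, Q, h⟩ := hγ.exists_sides t₀ univ_mem
    have h1 := h.displaced_mem
    rw [nhds_prod_eq] at h1
    filter_upwards [h1.curry] with t ht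
    obtain ⟨P', Q', h'⟩ := hγ.exists_sides t univ_mem
    have h2 : ∀ᶠ ε in 𝓝 (0 : ℝ), (0 < ε → displaced γ t ε ∈ P') := by
      have h3 := h'.displaced_mem
      rw [nhds_prod_eq] at h3
      exact h3.curry.self_of_nhds.mono fun ε hε => hε.1
    obtain ⟨ε, ⟨hε1, hε2⟩, hε⟩ := (((ht.and h2).filter_mono
      (nhdsWithin_le_nhds (s := Ioi 0))).and self_mem_nhdsWithin).exists
    rw [← hv t _ P' Q' h' _ (hε2 hε), ← hv t₀ _ P Q h _ (hε1.1 hε)]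
  refine ⟨v 0 - 2 * π, fun t₀ N P Q h => ?_⟩
  have h0 : v t₀ = v 0 := hloc.apply_eq_of_preconnectedSpace _ _
  obtain ⟨η, hη⟩ := (h.eventually_crossing hγ hc).exists
  constructor
  · intro x hx
    rw [hv t₀ N P Q h x hx, h0]
    ring
  · intro x hx
    have h1 := hjump t₀ N P Q h _ hη.1 x hx
    rw [hv t₀ N P Q h _ hη.1, h0] at h1
    linarith

theorem IsSides.left_subset_leftRegion {t₀ : ℝ} {N P Q : Set E3} (h : IsSides γ t₀ N P Q) :
    P ⊆ leftRegion γ := by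
  intro x hx
  have h1 := h.displaced_mem
  rw [nhds_prod_eq] at h1
  refine ⟨t₀, ?_⟩
  filter_upwards [nhdsWithin_le_nhds h1.curry.self_of_nhds, self_mem_nhdsWithin] with ε hε hε0
  exact h.isPreconnected_left.subset_connectedComponentIn (hε.1 hε0)
    (fun z hz => (h.left_subset hz).2) hx

theorem IsSides.right_subset_rightRegion {t₀ : ℝ} {N P Q : Set E3} (h : IsSides γ t₀ N P Q) :
    Q ⊆ rightRegion γ := by
  intro x hx
  have h1 := h.displaced_mem
  rw [nhds_prod_eq] at h1
  refine ⟨t₀, ?_⟩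
  filter_upwards [nhdsWithin_le_nhds h1.curry.self_of_nhds, self_mem_nhdsWithin] with ε hε hε0
  exact h.isPreconnected_right.subset_connectedComponentIn (hε.2 hε0)
    (fun z hz => (h.right_subset hz).2) hx

theorem leftRegion_subset : leftRegion γ ⊆ offCurve γ := fun _ ⟨_, ht⟩ =>
  connectedComponentIn_subset _ _ ht.exists.choose_spec

theorem rightRegion_subset : rightRegion γ ⊆ offCurve γ := fun _ ⟨_, ht⟩ =>
  connectedComponentIn_subset _ _ ht.exists.choose_spec

/-- The left region is a union of connected components of the complement of the loop. -/
theorem subset_leftRegion {C : Set E3} (hC : IsPreconnected C) (hCγ : C ⊆ offCurve γ) {x : E3}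
    (hx : x ∈ C) (hx' : x ∈ leftRegion γ) : C ⊆ leftRegion γ := by
  obtain ⟨t, ht⟩ := hx'
  refine fun y hy => ⟨t, ht.mono fun ε hε => ?_⟩
  have := connectedComponentIn_eq hε
  rw [component, this]
  exact hC.subset_connectedComponentIn hx hCγ hy

theorem subset_rightRegion {C : Set E3} (hC : IsPreconnected C) (hCγ : C ⊆ offCurve γ) {x : E3}
    (hx : x ∈ C) (hx' : x ∈ rightRegion γ) : C ⊆ rightRegion γ := by
  obtain ⟨t, ht⟩ := hx'
  refine fun y hy => ⟨t, ht.mono fun ε hε => ?_⟩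
  have := connectedComponentIn_eq hε
  rw [component, this]
  exact hC.subset_connectedComponentIn hx hCγ hy

/-- The left and the right region of a loop are disjoint: the change of argument along the loop
is larger by `2 π` on the left. This is the half of the Jordan curve theorem which says that a loop
separates the sphere. -/
theorem IsLoop.disjoint_regions (hγ : IsLoop γ T) (hc : IsParallelLift c γ) :
    Disjoint (leftRegion γ) (rightRegion γ) := by
  obtain ⟨m, hm⟩ := hγ.exists_level hc
  have hconst : ∀ x z, z ∈ component γ x → x ∈ offCurve γ →
      angleChange γ 0 (0 + T) z = angleChange γ 0 (0 + T) x := fun x z hz hx =>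
    eq_of_exp_eq isPreconnected_connectedComponentIn
      ((hγ.continuousOn_angleChange (by linarith [hγ.pos])).mono (connectedComponentIn_subset _ _))
      (fun z hz => hγ.exp_angleChange_period hc 0 (connectedComponentIn_subset _ _ hz)) hz
      (mem_connectedComponentIn hx)
  rw [Set.disjoint_left]
  rintro x ⟨t, ht⟩ ⟨t', ht'⟩
  have h1 : angleChange γ 0 (0 + T) x = m + 2 * π := by
    obtain ⟨P, Q, h⟩ := hγ.exists_sides t univ_mem
    have h1 := h.displaced_mem
    rw [nhds_prod_eq] at h1
    obtain ⟨ε, ⟨hε, hε1⟩, hε0⟩ :=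
      ((ht.and (nhdsWithin_le_nhds h1.curry.self_of_nhds)).and self_mem_nhdsWithin).exists
    rw [hconst _ _ hε (h.left_subset (hε1.1 hε0)).2]
    exact (hm t _ P Q h).1 _ (hε1.1 hε0)
  have h2 : angleChange γ 0 (0 + T) x = m := by
    obtain ⟨P, Q, h⟩ := hγ.exists_sides t' univ_mem
    have h1 := h.displaced_mem
    rw [nhds_prod_eq] at h1
    obtain ⟨ε, ⟨hε, hε1⟩, hε0⟩ :=
      ((ht'.and (nhdsWithin_le_nhds h1.curry.self_of_nhds)).and self_mem_nhdsWithin).exists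
    rw [hconst _ _ hε (h.right_subset (hε1.2 hε0)).2]
    exact (hm t' _ P Q h).2 _ (hε1.2 hε0)
  linarith [pi_pos]

/-! ### Two crossing loops -/

/-- The sphere is locally connected: the radial projection of a ball is a connected neighbourhood.
-/
theorem exists_preconnected_nhds {x₀ : E3} (hx₀ : ‖x₀‖ = 1) {N : Set E3} (hN : N ∈ 𝓝 x₀) :
    ∃ C, IsPreconnected C ∧ C ⊆ N ∩ Metric.sphere (0 : E3) 1 ∧ ∀ᶠ x in 𝓝 x₀, ‖x‖ = 1 → x ∈ C := by
  have hne : x₀ ≠ 0 := norm_ne_zero_iff.1 (by rw [hx₀]; exact one_ne_zero)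
  have h1 : ContinuousAt (fun y : E3 => ‖y‖⁻¹ • y) x₀ :=
    (continuousAt_id.norm.inv₀ (by simpa using hne)).smul continuousAt_id
  have h2 : Tendsto (fun y : E3 => ‖y‖⁻¹ • y) (𝓝 x₀) (𝓝 x₀) := by
    have := h1.tendsto
    rwa [hx₀, inv_one, one_smul] at this
  obtain ⟨r, hr, hball⟩ := Metric.eventually_nhds_iff_ball.1
    ((h2.eventually_mem hN).and (eventually_ne_nhds hne))
  refine ⟨(fun y : E3 => ‖y‖⁻¹ • y) '' Metric.ball x₀ r, ?_, ?_, ?_⟩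
  · refine (convex_ball x₀ r).isPreconnected.image _ fun y hy => ContinuousAt.continuousWithinAt ?_
    exact (continuousAt_id.norm.inv₀ (by simpa using (hball y hy).2)).smul continuousAt_id
  · rintro _ ⟨y, hy, rfl⟩
    refine ⟨(hball y hy).1, ?_⟩
    simp only [mem_sphere_iff_norm, sub_zero, norm_smul, norm_inv, norm_norm]
    exact inv_mul_cancel₀ (norm_ne_zero_iff.2 (hball y hy).2)
  · filter_upwards [Metric.ball_mem_nhds x₀ hr] with x hx hx1
    exact ⟨x, hx, by simp [hx1]⟩

/-- By stereographic projection from one of the points, this is the connectedness of the punctured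
plane. -/
theorem isPreconnected_sphere_diff_pair {p n : E3} (hp : ‖p‖ = 1) (hn : ‖n‖ = 1) (hpn : p ≠ n) :
    IsPreconnected (Metric.sphere (0 : E3) 1 \ {p, n}) := by
  have hF : Fact (Module.finrank ℝ E3 = 2 + 1) := ⟨by simp⟩
  have hp0 : p ≠ 0 := norm_ne_zero_iff.1 (by rw [hp]; exact one_ne_zero)
  have hrank : 1 < Module.rank ℝ (ℝ ∙ p)ᗮ := by
    rw [← Module.finrank_eq_rank, Submodule.finrank_orthogonal_span_singleton (n := 2) hp0]
    norm_num
  have hcon := (isConnected_compl_singleton_of_one_lt_rank hrank (stereoToFun p n)).isPreconnected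
  have himg := hcon.image (fun w => (stereoInvFun hp w : E3))
    (continuous_subtype_val.comp (continuous_stereoInvFun hp)).continuousOn
  convert himg using 1
  ext x
  constructor
  · rintro ⟨hx, hx'⟩
    simp only [mem_insert_iff, mem_singleton_iff, not_or] at hx'
    refine ⟨stereoToFun p x, fun he => hx'.2 ?_, ?_⟩
    · have h1 := stereo_left_inv hp (x := ⟨x, hx⟩) hx'.1
      have h2 := stereo_left_inv hp (x := ⟨n, by simpa using hn⟩) hpn.symm
      simp only [mem_singleton_iff] at he
      simp only [he] at h1
      exact congrArg Subtype.val (h1.symm.trans h2)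
    · exact congrArg Subtype.val (stereo_left_inv hp (x := ⟨x, hx⟩) hx'.1)
  · rintro ⟨w, hw, rfl⟩
    refine ⟨(stereoInvFun hp w).2, ?_⟩
    simp only [mem_insert_iff, mem_singleton_iff, not_or]
    refine ⟨fun h => stereoInvFun_ne_north_pole hp w (Subtype.ext h), fun h => hw ?_⟩
    rw [mem_singleton_iff, ← h, stereo_right_inv]

theorem IsLoop.offCurve_compl_mem (hσ : IsLoop σ S) {x : E3} (hx : x ∉ range σ) :
    (range σ)ᶜ ∈ 𝓝 x := hσ.isClosed_range.isOpen_compl.mem_nhds hx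

theorem IsLoop.eventually_leftRegion (hσ : IsLoop σ S) {x₀ : E3} (hx : x₀ ∈ leftRegion σ) :
    ∀ᶠ x in 𝓝 x₀, ‖x‖ = 1 → x ∈ leftRegion σ := by
  have hx1 : ‖x₀‖ = 1 := by simpa using (leftRegion_subset hx).1
  obtain ⟨C, hC, hCN, hC'⟩ :=
    exists_preconnected_nhds hx1 (hσ.offCurve_compl_mem (leftRegion_subset hx).2)
  exact hC'.mono fun x h h1 => subset_leftRegion hC (fun z hz => ⟨(hCN hz).2, (hCN hz).1⟩)
    (hC'.self_of_nhds hx1) hx (h h1)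

theorem IsLoop.eventually_rightRegion (hσ : IsLoop σ S) {x₀ : E3} (hx : x₀ ∈ rightRegion σ) :
    ∀ᶠ x in 𝓝 x₀, ‖x‖ = 1 → x ∈ rightRegion σ := by
  have hx1 : ‖x₀‖ = 1 := by simpa using (rightRegion_subset hx).1
  obtain ⟨C, hC, hCN, hC'⟩ :=
    exists_preconnected_nhds hx1 (hσ.offCurve_compl_mem (rightRegion_subset hx).2)
  exact hC'.mono fun x h h1 => subset_rightRegion hC (fun z hz => ⟨(hCN hz).2, (hCN hz).1⟩)
    (hC'.self_of_nhds hx1) hx (h h1)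

/-- A curve which crosses `σ` from the right to the left. -/
theorem IsLoop.eventually_sides_of_pos (hσ : IsLoop σ S) {s₀ t₀ : ℝ} (hγ : IsLoop γ T)
    (h0 : γ t₀ = σ s₀) (hv : 0 < orient (σ s₀) (deriv σ s₀) (deriv γ t₀)) :
    (∀ᶠ t in 𝓝[>] t₀, γ t ∈ leftRegion σ) ∧ ∀ᶠ t in 𝓝[<] t₀, γ t ∈ rightRegion σ := by
  obtain ⟨P, Q, h⟩ := hσ.exists_sides s₀ univ_mem
  have hy : HasDerivAt (fun s => γ (t₀ + s)) (deriv γ t₀) 0 := by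
    have h0 := (hγ.differentiable (t₀ + 0)).hasDerivAt.comp_const_add t₀ 0
    simpa using h0
  rw [orient_eq_inner_cross, real_inner_comm] at hv
  obtain ⟨h1, h2⟩ := h.crossing_mem _ _ (fun s => hγ.mem_sphere (t₀ + s)) (by simpa using h0) hy hv
  have e1 : Tendsto (fun t => t - t₀) (𝓝[>] t₀) (𝓝[>] 0) := by
    refine tendsto_nhdsWithin_iff.2 ⟨?_, ?_⟩
    · have : Continuous fun t => t - t₀ := by fun_prop
      have h3 := this.tendsto t₀
      rw [sub_self] at h3
      exact h3.mono_left nhdsWithin_le_nhds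
    · filter_upwards [self_mem_nhdsWithin] with t ht
      exact sub_pos.2 (mem_Ioi.1 ht)
  have e2 : Tendsto (fun t => t - t₀) (𝓝[<] t₀) (𝓝[<] 0) := by
    refine tendsto_nhdsWithin_iff.2 ⟨?_, ?_⟩
    · have : Continuous fun t => t - t₀ := by fun_prop
      have h3 := this.tendsto t₀
      rw [sub_self] at h3
      exact h3.mono_left nhdsWithin_le_nhds
    · filter_upwards [self_mem_nhdsWithin] with t ht
      exact sub_neg.2 (mem_Iio.1 ht)
  constructor
  · filter_upwards [e1.eventually h1] with t ht
    rw [add_sub_cancel] at ht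
    exact h.left_subset_leftRegion ht
  · filter_upwards [e2.eventually h2] with t ht
    rw [add_sub_cancel] at ht
    exact h.right_subset_rightRegion ht

/-- A curve which crosses `σ` from the left to the right. -/
theorem IsLoop.eventually_sides_of_neg (hσ : IsLoop σ S) {s₀ t₀ : ℝ} (hγ : IsLoop γ T)
    (h0 : γ t₀ = σ s₀) (hv : orient (σ s₀) (deriv σ s₀) (deriv γ t₀) < 0) :
    (∀ᶠ t in 𝓝[>] t₀, γ t ∈ rightRegion σ) ∧ ∀ᶠ t in 𝓝[<] t₀, γ t ∈ leftRegion σ := by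
  obtain ⟨P, Q, h⟩ := hσ.exists_sides s₀ univ_mem
  have hy : HasDerivAt (fun s => γ (t₀ - s)) (-deriv γ t₀) 0 := by
    have h0 := (hγ.differentiable (t₀ - 0)).hasDerivAt.comp_const_sub t₀ 0
    simpa using h0
  rw [orient_eq_inner_cross, real_inner_comm] at hv
  obtain ⟨h1, h2⟩ := h.crossing_mem _ _ (fun s => hγ.mem_sphere (t₀ - s)) (by simpa using h0) hy
    (by rw [inner_neg_right]; linarith)
  have e1 : Tendsto (fun t => t₀ - t) (𝓝[<] t₀) (𝓝[>] 0) := by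
    refine tendsto_nhdsWithin_iff.2 ⟨?_, ?_⟩
    · have : Continuous fun t => t₀ - t := by fun_prop
      have h3 := this.tendsto t₀
      rw [sub_self] at h3
      exact h3.mono_left nhdsWithin_le_nhds
    · filter_upwards [self_mem_nhdsWithin] with t ht
      exact sub_pos.2 (mem_Iio.1 ht)
  have e2 : Tendsto (fun t => t₀ - t) (𝓝[>] t₀) (𝓝[<] 0) := by
    refine tendsto_nhdsWithin_iff.2 ⟨?_, ?_⟩
    · have : Continuous fun t => t₀ - t := by fun_prop
      have h3 := this.tendsto t₀
      rw [sub_self] at h3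
      exact h3.mono_left nhdsWithin_le_nhds
    · filter_upwards [self_mem_nhdsWithin] with t ht
      exact sub_neg.2 (mem_Ioi.1 ht)
  constructor
  · filter_upwards [e2.eventually h2] with t ht
    rw [sub_sub_cancel] at ht
    exact h.right_subset_rightRegion ht
  · filter_upwards [e1.eventually h1] with t ht
    rw [sub_sub_cancel] at ht
    exact h.left_subset_leftRegion ht

theorem IsLoop.arc_subset_offCurve (hγ : IsLoop γ T) {a b : ℝ} (h : ∀ t ∈ Ioo a b, γ t ∉ range σ) :
    IsPreconnected (γ '' Ioo a b) ∧ γ '' Ioo a b ⊆ offCurve σ := by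
  refine ⟨isPreconnected_Ioo.image _ hγ.continuous.continuousOn, ?_⟩
  rintro _ ⟨t, ht, rfl⟩
  exact ⟨by simp [hγ.mem_sphere], h t ht⟩

theorem IsLoop.arc_subset_leftRegion (hγ : IsLoop γ T) {a b : ℝ}
    (h : ∀ t ∈ Ioo a b, γ t ∉ range σ) (h' : ∃ t ∈ Ioo a b, γ t ∈ leftRegion σ) :
    ∀ t ∈ Ioo a b, γ t ∈ leftRegion σ := by
  obtain ⟨h1, h2⟩ := hγ.arc_subset_offCurve h
  obtain ⟨t, ht, ht'⟩ := h'
  exact fun u hu => subset_leftRegion h1 h2 ⟨t, ht, rfl⟩ ht' ⟨u, hu, rfl⟩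

theorem IsLoop.arc_subset_rightRegion (hγ : IsLoop γ T) {a b : ℝ}
    (h : ∀ t ∈ Ioo a b, γ t ∉ range σ) (h' : ∃ t ∈ Ioo a b, γ t ∈ rightRegion σ) :
    ∀ t ∈ Ioo a b, γ t ∈ rightRegion σ := by
  obtain ⟨h1, h2⟩ := hγ.arc_subset_offCurve h
  obtain ⟨t, ht, ht'⟩ := h'
  exact fun u hu => subset_rightRegion h1 h2 ⟨t, ht, rfl⟩ ht' ⟨u, hu, rfl⟩

/-- Two loops which meet in exactly two points. The parameters of the second meeting point are the
last ones before those of the first one, where `σ` crosses `γ` from the right to the left. -/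
structure IsCrossingPair (γ σ : ℝ → E3) (T S t₁ t₀ s₁ s₀ : ℝ) : Prop where
  loop_left : IsLoop γ T
  loop_right : IsLoop σ S
  mem_left : t₀ ∈ Ioo t₁ (t₁ + T)
  mem_right : s₀ ∈ Ioo s₁ (s₁ + S)
  meet₀ : γ t₀ = σ s₀
  meet₁ : γ t₁ = σ s₁
  inter : range γ ∩ range σ = {γ t₀, γ t₁}
  pos : 0 < orient (γ t₀) (deriv γ t₀) (deriv σ s₀)

namespace IsCrossingPair

variable {t₁ t₀ s₁ s₀ : ℝ}

theorem ne (h : IsCrossingPair γ σ T S t₁ t₀ s₁ s₀) : γ t₀ ≠ γ t₁ := fun e => by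
  have := h.loop_left.eq_of_abs_sub_lt e
    (abs_lt.2 ⟨by linarith [h.mem_left.2], by linarith [h.mem_left.1, h.loop_left.pos]⟩)
  linarith [h.mem_left.1]

theorem notMem_left (h : IsCrossingPair γ σ T S t₁ t₀ s₁ s₀) {t : ℝ} (ht : t ∈ Ioo t₁ (t₁ + T))
    (hne : t ≠ t₀) : γ t ∉ range σ := by
  intro hmem
  have h1 : γ t ∈ range γ ∩ range σ := ⟨⟨t, rfl⟩, hmem⟩
  rw [h.inter] at h1
  have hT := h.mem_left
  rcases h1 with e | e
  · exact hne (h.loop_left.eq_of_abs_sub_lt (Eq.symm e)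
      (abs_lt.2 ⟨by linarith [ht.1, hT.2], by linarith [ht.2, hT.1]⟩))
  · have := h.loop_left.eq_of_abs_sub_lt (Eq.symm e)
      (abs_lt.2 ⟨by linarith [ht.1, ht.2], by linarith [ht.2]⟩)
    linarith [ht.1]

theorem notMem_right (h : IsCrossingPair γ σ T S t₁ t₀ s₁ s₀) {s : ℝ} (hs : s ∈ Ioo s₁ (s₁ + S))
    (hne : s ≠ s₀) : σ s ∉ range γ := by
  intro hmem
  have h1 : σ s ∈ range γ ∩ range σ := ⟨hmem, ⟨s, rfl⟩⟩
  rw [h.inter, h.meet₀, h.meet₁] at h1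
  have hS := h.mem_right
  rcases h1 with e | e
  · exact hne (h.loop_right.eq_of_abs_sub_lt (Eq.symm e)
      (abs_lt.2 ⟨by linarith [hs.1, hS.2], by linarith [hs.2, hS.1]⟩))
  · have := h.loop_right.eq_of_abs_sub_lt (Eq.symm e)
      (abs_lt.2 ⟨by linarith [hs.1, hs.2], by linarith [hs.2]⟩)
    linarith [hs.1]

/-- Each of the four arcs between the meeting points lies on one side of the other loop. -/
theorem arcs (h : IsCrossingPair γ σ T S t₁ t₀ s₁ s₀) :
    ((∀ t ∈ Ioo t₁ t₀, γ t ∈ leftRegion σ) ∧ ∀ t ∈ Ioo t₀ (t₁ + T), γ t ∈ rightRegion σ) ∧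
      (∀ s ∈ Ioo s₁ s₀, σ s ∈ rightRegion γ) ∧ ∀ s ∈ Ioo s₀ (s₁ + S), σ s ∈ leftRegion γ := by
  have ht := h.mem_left
  have hs := h.mem_right
  obtain ⟨h1, h2⟩ := h.loop_right.eventually_sides_of_neg h.loop_left h.meet₀ (by
    rw [orient_swap, ← h.meet₀]
    linarith [h.pos])
  obtain ⟨h3, h4⟩ := h.loop_left.eventually_sides_of_pos h.loop_right h.meet₀.symm h.pos
  refine ⟨⟨?_, ?_⟩, ?_, ?_⟩
  · refine h.loop_left.arc_subset_leftRegion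
      (fun t ht' => h.notMem_left ⟨ht'.1, ht'.2.trans ht.2⟩ ht'.2.ne) ?_
    obtain ⟨t, h6, h5⟩ := (h2.and (Ioo_mem_nhdsLT ht.1)).exists
    exact ⟨t, h5, h6⟩
  · refine h.loop_left.arc_subset_rightRegion
      (fun t ht' => h.notMem_left ⟨ht.1.trans ht'.1, ht'.2⟩ ht'.1.ne') ?_
    obtain ⟨t, h6, h5⟩ := (h1.and (Ioo_mem_nhdsGT ht.2)).exists
    exact ⟨t, h5, h6⟩
  · refine h.loop_right.arc_subset_rightRegion
      (fun s hs' => h.notMem_right ⟨hs'.1, hs'.2.trans hs.2⟩ hs'.2.ne) ?_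
    obtain ⟨s, h6, h5⟩ := (h4.and (Ioo_mem_nhdsLT hs.1)).exists
    exact ⟨s, h5, h6⟩
  · refine h.loop_right.arc_subset_leftRegion
      (fun s hs' => h.notMem_right ⟨hs.1.trans hs'.1, hs'.2⟩ hs'.1.ne') ?_
    obtain ⟨s, h6, h5⟩ := (h3.and (Ioo_mem_nhdsGT hs.2)).exists
    exact ⟨s, h5, h6⟩

/-- At the second meeting point `σ` crosses `γ` from the left to the right: otherwise the arc of `σ`
between the meeting points would start on the left of `γ` and end on the right of it. -/
theorem orient_nonpos (h : IsCrossingPair γ σ T S t₁ t₀ s₁ s₀) (hc : IsParallelLift c γ) :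
    orient (γ t₁) (deriv γ t₁) (deriv σ s₁) ≤ 0 := by
  by_contra! hcon
  obtain ⟨h3, -⟩ := h.loop_left.eventually_sides_of_pos h.loop_right h.meet₁.symm hcon
  obtain ⟨s, h6, h5⟩ := (h3.and (Ioo_mem_nhdsGT h.mem_right.1)).exists
  exact Set.disjoint_left.1 (h.loop_left.disjoint_regions hc) h6 (h.arcs.2.1 s h5)

end IsCrossingPair

/-! ### The area between two loops and the phase at the second meeting point -/

/-- The change of argument along the digon which follows `σ` from `s₁` to `s₀` and then returns
along `γ` from `t₀` to `t₁`. -/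
def digonAngle (γ σ : ℝ → E3) (t₁ t₀ s₁ s₀ : ℝ) (x : E3) : ℝ :=
  angleChange σ s₁ s₀ x - angleChange γ t₁ t₀ x

/-- The region to the right of `γ` and to the left of `σ`. -/
def between (γ σ : ℝ → E3) : Set E3 := rightRegion γ ∩ leftRegion σ

/-- The change of argument along the digon, corrected by its winding number. -/
def digonPhase (γ σ : ℝ → E3) (t₁ t₀ s₁ s₀ : ℝ) (x : E3) : ℝ :=
  digonAngle γ σ t₁ t₀ s₁ s₀ x - 2 * π * (between γ σ).indicator 1 x

theorem tendsto_sub_crossing {f : E3 → ℝ} {t : ℝ} (hf : ContinuousAt f (γ t)) :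
    Tendsto (fun η => f (crossing γ t η) - f (crossing γ t (-η))) (𝓝[>] 0) (𝓝 0) := by
  have h1 := tendsto_crossing γ t
  have h2 : Tendsto (fun η => crossing γ t (-η)) (𝓝 0) (𝓝 (γ t)) := by
    refine h1.comp ?_
    have := (continuous_neg (G := ℝ)).tendsto 0
    rwa [neg_zero] at this
  have h3 := (hf.tendsto.comp h1).sub (hf.tendsto.comp h2)
  rw [sub_self] at h3
  exact h3.mono_left nhdsWithin_le_nhds

/-- Points `crossing γ t η` and `crossing γ t (-η)` lie to the left and right of `γ`, and on the
same side of `σ` as `γ t`. -/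
theorem IsLoop.eventually_crossing_mem (hγ : IsLoop γ T) (hc : IsParallelLift c γ) {t : ℝ}
    {N : Set E3} (hN : ∀ᶠ x in 𝓝 (γ t), ‖x‖ = 1 → x ∈ N) :
    ∀ᶠ η in 𝓝[>] (0 : ℝ), (crossing γ t η ∈ leftRegion γ ∧ crossing γ t η ∈ N) ∧
      crossing γ t (-η) ∈ rightRegion γ ∧ crossing γ t (-η) ∈ N := by
  obtain ⟨P, Q, h⟩ := hγ.exists_sides t hN
  filter_upwards [h.eventually_crossing hγ hc] with η hη
  exact ⟨⟨h.left_subset_leftRegion hη.1, (h.left_subset hη.1).1 (norm_crossing hc hγ _ _)⟩,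
    h.right_subset_rightRegion hη.2, (h.right_subset hη.2).1 (norm_crossing hc hγ _ _)⟩

namespace IsCrossingPair

variable {t₁ t₀ s₁ s₀ : ℝ}

/-- Modulo `2 π`, the change of argument along the digon does not depend on the point from which it
is seen: it is the relative phase of the lifts at the two meeting points. -/
theorem exp_digonAngle (h : IsCrossingPair γ σ T S t₁ t₀ s₁ s₀) (hc : IsParallelLift c γ)
    (hd : IsParallelLift d σ) {u v : ℂ} (hu : c t₀ = u • d s₀) (hv : c t₁ = v • d s₁) {x : E3}
    (hx : x ∈ offCurve γ ∩ offCurve σ) :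
    Complex.exp (Complex.I * digonAngle γ σ t₁ t₀ s₁ s₀ x) = v / u := by
  obtain ⟨q, hq, rfl⟩ := exists_hopf_eq (x := x) (by simpa using hx.1.1)
  have hne : ∀ t, wedge q (c t) ≠ 0 := fun t => by
    rw [wedge_ne_zero_iff hq (hc.norm_eq t), hc.lies_over]
    exact (one_sub_inner_pos_of_offCurve h.loop_left hx.1 t).ne'
  have hne' : ∀ t, wedge q (d t) ≠ 0 := fun t => by
    rw [wedge_ne_zero_iff hq (hd.norm_eq t), hd.lies_over]
    exact (one_sub_inner_pos_of_offCurve h.loop_right hx.2 t).ne'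
  have h1 := exp_angleChange hc h.loop_left hq h.mem_left.1.le fun t _ => hne t
  have h2 := exp_angleChange hd h.loop_right hq h.mem_right.1.le fun t _ => hne' t
  have hu1 : ‖u‖ = 1 := by
    have := congrArg norm hu
    rwa [norm_smul, hc.norm_eq, hd.norm_eq, mul_one, eq_comm] at this
  have hv1 : ‖v‖ = 1 := by
    have := congrArg norm hv
    rwa [norm_smul, hc.norm_eq, hd.norm_eq, mul_one, eq_comm] at this
  have hu0 : u ≠ 0 := norm_ne_zero_iff.1 (by rw [hu1]; exact one_ne_zero)
  rw [hu, hv, wedge_smul_right, wedge_smul_right, norm_mul, norm_mul, hu1, hv1, one_mul,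
    one_mul] at h1
  rw [digonAngle, Complex.ofReal_sub, mul_sub, Complex.exp_sub,
    div_eq_div_iff (Complex.exp_ne_zero _) hu0]
  have n0 : ((‖wedge q (d s₀)‖ : ℝ) : ℂ) ≠ 0 := by simpa using hne' s₀
  have n1 := hne' s₁
  refine mul_right_cancel₀ (mul_ne_zero n1 n0) ?_
  linear_combination h1 - u * h2

theorem continuousAt_digonAngle (h : IsCrossingPair γ σ T S t₁ t₀ s₁ s₀) {x : E3} (hx : ‖x‖ = 1)
    (h1 : ∀ t ∈ Icc t₁ t₀, x ≠ γ t) (h2 : ∀ s ∈ Icc s₁ s₀, x ≠ σ s) :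
    ContinuousAt (digonAngle γ σ t₁ t₀ s₁ s₀) x :=
  (h.loop_right.continuousAt_angleChange h.mem_right.1.le fun s hs =>
    one_sub_inner_pos hx (h.loop_right.mem_sphere s) (h2 s hs)).sub
  (h.loop_left.continuousAt_angleChange h.mem_left.1.le fun t ht =>
    one_sub_inner_pos hx (h.loop_left.mem_sphere t) (h1 t ht))

/-- The phase `digonPhase` is constant on connected sets which do not meet the loops. -/
theorem digonPhase_eq (h : IsCrossingPair γ σ T S t₁ t₀ s₁ s₀) (hc : IsParallelLift c γ)
    (hd : IsParallelLift d σ) {u v : ℂ} (hu : c t₀ = u • d s₀) (hv : c t₁ = v • d s₁)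
    {C : Set E3} (hC : IsPreconnected C) (hCD : C ⊆ offCurve γ ∩ offCurve σ) {x y : E3}
    (hx : x ∈ C) (hy : y ∈ C) :
    digonPhase γ σ t₁ t₀ s₁ s₀ x = digonPhase γ σ t₁ t₀ s₁ s₀ y := by
  have h1 : digonAngle γ σ t₁ t₀ s₁ s₀ x = digonAngle γ σ t₁ t₀ s₁ s₀ y := by
    refine eq_of_exp_eq hC (fun z hz => ContinuousAt.continuousWithinAt ?_)
      (fun z hz => h.exp_digonAngle hc hd hu hv (hCD hz)) hx hy
    exact h.continuousAt_digonAngle (by simpa using (hCD hz).1.1)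
      (fun t _ e => (hCD hz).1.2 ⟨t, e.symm⟩) (fun t _ e => (hCD hz).2.2 ⟨t, e.symm⟩)
  have h2 : ∀ a ∈ C, ∀ b ∈ C, a ∈ between γ σ → b ∈ between γ σ := fun a ha b hb hab =>
    ⟨subset_rightRegion hC (fun z hz => (hCD hz).1) ha hab.1 hb,
      subset_leftRegion hC (fun z hz => (hCD hz).2) ha hab.2 hb⟩
  have h3 : (between γ σ).indicator (1 : E3 → ℝ) x = (between γ σ).indicator 1 y := by
    by_cases hx' : x ∈ between γ σ
    · rw [indicator_of_mem hx', indicator_of_mem (h2 x hx y hy hx')]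
      rfl
    · rw [indicator_of_notMem hx', indicator_of_notMem fun hy' => hx' (h2 y hy x hx hy')]
  rw [digonPhase, digonPhase, h1, h3]

/-- The phase `digonPhase` does not jump across a loop, away from the meeting points, so that it
is constant near every point there. -/
theorem digonPhase_locally_const_on_curve {α β : ℝ → E3} {e : ℝ → C2}
    (h : IsCrossingPair γ σ T S t₁ t₀ s₁ s₀) (hc : IsParallelLift c γ)
    (hd : IsParallelLift d σ) {u v : ℂ} (hu : c t₀ = u • d s₀) (hv : c t₁ = v • d s₁)
    {R t : ℝ} (hα : IsLoop α R) (hβ : IsClosed (range β)) (he : IsParallelLift e α)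
    (hαβ : offCurve α ∩ offCurve β = offCurve γ ∩ offCurve σ) (ht : α t ∉ range β)
    (hl : Tendsto (fun η => digonPhase γ σ t₁ t₀ s₁ s₀ (crossing α t η) -
      digonPhase γ σ t₁ t₀ s₁ s₀ (crossing α t (-η))) (𝓝[>] 0) (𝓝 0)) :
    (∃ z, ∀ᶠ y in 𝓝[offCurve γ ∩ offCurve σ] (α t), digonPhase γ σ t₁ t₀ s₁ s₀ y = z) ∧
      α t ∈ closure (offCurve γ ∩ offCurve σ) := by
  obtain ⟨P, Q, hs⟩ := hα.exists_sides t (hβ.isOpen_compl.mem_nhds ht)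
  have hP : P ⊆ offCurve γ ∩ offCurve σ := by
    rw [← hαβ]
    exact fun x hx => ⟨(hs.left_subset hx).2, (hs.left_subset hx).2.1, (hs.left_subset hx).1⟩
  have hQ : Q ⊆ offCurve γ ∩ offCurve σ := by
    rw [← hαβ]
    exact fun x hx => ⟨(hs.right_subset hx).2, (hs.right_subset hx).2.1, (hs.right_subset hx).1⟩
  have hev := hs.eventually_crossing hα he
  obtain ⟨η, hη⟩ := hev.exists
  have hPc : ∀ x ∈ P, ∀ y ∈ P, _ := fun x hx y hy =>
    h.digonPhase_eq hc hd hu hv hs.isPreconnected_left hP hx hy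
  have hQc : ∀ x ∈ Q, ∀ y ∈ Q, _ := fun x hx y hy =>
    h.digonPhase_eq hc hd hu hv hs.isPreconnected_right hQ hx hy
  refine ⟨⟨digonPhase γ σ t₁ t₀ s₁ s₀ (crossing α t η), ?_⟩, ?_⟩
  · filter_upwards [nhdsWithin_le_nhds hs.cover, self_mem_nhdsWithin] with y hy hyD
    rcases hy (by rw [← hαβ] at hyD; exact hyD.1) with h1 | h1
    · exact hPc _ h1 _ hη.1
    · have := hs.sub_eq_of_tendsto hα he hPc hQc hl hη.1 h1
      linarith
  · refine mem_closure_of_tendsto ((tendsto_crossing α t).mono_left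
      (nhdsWithin_le_nhds (s := Ioi 0))) (hev.mono fun η hη => hP hη.1)

/-- The jumps of the change of argument and of the winding number across `γ` cancel. -/
theorem tendsto_digonPhase_left (h : IsCrossingPair γ σ T S t₁ t₀ s₁ s₀) (hc : IsParallelLift c γ)
    (hd : IsParallelLift d σ) {t : ℝ} (ht : t ∈ Ioo t₁ (t₁ + T)) (hne : t ≠ t₀) :
    Tendsto (fun η => digonPhase γ σ t₁ t₀ s₁ s₀ (crossing γ t η) -
      digonPhase γ σ t₁ t₀ s₁ s₀ (crossing γ t (-η))) (𝓝[>] 0) (𝓝 0) := by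
  have hnot := h.notMem_left ht hne
  have hT := h.mem_left
  rcases lt_or_gt_of_ne hne with hlt | hgt
  · have hL := (h.arcs).1.1 t ⟨ht.1, hlt⟩
    have h1 := tendsto_jump hc h.loop_left ht.1 hlt fun r hr e =>
      h.loop_left.eq_of_abs_sub_lt e.symm
        (abs_lt.2 ⟨by linarith [hr.1, hr.2, hT.2], by linarith [hr.1, hr.2, hT.2, ht.1]⟩)
    have h2 := tendsto_sub_crossing (h.loop_right.continuousAt_angleChange h.mem_right.1.le
      (x := γ t) fun s _ => one_sub_inner_pos (h.loop_left.mem_sphere t)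
        (h.loop_right.mem_sphere s) fun e => hnot ⟨s, e.symm⟩)
    have h3 := (h2.sub h1).add_const (2 * π)
    rw [zero_sub, neg_add_cancel] at h3
    refine h3.congr' ?_
    filter_upwards [h.loop_left.eventually_crossing_mem hc (h.loop_right.eventually_leftRegion hL)]
      with η hη
    have e1 : crossing γ t η ∉ between γ σ := fun hm =>
      Set.disjoint_left.1 (h.loop_left.disjoint_regions hc) hη.1.1 hm.1
    have e2 : crossing γ t (-η) ∈ between γ σ := hη.2
    rw [digonPhase, digonPhase, indicator_of_notMem e1, indicator_of_mem e2, digonAngle,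
      digonAngle, Pi.one_apply]
    ring
  · have hR := (h.arcs).1.2 t ⟨hgt, ht.2⟩
    have h1 := tendsto_sub_crossing (h.continuousAt_digonAngle (h.loop_left.mem_sphere t)
      (fun r hr e => by
        have := h.loop_left.eq_of_abs_sub_lt e
          (abs_lt.2 ⟨by linarith [hr.1, ht.2], by linarith [hr.2, h.loop_left.pos]⟩)
        linarith [hr.2])
      (fun s _ e => hnot ⟨s, e.symm⟩))
    refine h1.congr' ?_
    filter_upwards [h.loop_left.eventually_crossing_mem hc (h.loop_right.eventually_rightRegion hR)]
      with η hη
    have e0 : ∀ x, x ∈ rightRegion σ → x ∉ between γ σ := fun x hx hm =>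
      Set.disjoint_left.1 (h.loop_right.disjoint_regions hd) hm.2 hx
    rw [digonPhase, digonPhase, indicator_of_notMem (e0 _ hη.1.2),
      indicator_of_notMem (e0 _ hη.2.2)]
    ring

/-- The jumps of the change of argument and of the winding number across `σ` cancel. -/
theorem tendsto_digonPhase_right (h : IsCrossingPair γ σ T S t₁ t₀ s₁ s₀)
    (hc : IsParallelLift c γ) (hd : IsParallelLift d σ) {s : ℝ} (hs : s ∈ Ioo s₁ (s₁ + S))
    (hne : s ≠ s₀) :
    Tendsto (fun η => digonPhase γ σ t₁ t₀ s₁ s₀ (crossing σ s η) -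
      digonPhase γ σ t₁ t₀ s₁ s₀ (crossing σ s (-η))) (𝓝[>] 0) (𝓝 0) := by
  have hnot := h.notMem_right hs hne
  have hS := h.mem_right
  rcases lt_or_gt_of_ne hne with hlt | hgt
  · have hR := (h.arcs).2.1 s ⟨hs.1, hlt⟩
    have h1 := tendsto_jump hd h.loop_right hs.1 hlt fun r hr e =>
      h.loop_right.eq_of_abs_sub_lt e.symm
        (abs_lt.2 ⟨by linarith [hr.1, hr.2, hS.2], by linarith [hr.1, hr.2, hS.2, hs.1]⟩)
    have h2 := tendsto_sub_crossing (h.loop_left.continuousAt_angleChange h.mem_left.1.le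
      (x := σ s) fun t _ => one_sub_inner_pos (h.loop_right.mem_sphere s)
        (h.loop_left.mem_sphere t) fun e => hnot ⟨t, e.symm⟩)
    have h3 := (h1.sub h2).sub_const (2 * π)
    rw [sub_zero, sub_self] at h3
    refine h3.congr' ?_
    filter_upwards [h.loop_right.eventually_crossing_mem hd (h.loop_left.eventually_rightRegion hR)]
      with η hη
    have e1 : crossing σ s η ∈ between γ σ := hη.1.symm
    have e2 : crossing σ s (-η) ∉ between γ σ := fun hm =>
      Set.disjoint_left.1 (h.loop_right.disjoint_regions hd) hm.2 hη.2.1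
    rw [digonPhase, digonPhase, indicator_of_notMem e2, indicator_of_mem e1, digonAngle,
      digonAngle, Pi.one_apply]
    ring
  · have hL := (h.arcs).2.2 s ⟨hgt, hs.2⟩
    have h1 := tendsto_sub_crossing (h.continuousAt_digonAngle (h.loop_right.mem_sphere s)
      (fun t _ e => hnot ⟨t, e.symm⟩) (fun r hr e => by
        have := h.loop_right.eq_of_abs_sub_lt e
          (abs_lt.2 ⟨by linarith [hr.1, hs.2], by linarith [hr.2, h.loop_right.pos]⟩)
        linarith [hr.2]))
    refine h1.congr' ?_
    filter_upwards [h.loop_right.eventually_crossing_mem hd (h.loop_left.eventually_leftRegion hL)]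
      with η hη
    have e0 : ∀ x, x ∈ leftRegion γ → x ∉ between γ σ := fun x hx hm =>
      Set.disjoint_left.1 (h.loop_left.disjoint_regions hc) hx hm.1
    rw [digonPhase, digonPhase, indicator_of_notMem (e0 _ hη.1.2),
      indicator_of_notMem (e0 _ hη.2.2)]
    ring

/-- The phase `digonPhase` is constant off the loops, since the sphere without the two meeting
points is connected. -/
theorem exists_digonPhase_eq (h : IsCrossingPair γ σ T S t₁ t₀ s₁ s₀) (hc : IsParallelLift c γ)
    (hd : IsParallelLift d σ) {u v : ℂ} (hu : c t₀ = u • d s₀) (hv : c t₁ = v • d s₁) :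
    ∀ x ∈ offCurve γ ∩ offCurve σ, ∀ y ∈ offCurve γ ∩ offCurve σ,
      digonPhase γ σ t₁ t₀ s₁ s₀ x = digonPhase γ σ t₁ t₀ s₁ s₀ y := by
  have hγ := h.loop_left
  have hσ := h.loop_right
  have hΩ := isPreconnected_sphere_diff_pair (hγ.mem_sphere t₀) (hγ.mem_sphere t₁) h.ne
  have hDΩ : offCurve γ ∩ offCurve σ ⊆ Metric.sphere (0 : E3) 1 \ {γ t₀, γ t₁} := by
    rintro x ⟨h1, -⟩
    refine ⟨h1.1, ?_⟩
    rintro (rfl | rfl)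
    exacts [h1.2 ⟨_, rfl⟩, h1.2 ⟨_, rfl⟩]
  have hloc : ∀ x ∈ Metric.sphere (0 : E3) 1 \ {γ t₀, γ t₁},
      (∃ z, ∀ᶠ y in 𝓝[offCurve γ ∩ offCurve σ] x, digonPhase γ σ t₁ t₀ s₁ s₀ y = z) ∧
        x ∈ closure (offCurve γ ∩ offCurve σ) := by
    rintro x ⟨hx, hx'⟩
    simp only [mem_insert_iff, mem_singleton_iff, not_or] at hx'
    by_cases h1 : x ∈ range γ
    · obtain ⟨t', rfl⟩ := h1
      obtain ⟨t, ht, e⟩ := Function.Periodic.exists_mem_Ico hγ.periodic hγ.pos t' t₁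
      rw [e] at hx' ⊢
      have ht1 : t ≠ t₁ := fun e' => hx'.2 (by rw [e'])
      have ht0 : t ≠ t₀ := fun e' => hx'.1 (by rw [e'])
      have ht' : t ∈ Ioo t₁ (t₁ + T) := ⟨lt_of_le_of_ne ht.1 ht1.symm, ht.2⟩
      exact h.digonPhase_locally_const_on_curve hc hd hu hv hγ hσ.isClosed_range hc rfl
        (h.notMem_left ht' ht0) (h.tendsto_digonPhase_left hc hd ht' ht0)
    by_cases h2 : x ∈ range σ
    · obtain ⟨s', rfl⟩ := h2
      obtain ⟨s, hs, e⟩ := Function.Periodic.exists_mem_Ico hσ.periodic hσ.pos s' s₁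
      rw [e, h.meet₀, h.meet₁] at hx'
      rw [e]
      have hs1 : s ≠ s₁ := fun e' => hx'.2 (by rw [e'])
      have hs0 : s ≠ s₀ := fun e' => hx'.1 (by rw [e'])
      have hs' : s ∈ Ioo s₁ (s₁ + S) := ⟨lt_of_le_of_ne hs.1 hs1.symm, hs.2⟩
      exact h.digonPhase_locally_const_on_curve hc hd hu hv hσ hγ.isClosed_range hd
        (inter_comm _ _) (h.notMem_right hs' hs0) (h.tendsto_digonPhase_right hc hd hs' hs0)
    · obtain ⟨C, hC, hCN, hC'⟩ := exists_preconnected_nhds (x₀ := x) (by simpa using hx)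
        (inter_mem (hγ.offCurve_compl_mem h1) (hσ.offCurve_compl_mem h2))
      have hCD : C ⊆ offCurve γ ∩ offCurve σ := fun z hz =>
        ⟨⟨(hCN hz).2, (hCN hz).1.1⟩, (hCN hz).2, (hCN hz).1.2⟩
      have hxC : x ∈ C := hC'.self_of_nhds (by simpa using hx)
      refine ⟨⟨digonPhase γ σ t₁ t₀ s₁ s₀ x, ?_⟩, subset_closure (hCD hxC)⟩
      filter_upwards [nhdsWithin_le_nhds hC', self_mem_nhdsWithin] with y hy hyD
      exact h.digonPhase_eq hc hd hu hv hC hCD (hy (by simpa using hyD.1.1)) hxC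
  intro x hx y hy
  exact eq_of_locally_const hΩ (fun z hz => (hloc z hz).2) (fun z hz => (hloc z hz).1)
    ⟨hx, hDΩ hx⟩ ⟨hy, hDΩ hy⟩

/-- The relative phase of two parallel lifts changes from one meeting point to the other by half
the area of the region between them. The constant value `w` of `digonPhase` is found by integrating
over the sphere: `digonAngle` has the mean value zero, so that `0 = 4 π w + 2 π area`. -/
theorem phase_eq (h : IsCrossingPair γ σ T S t₁ t₀ s₁ s₀) (hc : IsParallelLift c γ)
    (hd : IsParallelLift d σ) {u v : ℂ} (hu : c t₀ = u • d s₀) (hv : c t₁ = v • d s₁) :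
    v = u * Complex.exp (-(Complex.I * ((sphereArea (between γ σ)).toReal / 2 : ℝ))) := by
  have hγ := h.loop_left
  have hσ := h.loop_right
  have hae : ∀ᵐ x ∂sphereArea, x ∈ offCurve γ ∩ offCurve σ := by
    have h1 := measure_eq_zero_iff_ae_notMem.1
      (sphereArea_range_eq_zero hγ.differentiable hγ.isClosed_range)
    have h2 := measure_eq_zero_iff_ae_notMem.1
      (sphereArea_range_eq_zero hσ.differentiable hσ.isClosed_range)
    filter_upwards [h1, h2, ae_norm_eq_one] with x h1 h2 h3
    exact ⟨⟨by simpa using h3, h1⟩, by simpa using h3, h2⟩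
  have hne : (sphereArea univ) ≠ 0 := by
    rw [sphereArea_univ]
    simpa using pi_pos
  have : NeBot (ae sphereArea) := by
    rw [ae_neBot]
    rintro h0
    simp [h0] at hne
  obtain ⟨x₀, hx₀⟩ := hae.exists
  set w := digonPhase γ σ t₁ t₀ s₁ s₀ x₀ with hw
  set f := digonAngle γ σ t₁ t₀ s₁ s₀ with hf
  have hconst : ∀ x ∈ offCurve γ ∩ offCurve σ,
      f x = w + 2 * π * (between γ σ).indicator 1 x := fun x hx => by
    rw [hw, ← h.exists_digonPhase_eq hc hd hu hv x hx x₀ hx₀, digonPhase]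
    ring
  have hi1 := hσ.integrable_angleChange h.mem_right.1.le
  have hi2 := hγ.integrable_angleChange h.mem_left.1.le
  have hfi : Integrable f sphereArea := hi1.sub hi2
  have hf0 : ∫ x, f x ∂sphereArea = 0 := by
    simp only [hf, digonAngle]
    rw [integral_sub hi1 hi2, hσ.integral_angleChange h.mem_right.1.le,
      hγ.integral_angleChange h.mem_left.1.le, sub_zero]
  -- the region is measurable up to a null set, as a level set of `f`
  have hB : NullMeasurableSet (between γ σ) sphereArea := by
    refine NullMeasurableSet.congr
      (hfi.aemeasurable.nullMeasurableSet_preimage (measurableSet_singleton (w + 2 * π))) ?_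
    filter_upwards [hae] with x hx
    refine propext ?_
    show f x = w + 2 * π ↔ x ∈ between γ σ
    rw [hconst x hx]
    by_cases hxB : x ∈ between γ σ
    · simp [hxB]
    · simp [hxB, pi_ne_zero]
  have hint : ∫ x, f x ∂sphereArea = w * (4 * π) + 2 * π * (sphereArea (between γ σ)).toReal := by
    rw [integral_congr_ae (hae.mono fun x hx => hconst x hx), integral_add (integrable_const _),
      integral_const_mul, integral_const, integral_indicator₀ hB]
    · simp [Measure.real, sphereArea_univ, pi_pos.le, mul_comm]
    · exact ((integrable_const (1 : ℝ)).indicator₀ hB).const_mul _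
  rw [hf0] at hint
  have hw' : w = -((sphereArea (between γ σ)).toReal / 2) := by
    have := pi_pos
    have h1 : 2 * π * (2 * w + (sphereArea (between γ σ)).toReal) = 0 := by linarith
    rcases mul_eq_zero.1 h1 with h2 | h2 <;> linarith
  have hexp := h.exp_digonAngle hc hd hu hv hx₀
  have hE : Complex.exp (Complex.I * f x₀) = Complex.exp (Complex.I * w) := by
    rw [hconst x₀ hx₀]
    by_cases hxB : x₀ ∈ between γ σ
    · rw [indicator_of_mem hxB, Pi.one_apply, Complex.exp_eq_exp_iff_exists_int]
      refine ⟨1, ?_⟩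
      push_cast
      ring
    · rw [indicator_of_notMem hxB, mul_zero, add_zero]
  have hu0 : u ≠ 0 := by
    rintro rfl
    have := hc.norm_eq t₀
    rw [hu, zero_smul, norm_zero] at this
    exact zero_ne_one this
  rw [← hf, hE, hw', eq_div_iff hu0] at hexp
  rw [← hexp, mul_comm]
  congr 2
  push_cast
  ring

end IsCrossingPair

/-! ### The pairing of two loop states -/

/-- The Gram determinant of three vectors, two of which are orthogonal to the first one. -/
theorem orient_sq {x v w : E3} (hx : ‖x‖ = 1) (hv : inner ℝ x v = (0 : ℝ))
    (hw : inner ℝ x w = (0 : ℝ)) :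
    orient x v w ^ 2 = ‖v‖ ^ 2 * ‖w‖ ^ 2 - inner ℝ v w ^ 2 := by
  have h : orient x v w ^ 2 = inner ℝ x x * inner ℝ v v * inner ℝ w w +
      2 * (inner ℝ x v * inner ℝ v w * inner ℝ x w) - inner ℝ x x * inner ℝ v w ^ 2 -
        inner ℝ v v * inner ℝ x w ^ 2 - inner ℝ w w * inner ℝ x v ^ 2 := by
    simp only [orient, inner_E3, cross_zero, cross_one, cross_two]
    ring
  rw [h, hv, hw, real_inner_self_eq_norm_sq, real_inner_self_eq_norm_sq,
    real_inner_self_eq_norm_sq, hx]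
  ring

/-- At a transverse crossing, the scalar product and the orientation of the velocities are
determined up to a sign by the angle. -/
theorem IsLoop.crossing_angle (hγ : IsLoop γ T) (hσ : IsLoop σ S) {t s ν : ℝ} (h : γ t = σ s)
    (hν : InnerProductGeometry.angle (deriv γ t) (deriv σ s) = ν) :
    inner ℝ (deriv γ t) (deriv σ s) = 2 * cos ν ∧
      orient (γ t) (deriv γ t) (deriv σ s) ^ 2 = (2 * sin ν) ^ 2 := by
  have h1 : inner ℝ (deriv γ t) (deriv σ s) = 2 * cos ν := by
    rw [← InnerProductGeometry.cos_angle_mul_norm_mul_norm, hν, hγ.speed, hσ.speed,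
      mul_self_sqrt zero_le_two, mul_comm]
  refine ⟨h1, ?_⟩
  rw [orient_sq (hγ.mem_sphere t) (hγ.inner_deriv t) (by rw [h]; exact hσ.inner_deriv s), h1,
    hγ.speed, hσ.speed, sq_sqrt zero_le_two, mul_pow, mul_pow, sin_sq]
  ring

/-- The parameter of a point of a loop in the last period before a given one. -/
theorem IsLoop.exists_param (hγ : IsLoop γ T) {t t' : ℝ} (hne : γ t' ≠ γ t) :
    ∃ t₁, t ∈ Ioo t₁ (t₁ + T) ∧ γ t₁ = γ t' ∧ deriv γ t₁ = deriv γ t' := by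
  have hper : Function.Periodic (fun t => (γ t, deriv γ t)) T := fun t =>
    Prod.ext (hγ.periodic t) (hγ.deriv_periodic t)
  obtain ⟨t₁, ht₁, e⟩ := hper.exists_mem_Ico hγ.pos t' (t - T)
  have e1 : γ t' = γ t₁ := congrArg Prod.fst e
  refine ⟨t₁, ⟨by linarith [ht₁.2], lt_of_le_of_ne (by linarith [ht₁.1]) fun h => hne ?_⟩,
    e1.symm, (congrArg Prod.snd e).symm⟩
  rw [e1, ← hγ.periodic t₁, ← h]

/-- For a joint Bohr-Sommerfeld value the integrand of the pairing is periodic in both variables,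
so that the periods of integration can be moved. -/
theorem integral_pairing_shift (hγ : IsLoop γ T) (hσ : IsLoop σ S) (hc : IsParallelLift c γ)
    (hd : IsParallelLift d σ) {k : ℕ} (hk : holonomy c T ^ k = 1) (hk' : holonomy d S ^ k = 1)
    (a b : ℝ) :
    ∫ t in (0 : ℝ)..T, ∫ s in (0 : ℝ)..S, inner ℂ (d s) (c t) ^ k =
      ∫ t in a..(a + T), ∫ s in b..(b + S), inner ℂ (d s) (c t) ^ k := by
  have h1 : ∀ t, ∫ s in (0 : ℝ)..S, inner ℂ (d s) (c t) ^ k =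
      ∫ s in b..(b + S), inner ℂ (d s) (c t) ^ k := fun t => by
    have hper : Function.Periodic (fun s => (inner ℂ (d s) (c t) : ℂ) ^ k) S := fun s => by
      simp only
      rw [hd.add_period hσ.periodic, inner_smul_left, mul_pow, ← map_pow, hk', map_one, one_mul]
    simpa using hper.intervalIntegral_add_eq 0 b
  simp only [h1]
  have hper : Function.Periodic
      (fun t => ∫ s in b..(b + S), (inner ℂ (d s) (c t) : ℂ) ^ k) T := fun t => by
    simp only [hc.add_period hγ.periodic, inner_smul_right, mul_pow, hk, one_mul]
  simpa using hper.intervalIntegral_add_eq 0 a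

/-- The contributions of the two crossings are complex conjugates of each other. -/
theorem exp_add_exp_eq_cos (r : ℝ) (k : ℕ) (A ν : ℝ) :
    Complex.exp (Complex.I * (A / 4 : ℝ)) ^ k *
        (√(2 / r) * Complex.exp (Complex.I * (ν / 2 - π / 4 : ℝ))) +
      Complex.exp (-(Complex.I * (A / 4 : ℝ))) ^ k *
        (√(2 / r) * Complex.exp (-(Complex.I * (ν / 2 - π / 4 : ℝ)))) =
      ((√(8 / r) * cos (k * A / 4 + ν / 2 - π / 4) : ℝ) : ℂ) := by
  have h1 : √(8 / r) = 2 * √(2 / r) := by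
    rw [show 8 / r = 2 ^ 2 * (2 / r) by ring, sqrt_mul (by positivity), sqrt_sq zero_le_two]
  have h2 : ∀ z w : ℂ, Complex.exp z ^ k * (√(2 / r) * Complex.exp w) =
      √(2 / r) * Complex.exp (k * z + w) := fun z w => by
    rw [Complex.exp_add, Complex.exp_nat_mul]
    ring
  rw [h2, h2, h1, Complex.ofReal_mul, Complex.ofReal_cos, Complex.cos]
  have e1 : (k : ℂ) * (Complex.I * (A / 4 : ℝ)) + Complex.I * (ν / 2 - π / 4 : ℝ) =
      ((k * A / 4 + ν / 2 - π / 4 : ℝ) : ℂ) * Complex.I := by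
    push_cast
    ring
  have e2 : (k : ℂ) * -(Complex.I * (A / 4 : ℝ)) + -(Complex.I * (ν / 2 - π / 4 : ℝ)) =
      -((k * A / 4 + ν / 2 - π / 4 : ℝ) : ℂ) * Complex.I := by
    push_cast
    ring
  rw [e1, e2]
  push_cast
  ring

end CoherentLoop

end

theorem corollary4p3
    -- the loops `γ`, `σ` of lengths `T`, `S`, and parallel lifts `c`, `d` of them
    (γ σ : ℝ → E3) (T S : ℝ) (hγ : IsLoop γ T) (hσ : IsLoop σ S)
    (c d : ℝ → C2) (hc : IsParallelLift c γ) (hd : IsParallelLift d σ)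
    (hγBS : ∃ k, IsBohrSommerfeld c T k) (hσBS : ∃ k, IsBohrSommerfeld d S k)
    -- they meet exactly in the two points `p` and `n`
    (p n : E3) (hpn : p ≠ n) (hinter : range γ ∩ range σ = {p, n})
    (tp sp tn sn : ℝ) (hγp : γ tp = p) (hσp : σ sp = p) (hγn : γ tn = n) (hσn : σ sn = n)
    -- transversely, with positive orientation at `p`, and at equal angle `ν`
    (hp : 0 < orient p (deriv γ tp) (deriv σ sp))
    (hn : orient n (deriv γ tn) (deriv σ sn) ≠ 0)
    (ν : ℝ) (hνp : InnerProductGeometry.angle (deriv γ tp) (deriv σ sp) = ν)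
    (hνn : InnerProductGeometry.angle (deriv γ tn) (deriv σ sn) = ν)
    -- the area to the right of `γ` and to the left of `σ`
    (A : ℝ) (hA : A = (sphereArea (rightRegion γ ∩ leftRegion σ)).toReal)
    -- the relative phase of the lifts at `p`
    (hphase : c tp = Complex.exp (Complex.I * (A / 4 : ℝ)) • d sp) :
    Tendsto
      (fun k : ℕ => inner ℂ (loopState k c T) (loopState k d S) -
        ((√(8 / sin ν) * cos (k * A / 4 + ν / 2 - π / 4) : ℝ) : ℂ))
      (jointBohrSommerfeld c T d S) (𝓝 0) := by
  subst hσp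
  obtain ⟨t₁, ht, e1, e1'⟩ := hγ.exists_param (t := tp) (t' := tn) (by rw [hγn, hγp]; exact hpn.symm)
  obtain ⟨s₁, hs, e2, e2'⟩ := hσ.exists_param (t := sp) (t' := sn) (by rw [hσn]; exact hpn.symm)
  rw [← e1'] at hn hνn
  rw [← e2'] at hn hνn
  have hmeet₁ : γ t₁ = σ s₁ := by rw [e1, e2, hγn, hσn]
  have hpair : IsCrossingPair γ σ T S t₁ tp s₁ sp :=
    { loop_left := hγ
      loop_right := hσ
      mem_left := ht
      mem_right := hs
      meet₀ := hγp
      meet₁ := hmeet₁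
      inter := by rw [hinter, hγp, e1, hγn]
      pos := by rw [hγp]; exact hp }
  rw [← hγn, ← e1] at hn
  rw [← hγp] at hp
  -- the orientations at the two crossings are `2 sin ν` and `-2 sin ν`, which forces `0 < ν < π`
  obtain ⟨hi₀, ho₀⟩ := hγ.crossing_angle hσ hγp hνp
  obtain ⟨hi₁, ho₁⟩ := hγ.crossing_angle hσ hmeet₁ hνn
  have hν0 : 0 ≤ ν := hνp ▸ InnerProductGeometry.angle_nonneg _ _
  have hνπ : ν ≤ π := hνp ▸ InnerProductGeometry.angle_le_pi _ _
  have hsin0 : 0 ≤ sin ν := sin_nonneg_of_nonneg_of_le_pi hν0 hνπ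
  have hsin : 0 < sin ν := by
    refine lt_of_le_of_ne hsin0 fun h0 => ?_
    rw [← h0, mul_zero, zero_pow two_ne_zero] at ho₀
    exact hp.ne' (pow_eq_zero_iff two_ne_zero |>.1 ho₀)
  have hν0' : 0 < ν := lt_of_le_of_ne hν0 fun h0 => by simp [← h0] at hsin
  have hνπ' : ν < π := lt_of_le_of_ne hνπ fun h0 => by simp [h0] at hsin
  have ho₀' : orient (γ tp) (deriv γ tp) (deriv σ sp) = 2 * sin ν := by
    rcases sq_eq_sq_iff_eq_or_eq_neg.1 ho₀ with h | h
    · exact h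
    · linarith
  have hneg := lt_of_le_of_ne (hpair.orient_nonpos hc) hn
  have ho₁' : orient (γ t₁) (deriv γ t₁) (deriv σ s₁) = -(2 * sin ν) := by
    rcases sq_eq_sq_iff_eq_or_eq_neg.1 ho₁ with h | h
    · linarith
    · exact h
  -- the relative phase of the lifts goes from `e^{iA/4}` at `p` to `e^{iA/4 - iA/2}` at `n`
  have hv : c t₁ = (inner ℂ (d s₁) (c t₁) : ℂ) • d s₁ :=
    eq_smul_of_hopf_eq (hc.norm_eq _) (hd.norm_eq _) (by rw [hc.lies_over, hd.lies_over, hmeet₁])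
  have hphase₁ := hpair.phase_eq hc hd hphase hv
  have hv' : c t₁ = Complex.exp (-(Complex.I * (A / 4 : ℝ))) • d s₁ := by
    rw [hv]
    congr 1
    rw [hphase₁, between, ← hA, ← Complex.exp_add]
    congr 1
    push_cast
    ring
  -- periods with both meeting points in their interiors
  set a := (t₁ + tp) / 2 - T / 2 with ha
  set b := (s₁ + sp) / 2 - S / 2 with hb
  have hta : tp ∈ Ioo a (a + T) := ⟨by linarith [ht.1, ht.2], by linarith [ht.1, ht.2]⟩
  have hta₁ : t₁ ∈ Ioo a (a + T) := ⟨by linarith [ht.1, ht.2], by linarith [ht.1, ht.2, hγ.pos]⟩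
  have hsb : sp ∈ Ioo b (b + S) := ⟨by linarith [hs.1, hs.2], by linarith [hs.1, hs.2]⟩
  have hsb₁ : s₁ ∈ Ioo b (b + S) := ⟨by linarith [hs.1, hs.2], by linarith [hs.1, hs.2, hσ.pos]⟩
  have huniq : ∀ {α : ℝ → E3} {R a r r' : ℝ}, IsLoop α R → r' ∈ Ioo a (a + R) →
      r ∈ Icc a (a + R) → α r = α r' → r = r' := fun hα hr' hr e =>
    hα.eq_of_abs_sub_lt e.symm
      (abs_lt.2 ⟨by linarith [hr.1, hr'.2], by linarith [hr.2, hr'.1]⟩)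
  have hwin : ∀ t ∈ Icc a (a + T), ∀ s ∈ Icc b (b + S), γ t = σ s →
      (t = tp ∧ s = sp) ∨ (t = t₁ ∧ s = s₁) := by
    intro t ht' s hs' e
    have hmem : γ t ∈ range γ ∩ range σ := ⟨⟨t, rfl⟩, ⟨s, e.symm⟩⟩
    rw [hinter] at hmem
    rcases hmem with h | h
    · exact Or.inl ⟨huniq hγ hta ht' (h.trans hγp.symm), huniq hσ hsb hs' (e.symm.trans h)⟩
    · have h' : γ t = n := h
      exact Or.inr ⟨huniq hγ hta₁ ht' (by rw [h', e1, hγn]),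
        huniq hσ hsb₁ hs' (by rw [← e, h', e2, hσn])⟩
  have key := laplace_period hγ hσ hc hd hν0' hνπ' hta hta₁ hsb hsb₁ ht.1.ne' hwin hphase hv'
    ho₀' ho₁' hi₀ hi₁
  refine (key.mono_left (show jointBohrSommerfeld c T d S ≤ atTop from inf_le_left)).congr' ?_
  have hBS : ∀ᶠ k in jointBohrSommerfeld c T d S,
      IsBohrSommerfeld c T k ∧ IsBohrSommerfeld d S k :=
    mem_inf_of_right (mem_principal_self _)
  filter_upwards [hBS] with k hk
  rw [inner_loopState k hc.continuous hd.continuous,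
    integral_pairing_shift hγ hσ hc hd hk.1.2 hk.2.2 a b, exp_add_exp_eq_cos]
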